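/- Let $d\in\mathbb N$ and let $\mathscr R$ be the family of open sets $A\subsetneq\mathbb R^d$ that are increasing ($x\in A$, $y\in[0,\infty)^d$ imply $x+y\in A$), have convex complement, and satisfy $0\notin\overline A$. On a probability space consider: * claims $X^{(1)},X^{(2)},\dots$: random vectors that are a.s. in $[0,\infty)^d$, identically distributed with law $F$; write $X$ for a vector with law $F$ and $Y_A^{(i)}=\sup\{u: X^{(i)}\in uA\}$; * arrival times $T_1\le T_2\le\dots$ of a renewal process $N(t)=\#\{i:T_i\le t\}$ (partial sums of i.i.d. nonnegative inter-arrival times that are not a.s. zero), with renewal function $\lambda(t)=\sum_{i\ge1}P[T_i\le t]$, $t\in[0,\infty]$, and $\Lambda=\{t\in[0,\infty]:\lambda(t)>0\}$; * a càdlàg real process $(\xi(t))_{t\ge0}$ with $\xi(0)=0$. The claim sequence, the arrival times and $\xi$ are mutually independent. Put $D(t)=\sum_{i=1}^{N(t)}X^{(i)}e^{-\xi(T_i)}$ for $t\in[0,\infty]$. Let $A\in\mathscr R$. Assume $F\in MRV(\alpha,V,\mu)$ with $0<\alpha<\infty$: $V$ is a distribution on $\mathbb R$ with $\overline V(tx)/\overline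 V(x)\to t^{-\alpha}$ for all $t>0$, and $\mu\ne0$ is a measure on $[0,\infty)^d\setminus\{0\}$, finite away from the origin, such that $P[X\in xB]/\overline V(x)\to\mu(B)$ as $x\to\infty$ for every Borel set $B$ with $0\notin\overline B$ and $\mu(\partial B)=0$. Assume $\mu(A)>0$. Assume that the claims are tail asymptotically independent on $A$: for all $i\ne j$, $P[Y_A^{(i)}>x_i\mid Y_A^{(j)}>x_j]\to0$ as $x_i\wedge x_j\to\infty$. Assume finally that there are $0<k_1<\alpha<k_2<\infty$ such that * if $\alpha>1$: $\sum_{i\ge1}\big(E[e^{-k_1\xi(T_i)}]^{1/k_1}\vee E[e^{-k_2\xi(T_i)}]^{1/k_2}\big)<\infty$; * if $\alpha=1$: $\sum_{i\ge1}\big(E[e^{-k_1\xi(T_i)}]\vee E[e^{-k_2\xi(T_i)}]\big)^{1/k_2}<\infty$; * if $\alpha<1$: $k_2<1$ and $\sum_{i\ge1}\big(E[e^{-k_1\xi(T_i)}]\vee E[e^{-k_2\xi(T_i)}]\big)<\infty$. Then the series $D(\infty)$ converges a.s., and $$P[D(t)\in xA]\;\sim\;P[X\in xA]\int_0^tE\big[e^{-\alpha\xi(s)}\big]\,\lambda(ds)\qquad(x\to\infty)\tag{1}$$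 holds uniformly for $t\in[t_0,\infty]$ for every $t_0\in\Lambda$ (hence uniformly on all of $\Lambda$ if $\Lambda$ contains its infimum). If moreover, for some $k>\alpha$ and some $t_1\in\Lambda$, $\sup\{E[e^{-k\xi(s)}]: s\in\Lambda,\ s<\infty,\ s\le t_1\}<\infty$ (for instance, if $\xi$ is a.s. bounded below by a constant on $[0,t_1]$ for some finite $t_1\in\Lambda$), then (1) holds uniformly for $t\in\Lambda$, including $t=\infty$. Here "uniformly for $t\in\Delta$" means that the supremum over $t\in\Delta$ of the absolute value of the ratio of the two sides minus $1$ tends to $0$. -/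

import Mathlib

open Set Filter Topology MeasureTheory ProbabilityTheory
open scoped NNReal ENNReal Pointwise

noncomputable section

/-- The family `𝓡` of rare sets: proper open increasing subsets of `ℝᵈ` whose complement is convex
and whose closure does not contain the origin. -/
structure IsRareSet {d : ℕ} (A : Set (Fin d → ℝ)) : Prop where
  ne_univ : A ≠ Set.univ
  isOpen : IsOpen A
  increasing : ∀ x ∈ A, ∀ y : Fin d → ℝ, 0 ≤ y → x + y ∈ A
  convex_compl : Convex ℝ Aᶜ
  zero_notMem_closure : (0 : Fin d → ℝ) ∉ closure A

/-- `Y_A = sup {u : x ∈ u A}` as a function of the vector `x`. -/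
def rareLevel {d : ℕ} (A : Set (Fin d → ℝ)) (x : Fin d → ℝ) : ℝ :=
  sSup {u : ℝ | x ∈ u • A}

/-- The distribution `V` on the real line has a regularly varying tail with index `-α`. -/
def IsRegVar (V : Measure ℝ) (α : ℝ) : Prop :=
  ∀ t : ℝ, 0 < t →
    Tendsto (fun x : ℝ => V.real (Ioi (t * x)) / V.real (Ioi x)) atTop (𝓝 (t ^ (-α)))

/-- `F ∈ MRV(α, V, ν)`: standard multivariate regular variation on the positive orthant. The limit
measure `ν` lives on the orthant without the origin, is finite away from the origin, is not zero,
and `P[X ∈ x B] / P[V > x] → ν B` for every Borel `ν`-continuity set `B` bounded away from the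
origin (vague convergence). -/
structure IsMRV {d : ℕ} (F : Measure (Fin d → ℝ)) (α : ℝ) (V : Measure ℝ)
    (ν : Measure (Fin d → ℝ)) : Prop where
  index_pos : 0 < α
  isProbabilityMeasure : IsProbabilityMeasure V
  regVar : IsRegVar V α
  orthant : ν {x | 0 ≤ x ∧ x ≠ 0}ᶜ = 0
  finite_away : ∀ ε : ℝ, 0 < ε → ν {x | ε ≤ ‖x‖} < ∞
  ne_zero : ν ≠ 0
  tendsto : ∀ B : Set (Fin d → ℝ), MeasurableSet B → (0 : Fin d → ℝ) ∉ closure B →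
    ν (frontier B) = 0 →
    Tendsto (fun x : ℝ => F (x • B) / V (Ioi x)) atTop (𝓝 (ν B))

section Model

variable {Ω : Type*} [MeasurableSpace Ω]

/-- Tail asymptotic independence on `A`: for `i ≠ j`,
`P[Y_A⁽ⁱ⁾ > x_i | Y_A⁽ʲ⁾ > x_j] → 0` as `min x_i x_j → ∞`. -/
def IsTAI {d : ℕ} (P : Measure Ω) (A : Set (Fin d → ℝ)) (X : ℕ → Ω → Fin d → ℝ) : Prop :=
  ∀ i j : ℕ, i ≠ j →
    Tendsto (fun p : ℝ × ℝ =>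
        ProbabilityTheory.cond P {ω | p.2 < rareLevel A (X j ω)} {ω | p.1 < rareLevel A (X i ω)})
      (atTop ×ˢ atTop) (𝓝 0)

/-- `T` is the sequence of arrival times of a renewal process: `T i` is the sum of the first `i + 1`
terms of an i.i.d. sequence of nonnegative inter-arrival times that are not a.s. zero. -/
def IsRenewalTimes (P : Measure Ω) (T : ℕ → Ω → ℝ≥0) : Prop :=
  ∃ τ : ℕ → Ω → ℝ≥0,
    (∀ i, Measurable (τ i)) ∧ iIndepFun τ P ∧ (∀ i, IdentDistrib (τ i) (τ 0) P P) ∧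
    ¬ (∀ᵐ ω ∂P, τ 0 ω = 0) ∧
    ∀ i ω, T i ω = ∑ j ∈ Finset.range (i + 1), τ j ω

/-- A real process, started at zero, whose paths are right-continuous with left limits. -/
structure IsCadlagProcess (ξ : ℝ≥0 → Ω → ℝ) : Prop where
  measurable : ∀ t, Measurable (ξ t)
  init : ∀ ω, ξ 0 ω = 0
  right_continuous : ∀ ω t, ContinuousWithinAt (fun s => ξ s ω) (Ici t) t
  left_limits : ∀ ω t, ∃ l : ℝ, Tendsto (fun s => ξ s ω) (𝓝[<] t) (𝓝 l)

/-- Mutual independence of the claims, the arrival times and the return process. -/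
def IndepIngredients {d : ℕ} (P : Measure Ω) (X : ℕ → Ω → Fin d → ℝ) (T : ℕ → Ω → ℝ≥0)
    (ξ : ℝ≥0 → Ω → ℝ) : Prop :=
  iIndep ![MeasurableSpace.comap (fun ω i => X i ω) inferInstance,
    MeasurableSpace.comap (fun ω i => T i ω) inferInstance,
    MeasurableSpace.comap (fun ω t => ξ t ω) inferInstance] P

/-- The renewal function `λ(t) = E[N(t)] = ∑ᵢ P[Tᵢ ≤ t]`, for `t ∈ [0, ∞]`. -/
def renewalFunction (P : Measure Ω) (T : ℕ → Ω → ℝ≥0) (t : ℝ≥0∞) : ℝ≥0∞ :=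
  ∑' i, P {ω | (T i ω : ℝ≥0∞) ≤ t}

/-- The renewal measure `λ(ds)`, whose distribution function is the renewal function. -/
def renewalMeasure (P : Measure Ω) (T : ℕ → Ω → ℝ≥0) : Measure ℝ≥0 :=
  Measure.sum fun i => P.map (T i)

/-- The set `Λ = {t ∈ [0, ∞] : λ(t) > 0}`. -/
def renewalSupport (P : Measure Ω) (T : ℕ → Ω → ℝ≥0) : Set ℝ≥0∞ :=
  {t | 0 < renewalFunction P T t}

/-- The moment `E[e^{-k ξ(S)}] ∈ [0, ∞]` at a random time `S`. -/
def discountMoment (P : Measure Ω) (ξ : ℝ≥0 → Ω → ℝ) (k : ℝ) (S : Ω → ℝ≥0) : ℝ≥0∞ :=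
  ∫⁻ ω, ENNReal.ofReal (Real.exp (-k * ξ (S ω) ω)) ∂P

/-- The moment summability conditions on the discount factors at the arrival times. -/
def MomentSummability (P : Measure Ω) (T : ℕ → Ω → ℝ≥0) (ξ : ℝ≥0 → Ω → ℝ) (α : ℝ) : Prop :=
  (1 < α → ∃ k₁ k₂ : ℝ, 0 < k₁ ∧ k₁ < α ∧ α < k₂ ∧
    ∑' i, max (discountMoment P ξ k₁ (T i) ^ (1 / k₁))
      (discountMoment P ξ k₂ (T i) ^ (1 / k₂)) < ∞) ∧
  (α = 1 → ∃ k₁ k₂ : ℝ, 0 < k₁ ∧ k₁ < α ∧ α < k₂ ∧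
    ∑' i, max (discountMoment P ξ k₁ (T i) ^ (1 / k₂))
      (discountMoment P ξ k₂ (T i) ^ (1 / k₂)) < ∞) ∧
  (α < 1 → ∃ k₁ k₂ : ℝ, 0 < k₁ ∧ k₁ < α ∧ α < k₂ ∧ k₂ < 1 ∧
    ∑' i, max (discountMoment P ξ k₁ (T i)) (discountMoment P ξ k₂ (T i)) < ∞)

/-- Some moment of the discount factor of order larger than `α` is bounded on an initial piece
`{s ∈ Λ : s ≤ t₁}` of `Λ`, with `t₁ ∈ Λ`. -/
def InitialMomentBound (P : Measure Ω) (T : ℕ → Ω → ℝ≥0) (ξ : ℝ≥0 → Ω → ℝ) (α : ℝ) : Prop :=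
  ∃ k : ℝ, α < k ∧ ∃ t₁ ∈ renewalSupport P T, ∃ C : ℝ≥0,
    ∀ s : ℝ≥0, (s : ℝ≥0∞) ∈ renewalSupport P T → (s : ℝ≥0∞) ≤ t₁ →
      discountMoment P ξ k (fun _ => s) ≤ C

/-- The discounted aggregate claims `D(t) = ∑_{i ≤ N(t)} X⁽ⁱ⁾ e^{-ξ(Tᵢ)}`, for `t ∈ [0, ∞]`; the
`i`-th claim is counted by `N(t)` exactly when `Tᵢ ≤ t`. -/
def discountedClaims {d : ℕ} (X : ℕ → Ω → Fin d → ℝ) (T : ℕ → Ω → ℝ≥0) (ξ : ℝ≥0 → Ω → ℝ)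
    (t : ℝ≥0∞) (ω : Ω) : Fin d → ℝ :=
  ∑' i, {j : ℕ | (T j ω : ℝ≥0∞) ≤ t}.indicator
    (fun j => Real.exp (-ξ (T j ω) ω) • X j ω) i

/-- The integral `∫_0^t E[e^{-α ξ(s)}] λ(ds)`, for `t ∈ [0, ∞]`. -/
def discountIntegral (P : Measure Ω) (T : ℕ → Ω → ℝ≥0) (ξ : ℝ≥0 → Ω → ℝ) (α : ℝ)
    (t : ℝ≥0∞) : ℝ≥0∞ :=
  ∫⁻ s in {s : ℝ≥0 | (s : ℝ≥0∞) ≤ t}, discountMoment P ξ α (fun _ => s) ∂(renewalMeasure P T)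

end Model

/-- `f(x; t) ∼ g(x; t)` as `x → ∞`, uniformly for `t ∈ Δ`: `sup_{t ∈ Δ} |f / g - 1| → 0`. -/
def UniformlyEquivalent (f g : ℝ → ℝ≥0∞ → ℝ) (Δ : Set ℝ≥0∞) : Prop :=
  TendstoUniformlyOn (fun x t => f x t / g x t) (fun _ => 1) atTop Δ

end

/-! The complement of `A` is closed, convex and a neighbourhood of 0, so its gauge `p` is continuous
and sublinear, and `x • A = {p > x}` for `x > 0`. Write `θᵢ = e^{-ξ(Tᵢ)}`. Since `A` is increasing,
`D(t) ∈ xA` holds as soon as one claim with `Tᵢ ≤ t` has `θᵢ p(Xᵢ) > x`; since `p` is subadditive,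
it forces `∑ θᵢ p(Xᵢ) > x` over those claims. Multivariate regular variation makes `G(x) = P[p(X) >
x]` regularly varying of index `-α`, and what remains is to show that the scalar maximum and sum
have the same tail.

For one claim, independence gives `P[Tᵢ ≤ t, θᵢ p(Xᵢ) > x] = E[G(x/θᵢ); Tᵢ ≤ t]`. By
`IsRegVarTail.uniform`, `G(x/s)` differs from `s^α G(x)` by at most `η (s^k₁ + s^k₂) G(x)` for all
`s > 0` at once, so the error is uniform in `t`. Summing over `i` and conditioning on the arrival
times produces the integral (`discountIntegral_eq`). Two claims are rarely large together
(`pair_le`). Remainders of the series are negligible by the moment conditions: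
`hasNegligibleTails_of_one_lt` uses excesses over levels proportional to `L^k₂` norms when `α > 1`,
and `hasNegligibleTails_of_truncation` uses truncation and Minkowski when `α ≤ 1`. This gives
`measure_sum_gt_le` and `le_measure_exists_gt`, with error `ε G(x)` uniformly in `t`.

Such an error is a relative one where the integral is bounded below, hence on `[t₀, ∞]`. If `Λ`
misses its infimum, the integral vanishes there. With `q = P[T₀ ≤ t]` one has `P[Tᵢ ≤ t] ≤ q^(i+1)`,
so all that involves a claim beyond the first costs `O(q² G(x))` (`bounds_of_small`), while the main
term is at least `c q G(x)`, because right-continuity and Fatou keep `E[e^{-αξ(s)}]` away from 0 to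
the right of the infimum (`exists_le_discountMoment`). -/

noncomputable section

/-! ### Regularly varying tails: Potter bounds and uniform convergence -/

/-- A tail function `G = P[Y > ·]` that is regularly varying with index `-α`. -/
structure IsRegVarTail (G : ℝ → ℝ) (α : ℝ) : Prop where
  index_pos : 0 < α
  antitone : Antitone G
  nonneg : ∀ x, 0 ≤ G x
  le_one : ∀ x, G x ≤ 1
  tendsto : ∀ t : ℝ, 0 < t → Tendsto (fun x => G (t * x) / G x) atTop (𝓝 (t ^ (-α)))

namespace IsRegVarTail

variable {G : ℝ → ℝ} {α : ℝ}

lemma pos (h : IsRegVarTail G α) (x : ℝ) : 0 < G x := by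
  have h1 := h.tendsto 1 one_pos
  simp only [one_mul, Real.one_rpow] at h1
  have h2 : ∀ᶠ y in atTop, (0 : ℝ) < G y / G y := h1.eventually (lt_mem_nhds one_pos)
  obtain ⟨y, hy, hxy⟩ := (h2.and (eventually_ge_atTop x)).exists
  refine lt_of_lt_of_le ?_ (h.antitone hxy)
  refine lt_of_le_of_ne (h.nonneg y) fun h0 => ?_
  rw [← h0] at hy
  simp at hy

/-- An exponent beyond `α` leaves room to turn the limit `2 ^ (-α)` into a one-step inequality;
iterating it along powers of 2 gives the Potter bounds. -/
lemma exists_le_two_mul (h : IsRegVarTail G α) {k : ℝ} (hk : α < k) :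
    ∃ x₀ : ℝ, 0 < x₀ ∧ ∀ z, x₀ ≤ z → G z ≤ 2 ^ k * G (2 * z) := by
  have h1 := h.tendsto 2 two_pos
  have h2 : (2 : ℝ) ^ (-k) < 2 ^ (-α) :=
    Real.rpow_lt_rpow_of_exponent_lt one_lt_two (by linarith)
  obtain ⟨x₀, hx₀⟩ := eventually_atTop.1 (h1.eventually (lt_mem_nhds h2))
  refine ⟨max x₀ 1, by positivity, fun z hz => ?_⟩
  have h3 := hx₀ z (le_trans (le_max_left _ _) hz)
  rw [lt_div_iff₀ (h.pos z), Real.rpow_neg two_pos.le] at h3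
  have h4 : (0 : ℝ) < 2 ^ k := by positivity
  rw [inv_mul_lt_iff₀ h4] at h3
  exact h3.le

lemma exists_two_mul_le (h : IsRegVarTail G α) {k : ℝ} (hk : k < α) :
    ∃ x₀ : ℝ, 0 < x₀ ∧ ∀ z, x₀ ≤ z → G (2 * z) ≤ 2 ^ (-k) * G z := by
  have h1 := h.tendsto 2 two_pos
  have h2 : (2 : ℝ) ^ (-α) < 2 ^ (-k) :=
    Real.rpow_lt_rpow_of_exponent_lt one_lt_two (by linarith)
  obtain ⟨x₀, hx₀⟩ := eventually_atTop.1 (h1.eventually (gt_mem_nhds h2))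
  refine ⟨max x₀ 1, by positivity, fun z hz => ?_⟩
  have h3 := hx₀ z (le_trans (le_max_left _ _) hz)
  rw [div_lt_iff₀ (h.pos z)] at h3
  exact h3.le

/-- Upper Potter bound, on a neighbourhood of infinity. -/
lemma exists_le_rpow_mul (h : IsRegVarTail G α) {k : ℝ} (hk : α < k) :
    ∃ x₀ : ℝ, 0 < x₀ ∧ ∀ z, x₀ ≤ z → ∀ s, 1 ≤ s → G z ≤ 2 ^ k * s ^ k * G (s * z) := by
  obtain ⟨x₀, hx₀, H⟩ := h.exists_le_two_mul hk
  have hk0 : 0 < k := h.index_pos.trans hk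
  refine ⟨x₀, hx₀, fun z hz s hs => ?_⟩
  have hz0 : 0 < z := hx₀.trans_le hz
  have key : ∀ n : ℕ, G z ≤ ((2 : ℝ) ^ n) ^ k * G (2 ^ n * z) := by
    intro n
    induction n with
    | zero => simp
    | succ n ih =>
      have h1 : z ≤ 2 ^ n * z := le_mul_of_one_le_left hz0.le (one_le_pow₀ one_le_two)
      have h2 := H (2 ^ n * z) (hz.trans h1)
      refine ih.trans ?_
      rw [pow_succ', Real.mul_rpow two_pos.le (by positivity), mul_assoc 2]
      calc ((2 : ℝ) ^ n) ^ k * G (2 ^ n * z)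
          ≤ ((2 : ℝ) ^ n) ^ k * (2 ^ k * G (2 * (2 ^ n * z))) := by gcongr
        _ = _ := by ring
  obtain ⟨n, hn1, hn2⟩ := exists_nat_pow_near hs one_lt_two
  refine (key (n + 1)).trans ?_
  have h1 : ((2 : ℝ) ^ (n + 1)) ^ k ≤ 2 ^ k * s ^ k := by
    rw [← Real.mul_rpow two_pos.le (by positivity)]
    refine Real.rpow_le_rpow (by positivity) ?_ hk0.le
    rw [pow_succ']; gcongr
  have h2 : G (2 ^ (n + 1) * z) ≤ G (s * z) := h.antitone (by gcongr)
  exact mul_le_mul h1 h2 (h.nonneg _) (by positivity)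

/-- Upper Potter bound, on the whole positive half-line. -/
lemma potter_up (h : IsRegVarTail G α) {k : ℝ} (hk : α < k) :
    ∃ C : ℝ, 0 < C ∧ ∀ z, 0 < z → ∀ s, 1 ≤ s → G (z / s) ≤ C * s ^ k * G z := by
  obtain ⟨x₀, hx₀, H⟩ := h.exists_le_rpow_mul hk
  have hk0 : 0 < k := h.index_pos.trans hk
  have hG0 := h.pos x₀
  have h2k : (1 : ℝ) ≤ 2 ^ k := Real.one_le_rpow one_le_two hk0.le
  refine ⟨2 ^ k / G x₀, by positivity, fun z hz s hs => ?_⟩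
  have hsk : (1 : ℝ) ≤ s ^ k := Real.one_le_rpow hs hk0.le
  have hs0 : 0 < s := by linarith
  have hGz := h.pos z
  rcases le_or_gt x₀ (z / s) with h1 | h1
  · have h2 := H (z / s) h1 s hs
    rw [mul_div_cancel₀ _ hs0.ne'] at h2
    refine h2.trans ?_
    have h3 : (2 : ℝ) ^ k ≤ 2 ^ k / G x₀ := le_div_self (by positivity) hG0 (h.le_one _)
    gcongr
  -- Here the bound near infinity is not available at `z / s`. Since `G ≤ 1`, it suffices to compare
  -- `G x₀` with `G z`, and the ratio `z / x₀` is less than `s`.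
  · refine (h.le_one _).trans ?_
    have hgoal : G x₀ ≤ 2 ^ k * s ^ k * G z → 1 ≤ 2 ^ k / G x₀ * s ^ k * G z := by
      intro h3
      rw [div_mul_eq_mul_div, div_mul_eq_mul_div, le_div_iff₀ hG0, one_mul]
      exact h3
    apply hgoal
    rcases le_or_gt x₀ z with h2 | h2
    · have h3 := H x₀ le_rfl (z / x₀) ((one_le_div hx₀).2 h2)
      rw [div_mul_cancel₀ _ hx₀.ne'] at h3
      refine h3.trans ?_
      have h4 : z / x₀ ≤ s := by
        rw [div_lt_iff₀ hs0] at h1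
        rw [div_le_iff₀ hx₀]; linarith
      gcongr
    · calc G x₀ ≤ G z := h.antitone h2.le
        _ = 1 * 1 * G z := by ring
        _ ≤ _ := by gcongr

/-- Lower Potter bound. -/
lemma potter_down (h : IsRegVarTail G α) {k : ℝ} (hk0 : 0 < k) (hk : k < α) :
    ∃ C x₀ : ℝ, 0 < C ∧ 0 < x₀ ∧ ∀ z, x₀ ≤ z → ∀ s, 1 ≤ s → G (s * z) ≤ C * s ^ (-k) * G z := by
  obtain ⟨x₀, hx₀, H⟩ := h.exists_two_mul_le hk
  refine ⟨2 ^ k, x₀, by positivity, hx₀, fun z hz s hs => ?_⟩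
  have hz0 : 0 < z := hx₀.trans_le hz
  have hs0 : 0 < s := by linarith
  have key : ∀ n : ℕ, G (2 ^ n * z) ≤ ((2 : ℝ) ^ n) ^ (-k) * G z := by
    intro n
    induction n with
    | zero => simp
    | succ n ih =>
      have h1 : z ≤ 2 ^ n * z := le_mul_of_one_le_left hz0.le (one_le_pow₀ one_le_two)
      have h2 := H (2 ^ n * z) (hz.trans h1)
      rw [pow_succ', Real.mul_rpow two_pos.le (by positivity), mul_assoc 2]
      refine h2.trans ?_
      calc (2 : ℝ) ^ (-k) * G (2 ^ n * z)
          ≤ (2 : ℝ) ^ (-k) * (((2 : ℝ) ^ n) ^ (-k) * G z) := by gcongr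
        _ = _ := by ring
  obtain ⟨n, hn1, hn2⟩ := exists_nat_pow_near hs one_lt_two
  calc G (s * z) ≤ G (2 ^ n * z) := h.antitone (by gcongr)
    _ ≤ ((2 : ℝ) ^ n) ^ (-k) * G z := key n
    _ ≤ 2 ^ k * s ^ (-k) * G z := by
      refine mul_le_mul_of_nonneg_right ?_ (h.nonneg z)
      have h1 : (2 : ℝ) ^ k = (2⁻¹) ^ (-k) := by
        rw [Real.rpow_neg (by positivity), Real.inv_rpow two_pos.le, inv_inv]
      rw [h1, ← Real.mul_rpow (by positivity) hs0.le]
      refine Real.rpow_le_rpow_of_nonpos (by positivity) ?_ (by linarith)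
      rw [pow_succ] at hn2
      linarith

/-- Two-sided Potter bound. -/
lemma potter (h : IsRegVarTail G α) {k₁ k₂ : ℝ} (hk₁ : 0 < k₁) (h1 : k₁ < α) (h2 : α < k₂) :
    ∃ C x₀ : ℝ, 0 < C ∧ 0 < x₀ ∧ ∀ x, x₀ ≤ x → ∀ s, 0 < s →
      G (x / s) ≤ C * (s ^ k₁ + s ^ k₂) * G x := by
  obtain ⟨C₁, x₁, hC₁, hx₁, H₁⟩ := h.potter_down hk₁ h1
  obtain ⟨C₂, hC₂, H₂⟩ := h.potter_up h2
  refine ⟨max C₁ C₂, x₁, by positivity, hx₁, fun x hx s hs => ?_⟩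
  have hGx := h.nonneg x
  have e1 : 0 < s ^ k₁ := by positivity
  have e2 : 0 < s ^ k₂ := by positivity
  rcases le_total 1 s with h3 | h3
  · refine (H₂ x (hx₁.trans_le hx) s h3).trans ?_
    gcongr
    · exact le_max_right _ _
    · linarith
  · have h4 := H₁ x hx s⁻¹ ((one_le_inv₀ hs).2 h3)
    rw [Real.inv_rpow hs.le, Real.rpow_neg hs.le, inv_inv, mul_comm s⁻¹, ← div_eq_mul_inv] at h4
    refine h4.trans ?_
    gcongr
    · exact le_max_left _ _
    · linarith

lemma tendsto_div (h : IsRegVarTail G α) {s : ℝ} (hs : 0 < s) :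
    Tendsto (fun x => G (x / s) / G x) atTop (𝓝 (s ^ α)) := by
  have h1 := h.tendsto s⁻¹ (by positivity)
  rw [Real.inv_rpow hs.le, Real.rpow_neg hs.le, inv_inv] at h1
  refine h1.congr fun x => ?_
  rw [div_eq_inv_mul x s]

/-- Uniform convergence theorem on compact intervals. -/
lemma uniform_Icc (h : IsRegVarTail G α) {a b : ℝ} (ha : 0 < a) {ε : ℝ} (hε : 0 < ε) :
    ∃ x₁ : ℝ, ∀ x, x₁ ≤ x → ∀ s ∈ Icc a b, |G (x / s) / G x - s ^ α| ≤ ε := by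
  have hloc : TendstoLocallyUniformlyOn (fun x s => G (x / s) / G x) (fun s : ℝ => s ^ α) atTop
      (Ioi 0) := by
    rw [tendstoLocallyUniformlyOn_iff_forall_tendsto]
    intro s₀ hs₀
    rw [IsOpen.nhdsWithin_eq isOpen_Ioi hs₀]
    have hs₀' : 0 < s₀ := hs₀
    have hcont : ContinuousAt (fun s : ℝ => s ^ α) s₀ :=
      Real.continuousAt_rpow_const _ _ (Or.inl hs₀'.ne')
    rw [Metric.uniformity_basis_dist.tendsto_right_iff]
    intro e he
    obtain ⟨δ, hδ, hδ'⟩ := Metric.continuousAt_iff.1 hcont (e / 4) (by positivity)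
    -- Since `s ↦ G (x / s)` is monotone, convergence at the two points `s₀ ± η` controls all `s`
    -- between them; continuity of the limit does the rest.
    set η := min (δ / 2) (s₀ / 2) with hη
    have hη0 : 0 < η := by positivity
    have hηδ : η < δ := lt_of_le_of_lt (min_le_left _ _) (by linarith)
    have hηs : η < s₀ := lt_of_le_of_lt (min_le_right _ _) (by linarith)
    have t1 := h.tendsto_div (s := s₀ - η) (by linarith)
    have t2 := h.tendsto_div (s := s₀ + η) (by linarith)
    have e1 := t1.eventually (Metric.ball_mem_nhds _ (show 0 < e / 4 by positivity))
    have e2 := t2.eventually (Metric.ball_mem_nhds _ (show 0 < e / 4 by positivity))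
    have e3 : ∀ᶠ s in 𝓝 s₀, dist s s₀ < η := Metric.ball_mem_nhds _ hη0
    filter_upwards [((e1.and e2).and (eventually_gt_atTop 0)).prod_mk e3] with p hp
    obtain ⟨⟨⟨q1, q2⟩, q0⟩, q3⟩ := hp
    have q3' := q3
    rw [Real.dist_eq, abs_lt] at q3
    have c1 := hδ' (x := s₀ - η) (by rw [Real.dist_eq, abs_lt]; constructor <;> linarith)
    have c2 := hδ' (x := s₀ + η) (by rw [Real.dist_eq, abs_lt]; constructor <;> linarith)
    have c3 := hδ' (x := p.2) (by linarith)
    have hG := h.pos p.1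
    have m1 : G (p.1 / (s₀ - η)) / G p.1 ≤ G (p.1 / p.2) / G p.1 := by
      refine div_le_div_of_nonneg_right (h.antitone ?_) hG.le
      exact div_le_div_of_nonneg_left q0.le (by linarith) (by linarith)
    have m2 : G (p.1 / p.2) / G p.1 ≤ G (p.1 / (s₀ + η)) / G p.1 := by
      refine div_le_div_of_nonneg_right (h.antitone ?_) hG.le
      exact div_le_div_of_nonneg_left q0.le (by linarith) (by linarith)
    simp only [Real.dist_eq, abs_lt] at q1 q2 c1 c2 c3 ⊢
    constructor <;> linarith
  have hunif := (tendstoLocallyUniformlyOn_iff_tendstoUniformlyOn_of_compact isCompact_Icc).1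
    (hloc.mono (show Icc a b ⊆ Ioi 0 from fun s hs => ha.trans_le hs.1))
  obtain ⟨x₁, hx₁⟩ := eventually_atTop.1 (Metric.tendstoUniformlyOn_iff.1 hunif ε hε)
  refine ⟨x₁, fun x hx s hs => ?_⟩
  have := hx₁ x hx s hs
  rw [dist_comm, Real.dist_eq] at this
  exact this.le

/-- Uniform convergence on the half-line, relative to a two-sided power weight. -/
lemma uniform (h : IsRegVarTail G α) {k₁ k₂ : ℝ} (hk₁ : 0 < k₁) (h1 : k₁ < α) (h2 : α < k₂)
    {η : ℝ} (hη : 0 < η) :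
    ∃ x₁ : ℝ, 0 < x₁ ∧ ∀ x, x₁ ≤ x → ∀ s, 0 < s →
      |G (x / s) - s ^ α * G x| ≤ η * (s ^ k₁ + s ^ k₂) * G x := by
  -- Potter's bound with exponents strictly inside `(k₁, k₂)` is of smaller order than the weight `s
  -- ^ k₁ + s ^ k₂` at both 0 and infinity, so only a compact interval `[B⁻¹, B]` needs uniform
  -- convergence.
  obtain ⟨l₁, hl₁, hl₁'⟩ := exists_between h1
  obtain ⟨l₂, hl₂, hl₂'⟩ := exists_between h2
  obtain ⟨C, x₀, hC, hx₀, H⟩ := h.potter (hk₁.trans hl₁) hl₁' hl₂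
  have ta : Tendsto (fun s : ℝ => (2 * C + 1) * s ^ (l₂ - k₂)) atTop (𝓝 0) := by
    have := (tendsto_rpow_neg_atTop (show 0 < k₂ - l₂ by linarith)).const_mul (2 * C + 1)
    simpa using this
  have tb : Tendsto (fun s : ℝ => (2 * C + 1) * s ^ (k₁ - l₁)) atTop (𝓝 0) := by
    have := (tendsto_rpow_neg_atTop (show 0 < l₁ - k₁ by linarith)).const_mul (2 * C + 1)
    simpa using this
  obtain ⟨b, hb⟩ := eventually_atTop.1
    ((ta.eventually (gt_mem_nhds hη)).and (tb.eventually (gt_mem_nhds hη)))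
  set B := max b 1 with hB
  have hB1 : 1 ≤ B := le_max_right _ _
  have hB0 : 0 < B := by linarith
  -- The tolerance is below `η * s ^ k₁` for every `s ≥ B⁻¹`.
  obtain ⟨x₁, hx₁⟩ := h.uniform_Icc (a := B⁻¹) (b := B) (inv_pos.2 hB0)
    (show 0 < η * (B⁻¹) ^ k₁ by positivity)
  refine ⟨max x₀ x₁, by positivity, fun x hx s hs => ?_⟩
  have hG := h.pos x
  have hxx₀ : x₀ ≤ x := (le_max_left _ _).trans hx
  have p1 : 0 < s ^ k₁ := by positivity
  have p2 : 0 < s ^ k₂ := by positivity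
  have p3 : 0 < s ^ α := by positivity
  have crude : ∀ w, s ^ l₁ ≤ w → s ^ l₂ ≤ w → s ^ α ≤ w →
      |G (x / s) - s ^ α * G x| ≤ (2 * C + 1) * w * G x := by
    intro w w1 w2 w3
    have hw : 0 < w := p3.trans_le w3
    have q1 := H x hxx₀ s hs
    have q2 : C * (s ^ l₁ + s ^ l₂) * G x ≤ C * (w + w) * G x := by gcongr
    have q3 : s ^ α * G x ≤ w * G x := by gcongr
    have q4 := h.nonneg (x / s)
    have q5 : 0 ≤ C * (w + w) * G x := by positivity
    have q6 : 0 ≤ s ^ α * G x := by positivity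
    have q7 : (2 * C + 1) * w * G x = C * (w + w) * G x + w * G x := by ring
    rw [abs_le, q7]
    constructor <;> linarith
  rcases lt_or_ge s B⁻¹ with c1 | c1
  · have hs1 : s ≤ 1 := c1.le.trans (inv_le_one_of_one_le₀ hB1)
    have hc := crude (s ^ l₁) le_rfl
      (Real.rpow_le_rpow_of_exponent_ge hs hs1 (by linarith))
      (Real.rpow_le_rpow_of_exponent_ge hs hs1 (by linarith))
    refine hc.trans (mul_le_mul_of_nonneg_right ?_ hG.le)
    have hinv : b ≤ s⁻¹ := (le_max_left b 1).trans ((lt_inv_comm₀ hs hB0).1 c1).le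
    have hb' := (hb s⁻¹ hinv).2.le
    have e : s ^ l₁ = (s⁻¹) ^ (k₁ - l₁) * s ^ k₁ := by
      rw [Real.inv_rpow hs.le, ← Real.rpow_neg hs.le, ← Real.rpow_add hs]; congr 1; ring
    calc (2 * C + 1) * s ^ l₁ = ((2 * C + 1) * (s⁻¹) ^ (k₁ - l₁)) * s ^ k₁ := by rw [e]; ring
      _ ≤ η * s ^ k₁ := by gcongr
      _ ≤ η * (s ^ k₁ + s ^ k₂) := by gcongr; linarith
  rcases le_or_gt s B with c2 | c2
  · have q := hx₁ x ((le_max_right _ _).trans hx) s ⟨c1, c2⟩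
    have e : G (x / s) - s ^ α * G x = (G (x / s) / G x - s ^ α) * G x := by
      field_simp
    rw [e, abs_mul, abs_of_pos hG]
    refine mul_le_mul_of_nonneg_right (q.trans ?_) hG.le
    gcongr
    have : (B⁻¹) ^ k₁ ≤ s ^ k₁ := by gcongr
    linarith
  · have hs1 : 1 ≤ s := hB1.trans c2.le
    have hc := crude (s ^ l₂) (Real.rpow_le_rpow_of_exponent_le hs1 (by linarith)) le_rfl
      (Real.rpow_le_rpow_of_exponent_le hs1 (by linarith))
    refine hc.trans (mul_le_mul_of_nonneg_right ?_ hG.le)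
    have hb' := (hb s ((le_max_left b 1).trans c2.le)).1.le
    have e : s ^ l₂ = s ^ (l₂ - k₂) * s ^ k₂ := by
      rw [← Real.rpow_add hs]; congr 1; ring
    calc (2 * C + 1) * s ^ l₂ = ((2 * C + 1) * s ^ (l₂ - k₂)) * s ^ k₂ := by rw [e]; ring
      _ ≤ η * s ^ k₂ := by gcongr
      _ ≤ η * (s ^ k₁ + s ^ k₂) := by gcongr; linarith

end IsRegVarTail

/-! ### Power sums, Minkowski's inequality and dyadic decompositions -/

lemma ENNReal.tsum_rpow_le_rpow_tsum {ι : Type*} (a : ι → ℝ≥0∞) {p : ℝ} (hp : 1 ≤ p) :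
    ∑' i, a i ^ p ≤ (∑' i, a i) ^ p := by
  have hsplit : ∀ b : ℝ≥0∞, b ^ p = b * b ^ (p - 1) := fun b => by
    conv_rhs => rw [← ENNReal.rpow_one b]
    rw [ENNReal.rpow_one b]
    nth_rewrite 2 [← ENNReal.rpow_one b]
    rw [← ENNReal.rpow_add_of_nonneg _ _ zero_le_one (by linarith)]
    congr 1; ring
  calc ∑' i, a i ^ p = ∑' i, a i * a i ^ (p - 1) := by simp only [hsplit]
    _ ≤ ∑' i, a i * (∑' j, a j) ^ (p - 1) := by
        gcongr with i
        exact ENNReal.le_tsum i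
    _ = (∑' i, a i) ^ p := by rw [ENNReal.tsum_mul_right, ← hsplit]

/-- Minkowski's inequality for countable sums. -/
lemma lintegral_tsum_rpow_le {Ω : Type*} [MeasurableSpace Ω] {P : Measure Ω}
    {f : ℕ → Ω → ℝ≥0∞} (hf : ∀ i, Measurable (f i)) {k : ℝ} (hk : 1 ≤ k) :
    ∫⁻ ω, (∑' i, f i ω) ^ k ∂P ≤ (∑' i, (∫⁻ ω, f i ω ^ k ∂P) ^ (1 / k)) ^ k := by
  have hk0 : 0 < k := by linarith
  have hfin : ∀ n, ∫⁻ ω, (∑ i ∈ Finset.range n, f i ω) ^ k ∂P ≤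
      (∑ i ∈ Finset.range n, (∫⁻ ω, f i ω ^ k ∂P) ^ (1 / k)) ^ k := by
    intro n
    have : (∫⁻ ω, (∑ i ∈ Finset.range n, f i ω) ^ k ∂P) ^ (1 / k) ≤
        ∑ i ∈ Finset.range n, (∫⁻ ω, f i ω ^ k ∂P) ^ (1 / k) := by
      induction n with
      | zero => simp [hk0]
      | succ n ih =>
        simp only [Finset.sum_range_succ]
        have hm : Measurable fun ω => ∑ i ∈ Finset.range n, f i ω :=
          Finset.measurable_sum _ fun i _ => hf i
        exact (ENNReal.lintegral_Lp_add_le hm.aemeasurable (hf n).aemeasurable hk).trans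
          (add_le_add_left ih _)
    have h2 := ENNReal.rpow_le_rpow this hk0.le
    rwa [← ENNReal.rpow_mul, one_div, inv_mul_cancel₀ hk0.ne', ENNReal.rpow_one, ← one_div] at h2
  have hmono : Monotone fun n => fun ω => (∑ i ∈ Finset.range n, f i ω) ^ k := by
    intro a b hab ω
    exact ENNReal.rpow_le_rpow (Finset.sum_le_sum_of_subset (Finset.range_mono hab)) hk0.le
  have hlim : ∀ ω, (∑' i, f i ω) ^ k = ⨆ n, (∑ i ∈ Finset.range n, f i ω) ^ k := by
    intro ω
    refine tendsto_nhds_unique (f := fun n => (∑ i ∈ Finset.range n, f i ω) ^ k) (l := atTop) ?_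
      (tendsto_atTop_iSup fun a b hab => hmono hab ω)
    exact (ENNReal.continuous_rpow_const.tendsto _).comp (ENNReal.tendsto_nat_tsum fun i => f i ω)
  simp only [hlim]
  rw [lintegral_iSup (fun n => (Finset.measurable_sum _ fun i _ => hf i).pow_const k) hmono]
  refine iSup_le fun n => (hfin n).trans ?_
  exact ENNReal.rpow_le_rpow (ENNReal.sum_le_tsum _) hk0.le

/-- The first `n` with `x / 2 ^ (n + 1) < z` satisfies `z ≤ x / 2 ^ n`, so its term suffices.
Integrated, this bounds a truncated moment by tail probabilities. -/
lemma ENNReal.rpow_le_tsum_dyadic {x z : ℝ≥0∞} (hx : x ≠ ⊤) (hzx : z ≤ x) {k : ℝ} (hk : 0 < k) :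
    z ^ k ≤ ∑' n : ℕ, if x / 2 ^ (n + 1) < z then (x / 2 ^ n) ^ k else 0 := by
  classical
  rcases eq_or_ne z 0 with h0 | h0
  · simp [h0, hk]
  have hex : ∃ n : ℕ, x / 2 ^ (n + 1) < z := by
    have h1 : Tendsto (fun n : ℕ => x * (2⁻¹ : ℝ≥0∞) ^ (n + 1)) atTop (𝓝 (x * 0)) := by
      refine ENNReal.Tendsto.const_mul ?_ (Or.inr hx)
      exact (tendsto_add_atTop_iff_nat 1).2
        (ENNReal.tendsto_pow_atTop_nhds_zero_of_lt_one (by simp))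
    rw [mul_zero] at h1
    obtain ⟨n, hn⟩ := (h1.eventually (gt_mem_nhds (pos_iff_ne_zero.2 h0))).exists
    exact ⟨n, by rwa [div_eq_mul_inv, ENNReal.inv_pow]⟩
  have hn := Nat.find_spec hex
  have hle : z ≤ x / 2 ^ (Nat.find hex) := by
    rcases Nat.eq_zero_or_pos (Nat.find hex) with h | h
    · rw [h]; simpa using hzx
    · obtain ⟨m, hm⟩ := Nat.exists_eq_succ_of_ne_zero h.ne'
      have := Nat.find_min hex (m := m) (by omega)
      rw [hm]
      exact not_lt.1 this
  refine le_trans ?_ (ENNReal.le_tsum (Nat.find hex))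
  rw [if_pos hn]
  exact ENNReal.rpow_le_rpow hle hk.le

/-- The same device upwards: integrated, it bounds the mean excess over `x` by tail probabilities.
-/
lemma ENNReal.tsub_le_tsum_dyadic {x z : ℝ≥0∞} (hx : x ≠ 0) (hz : z ≠ ⊤) :
    z - x ≤ ∑' n : ℕ, if 2 ^ n * x < z then 2 ^ (n + 1) * x else 0 := by
  classical
  rcases le_or_gt z x with h0 | h0
  · simp [tsub_eq_zero_of_le h0]
  have hex : ∃ n : ℕ, z ≤ 2 ^ (n + 1) * x := by
    obtain ⟨n, hn⟩ := ENNReal.exists_nat_gt (ENNReal.div_ne_top hz hx)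
    refine ⟨n, ?_⟩
    have h1 : (n : ℝ≥0∞) ≤ 2 ^ (n + 1) := by
      have : n ≤ 2 ^ (n + 1) := (Nat.lt_two_pow_self (n := n)).le.trans
        (Nat.pow_le_pow_right (by norm_num) (by omega))
      exact_mod_cast this
    have h2 := (hn.trans_le h1).le
    rwa [ENNReal.div_le_iff_le_mul (Or.inl hx) (Or.inl h0.ne_top)] at h2
  have hn := Nat.find_spec hex
  have hlt : 2 ^ (Nat.find hex) * x < z := by
    rcases Nat.eq_zero_or_pos (Nat.find hex) with h | h
    · rw [h]; simpa using h0
    · obtain ⟨m, hm⟩ := Nat.exists_eq_succ_of_ne_zero h.ne'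
      have := Nat.find_min hex (m := m) (by omega)
      rw [hm]
      exact not_le.1 this
  refine le_trans ?_ (ENNReal.le_tsum (Nat.find hex))
  rw [if_pos hlt]
  exact tsub_le_self.trans hn

lemma ENNReal.exists_tsum_nat_add_le {w : ℕ → ℝ≥0∞} (hw : ∑' i, w i ≠ ⊤) {δ : ℝ≥0∞}
    (hδ : δ ≠ 0) : ∃ m : ℕ, ∀ n, m ≤ n → ∑' i, w (i + n) ≤ δ :=
  eventually_atTop.1
    ((ENNReal.tendsto_sum_nat_add w hw).eventually (ge_mem_nhds (pos_iff_ne_zero.2 hδ)))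

/-! ### Negligibility of the remainders of a series -/

section TailSums

variable {Ω : Type*} [MeasurableSpace Ω] {P : Measure Ω} {G : ℝ → ℝ} {α : ℝ}

/-- The tails of a series are uniformly negligible with respect to `G`. -/
def HasNegligibleTails (P : Measure Ω) (G : ℝ → ℝ) (Z : ℕ → Ω → ℝ≥0∞) : Prop :=
  ∀ ε : ℝ≥0∞, ε ≠ 0 → ∃ m : ℕ, ∃ x₁ : ℝ, ∀ x, x₁ ≤ x →
    P {ω | ENNReal.ofReal x < ∑' i, Z (i + m) ω} ≤ ε * ENNReal.ofReal (G x)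

/-- As `α > 1`, a tail with exponent `k ∈ (1, α)` is integrable, so the mean excess of `Z i` over `x
* w i` is `O(w i * x * G x)`. If the levels `x * w i` add up to at most half of `y`, the sum exceeds
`y` only when the total excess exceeds `y / 2`, and Markov's inequality applies. No independence of
the terms is needed. -/
theorem hasNegligibleTails_of_one_lt (h : IsRegVarTail G α) (hα : 1 < α)
    {Z : ℕ → Ω → ℝ≥0∞} (hZ : ∀ i, Measurable (Z i)) (hZfin : ∀ i ω, Z i ω ≠ ⊤)
    {w : ℕ → ℝ≥0∞} (hw0 : ∀ i, w i ≠ 0) (hw : ∑' i, w i ≠ ⊤) {K : ℝ≥0∞} (hK : K ≠ ⊤) {x₀ : ℝ}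
    (H : ∀ i x, x₀ ≤ x → P {ω | ENNReal.ofReal x * w i < Z i ω} ≤ K * ENNReal.ofReal (G x)) :
    HasNegligibleTails P G Z := by
  obtain ⟨k, hk1, hkα⟩ := exists_between hα
  obtain ⟨C, x₂, hC, hx₂, HC⟩ := h.potter_down (by linarith) hkα
  set d : ℕ → ℝ≥0∞ := fun n => ENNReal.ofReal (2 * C * (2 ^ (1 - k)) ^ n) with hd
  set D := ∑' n, d n with hD
  have hDtop : D ≠ ⊤ := by
    refine Summable.tsum_ofReal_ne_top ?_
    refine (summable_geometric_of_lt_one (by positivity) ?_).mul_left _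
    exact Real.rpow_lt_one_of_one_lt_of_neg one_lt_two (by linarith)
  have step : ∀ i x, max (max x₀ x₂) 1 ≤ x →
      ∫⁻ ω, (Z i ω - ENNReal.ofReal x * w i) ∂P ≤
        w i * (ENNReal.ofReal x * (K * D * ENNReal.ofReal (G x))) := by
    intro i x hx
    have hx0 : x₀ ≤ x := ((le_max_left _ _).trans (le_max_left _ _)).trans hx
    have hx2 : x₂ ≤ x := ((le_max_right _ _).trans (le_max_left _ _)).trans hx
    have hx1 : 1 ≤ x := (le_max_right _ _).trans hx
    have hxpos : 0 < x := by linarith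
    have hne : ENNReal.ofReal x * w i ≠ 0 :=
      mul_ne_zero (by simpa using hxpos) (hw0 i)
    have hms : ∀ n : ℕ, MeasurableSet {ω | 2 ^ n * (ENNReal.ofReal x * w i) < Z i ω} :=
      fun n => measurableSet_lt measurable_const (hZ i)
    calc ∫⁻ ω, (Z i ω - ENNReal.ofReal x * w i) ∂P
        ≤ ∫⁻ ω, ∑' n : ℕ, {ω | 2 ^ n * (ENNReal.ofReal x * w i) < Z i ω}.indicator
            (fun _ => 2 ^ (n + 1) * (ENNReal.ofReal x * w i)) ω ∂P := by
          refine lintegral_mono fun ω => (ENNReal.tsub_le_tsum_dyadic hne (hZfin i ω)).trans ?_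
          simp [indicator_apply]
      _ = ∑' n : ℕ, 2 ^ (n + 1) * (ENNReal.ofReal x * w i) *
            P {ω | 2 ^ n * (ENNReal.ofReal x * w i) < Z i ω} := by
          rw [lintegral_tsum fun n => (measurable_const.indicator (hms n)).aemeasurable]
          congr with n
          rw [lintegral_indicator_const (hms n)]
      _ ≤ ∑' n : ℕ, w i * (ENNReal.ofReal x * (K * d n * ENNReal.ofReal (G x))) := by
          refine ENNReal.tsum_le_tsum fun n => ?_
          have hn1 : (1 : ℝ) ≤ 2 ^ n := one_le_pow₀ one_le_two
          have e1 : (2 : ℝ≥0∞) ^ n * (ENNReal.ofReal x * w i) =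
              ENNReal.ofReal (2 ^ n * x) * w i := by
            rw [ENNReal.ofReal_mul (by positivity), ENNReal.ofReal_pow two_pos.le]
            simp [mul_assoc]
          have h1 := H i (2 ^ n * x) (hx0.trans (le_mul_of_one_le_left hxpos.le hn1))
          have h2 := HC x hx2 (2 ^ n) hn1
          rw [e1]
          have e2 : (2 : ℝ≥0∞) ^ (n + 1) = ENNReal.ofReal (2 ^ (n + 1)) := by
            rw [ENNReal.ofReal_pow two_pos.le]; simp
          have e3 : ENNReal.ofReal (2 ^ (n + 1)) * ENNReal.ofReal (G (2 ^ n * x)) ≤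
              d n * ENNReal.ofReal (G x) := by
            rw [hd, ← ENNReal.ofReal_mul (by positivity), ← ENNReal.ofReal_mul (by positivity)]
            refine ENNReal.ofReal_le_ofReal ?_
            calc (2 : ℝ) ^ (n + 1) * G (2 ^ n * x)
                ≤ 2 ^ (n + 1) * (C * (2 ^ n) ^ (-k) * G x) := by gcongr
              _ = 2 * C * (2 ^ (1 - k)) ^ n * G x := by
                have : ((2 : ℝ) ^ (1 - k)) ^ n = 2 ^ n * (2 ^ n) ^ (-k) := by
                  rw [← Real.rpow_natCast, ← Real.rpow_mul two_pos.le,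
                    ← Real.rpow_natCast 2 n, ← Real.rpow_mul two_pos.le,
                    ← Real.rpow_add two_pos]
                  congr 1; ring
                rw [this]; ring
          calc 2 ^ (n + 1) * (ENNReal.ofReal x * w i) *
                P {ω | ENNReal.ofReal (2 ^ n * x) * w i < Z i ω}
              ≤ ENNReal.ofReal (2 ^ (n + 1)) * (ENNReal.ofReal x * w i) *
                (K * ENNReal.ofReal (G (2 ^ n * x))) := by rw [e2]; gcongr
            _ = w i * (ENNReal.ofReal x * (K *
                (ENNReal.ofReal (2 ^ (n + 1)) * ENNReal.ofReal (G (2 ^ n * x))))) := by ring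
            _ ≤ w i * (ENNReal.ofReal x * (K * (d n * ENNReal.ofReal (G x)))) := by gcongr
            _ = _ := by ring
      _ = w i * (ENNReal.ofReal x * (K * D * ENNReal.ofReal (G x))) := by
          rw [ENNReal.tsum_mul_left, ENNReal.tsum_mul_left, ENNReal.tsum_mul_right,
            ENNReal.tsum_mul_left]
  intro ε hε
  have hconst : K * D * ENNReal.ofReal C ≠ ⊤ :=
    ENNReal.mul_ne_top (ENNReal.mul_ne_top hK hDtop) ENNReal.ofReal_ne_top
  obtain ⟨δ, hδ0, hδ1, hδ⟩ : ∃ δ : ℝ, 0 < δ ∧ 2 * δ ≤ 1 ∧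
      K * D * ENNReal.ofReal C * ENNReal.ofReal ((2 * δ) ^ k) ≤ ε := by
    have h1 : Tendsto (fun δ : ℝ => K * D * ENNReal.ofReal C * ENNReal.ofReal ((2 * δ) ^ k))
        (𝓝[>] 0) (𝓝 (K * D * ENNReal.ofReal C * ENNReal.ofReal ((2 * 0) ^ k))) := by
      refine ENNReal.Tendsto.const_mul ?_ (Or.inr hconst)
      refine tendsto_nhdsWithin_of_tendsto_nhds ?_
      refine (ENNReal.continuous_ofReal.comp ?_).tendsto 0
      exact (continuous_const.mul continuous_id).rpow_const fun _ => Or.inr (by linarith)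
    rw [mul_zero, Real.zero_rpow (by linarith), ENNReal.ofReal_zero, mul_zero] at h1
    have h2 : ∀ᶠ δ : ℝ in 𝓝[>] 0, δ < 1 / 2 :=
      tendsto_nhdsWithin_of_tendsto_nhds tendsto_id |>.eventually (gt_mem_nhds (by norm_num))
    obtain ⟨δ, ⟨h3, h4⟩, h5⟩ := ((h1.eventually (ge_mem_nhds (pos_iff_ne_zero.2 hε))).and
      h2).and self_mem_nhdsWithin |>.exists
    exact ⟨δ, h5, by linarith, h3⟩
  obtain ⟨m, hm⟩ := ENNReal.exists_tsum_nat_add_le hw (δ := ENNReal.ofReal δ) (by simpa using hδ0)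
  refine ⟨m, max (max x₀ x₂) 1, fun y hy => ?_⟩
  have hy1 : 1 ≤ y := (le_max_right _ _).trans hy
  have hy0 : 0 < y := by linarith
  -- The weights beyond `m` sum to at most `δ`, so the levels `x * w i` use at most `x * δ = y / 2`.
  -- A small `δ` makes `x` much larger than `y`, which yields the factor `(2 * δ) ^ k`.
  set x := y / (2 * δ) with hx
  have hyx : y ≤ x := by
    rw [hx, le_div_iff₀ (by positivity)]
    exact mul_le_of_le_one_right hy0.le hδ1
  have hx0 : 0 < x := hy0.trans_le hyx
  have hxy : x * δ = y / 2 := by rw [hx]; field_simp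
  have hGx : G x ≤ C * (2 * δ) ^ k * G y := by
    have h1 := HC y (((le_max_right _ _).trans (le_max_left _ _)).trans hy) (2 * δ)⁻¹
      ((one_le_inv₀ (by positivity)).2 hδ1)
    rw [Real.inv_rpow (by positivity), Real.rpow_neg (by positivity), inv_inv,
      ← div_eq_inv_mul] at h1
    exact h1
  have hsum : ∫⁻ ω, (∑' i, Z (i + m) ω - ENNReal.ofReal (y / 2)) ∂P ≤
      ENNReal.ofReal (y / 2) * (K * D * ENNReal.ofReal (G x)) := by
    calc ∫⁻ ω, (∑' i, Z (i + m) ω - ENNReal.ofReal (y / 2)) ∂P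
        ≤ ∫⁻ ω, ∑' i, (Z (i + m) ω - ENNReal.ofReal x * w (i + m)) ∂P := by
          refine lintegral_mono fun ω => ?_
          rw [tsub_le_iff_right]
          calc ∑' i, Z (i + m) ω ≤ ∑' i, ((Z (i + m) ω - ENNReal.ofReal x * w (i + m)) +
                ENNReal.ofReal x * w (i + m)) := ENNReal.tsum_le_tsum fun i => le_tsub_add
            _ = ∑' i, (Z (i + m) ω - ENNReal.ofReal x * w (i + m)) +
                ENNReal.ofReal x * ∑' i, w (i + m) := by
                rw [ENNReal.tsum_add, ENNReal.tsum_mul_left]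
            _ ≤ _ := by
                gcongr
                rw [← hxy, ENNReal.ofReal_mul hx0.le]
                gcongr
                exact hm m le_rfl
      _ = ∑' i, ∫⁻ ω, (Z (i + m) ω - ENNReal.ofReal x * w (i + m)) ∂P :=
          lintegral_tsum fun i => ((hZ _).sub_const _).aemeasurable
      _ ≤ ∑' i, w (i + m) * (ENNReal.ofReal x * (K * D * ENNReal.ofReal (G x))) :=
          ENNReal.tsum_le_tsum fun i => step _ _ (hy.trans hyx)
      _ ≤ ENNReal.ofReal δ * (ENNReal.ofReal x * (K * D * ENNReal.ofReal (G x))) := by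
          rw [ENNReal.tsum_mul_right]
          gcongr
          exact hm m le_rfl
      _ = _ := by rw [← mul_assoc, ← ENNReal.ofReal_mul hδ0.le, mul_comm δ, hxy]
  have hy2 : ENNReal.ofReal (y / 2) ≠ 0 := by simpa using hy0
  have hmark := mul_meas_ge_le_lintegral (μ := P)
    (f := fun ω => ∑' i, Z (i + m) ω - ENNReal.ofReal (y / 2))
    ((Measurable.tsum fun i => hZ _).sub_const _) (ENNReal.ofReal (y / 2))
  have h3 : ENNReal.ofReal (y / 2) * P {ω | ENNReal.ofReal y < ∑' i, Z (i + m) ω} ≤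
      ENNReal.ofReal (y / 2) * (K * D * ENNReal.ofReal (G x)) := by
    refine le_trans (mul_le_mul_right ?_ _) (hmark.trans hsum)
    refine measure_mono fun ω hω => ?_
    refine ENNReal.le_sub_of_add_le_left ENNReal.ofReal_ne_top ?_
    rw [← ENNReal.ofReal_add (by positivity) (by positivity), add_halves]
    exact le_of_lt hω
  rw [ENNReal.mul_le_mul_iff_right hy2 ENNReal.ofReal_ne_top] at h3
  refine h3.trans ?_
  calc K * D * ENNReal.ofReal (G x)
      ≤ K * D * ENNReal.ofReal (C * (2 * δ) ^ k * G y) := by gcongr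
    _ = K * D * ENNReal.ofReal C * ENNReal.ofReal ((2 * δ) ^ k) * ENNReal.ofReal (G y) := by
        rw [ENNReal.ofReal_mul (by positivity), ENNReal.ofReal_mul (by positivity)]; ring
    _ ≤ ε * ENNReal.ofReal (G y) := by gcongr

/-- Either some term exceeds `x`, with total probability controlled by `∑ M i`, or the sum of the
terms truncated at `x` exceeds `x`. The `k`-th moment of a truncated term is `O(x ^ k * M i * G x)`
because `k > l`; Minkowski's inequality sums these and Markov's concludes. -/
theorem hasNegligibleTails_of_truncation
    {Z : ℕ → Ω → ℝ≥0∞} (hZ : ∀ i, Measurable (Z i)) {k l : ℝ} (hk : 1 ≤ k) (hlk : l < k)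
    {M : ℕ → ℝ≥0∞} (hM : ∑' i, M i ^ (1 / k) ≠ ⊤) {K : ℝ≥0∞} (hK : K ≠ ⊤) {x₀ : ℝ}
    (H : ∀ i x, x₀ ≤ x → ∀ u, 1 ≤ u →
      P {ω | ENNReal.ofReal (x / u) < Z i ω} ≤
        K * ENNReal.ofReal (u ^ l) * M i * ENNReal.ofReal (G x)) :
    HasNegligibleTails P G Z := by
  have hk0 : 0 < k := by linarith
  set d : ℕ → ℝ≥0∞ := fun n => ENNReal.ofReal (2 ^ l * (2 ^ (l - k)) ^ n) with hd
  set D := ∑' n, d n with hD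
  have hDtop : D ≠ ⊤ := by
    refine Summable.tsum_ofReal_ne_top ?_
    refine (summable_geometric_of_lt_one (by positivity) ?_).mul_left _
    exact Real.rpow_lt_one_of_one_lt_of_neg one_lt_two (by linarith)
  set Y : ℝ → ℕ → Ω → ℝ≥0∞ := fun x i => {ω | Z i ω ≤ ENNReal.ofReal x}.indicator (Z i) with hY
  have hYm : ∀ x i, Measurable (Y x i) := fun x i =>
    (hZ i).indicator (measurableSet_le (hZ i) measurable_const)
  have step : ∀ i x, max x₀ 1 ≤ x →
      ∫⁻ ω, Y x i ω ^ k ∂P ≤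
        (ENNReal.ofReal x ^ k * (K * D * ENNReal.ofReal (G x))) * M i := by
    intro i x hx
    have hx0 : x₀ ≤ x := (le_max_left _ _).trans hx
    have hxpos : 0 < x := lt_of_lt_of_le one_pos ((le_max_right _ _).trans hx)
    have hms : ∀ n : ℕ, MeasurableSet {ω | ENNReal.ofReal x / 2 ^ (n + 1) < Z i ω} :=
      fun n => measurableSet_lt measurable_const (hZ i)
    calc ∫⁻ ω, Y x i ω ^ k ∂P
        ≤ ∫⁻ ω, ∑' n : ℕ, {ω | ENNReal.ofReal x / 2 ^ (n + 1) < Z i ω}.indicator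
            (fun _ => (ENNReal.ofReal x / 2 ^ n) ^ k) ω ∂P := by
          refine lintegral_mono fun ω => ?_
          by_cases hω : Z i ω ≤ ENNReal.ofReal x
          · have e : Y x i ω = Z i ω := by simp [hY, hω]
            rw [e]
            refine (ENNReal.rpow_le_tsum_dyadic ENNReal.ofReal_ne_top hω hk0).trans ?_
            simp [indicator_apply]
          · have e : Y x i ω = 0 := by simp [hY, hω]
            simp [e, hk0]
      _ = ∑' n : ℕ, (ENNReal.ofReal x / 2 ^ n) ^ k *
            P {ω | ENNReal.ofReal x / 2 ^ (n + 1) < Z i ω} := by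
          rw [lintegral_tsum fun n => (measurable_const.indicator (hms n)).aemeasurable]
          congr with n
          rw [lintegral_indicator_const (hms n)]
      _ ≤ ∑' n : ℕ, (ENNReal.ofReal x ^ k * (K * d n * ENNReal.ofReal (G x))) * M i := by
          refine ENNReal.tsum_le_tsum fun n => ?_
          have e0 : ∀ n : ℕ, ENNReal.ofReal x / 2 ^ n = ENNReal.ofReal (x / 2 ^ n) := fun n => by
            rw [ENNReal.ofReal_div_of_pos (by positivity), ENNReal.ofReal_pow two_pos.le]
            simp
          have h1 := H i x hx0 (2 ^ (n + 1)) (one_le_pow₀ one_le_two)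
          have e3 : (ENNReal.ofReal x / 2 ^ n) ^ k * ENNReal.ofReal ((2 ^ (n + 1)) ^ l) =
              ENNReal.ofReal x ^ k * d n := by
            rw [e0, ENNReal.ofReal_rpow_of_pos (by positivity),
              ENNReal.ofReal_rpow_of_pos (by positivity), hd,
              ← ENNReal.ofReal_mul (by positivity), ← ENNReal.ofReal_mul (by positivity)]
            congr 1
            rw [Real.div_rpow hxpos.le (by positivity), div_eq_mul_inv, mul_assoc]
            congr 1
            rw [← Real.rpow_neg (by positivity), ← Real.rpow_natCast, ← Real.rpow_mul two_pos.le,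
              ← Real.rpow_natCast 2 (n + 1), ← Real.rpow_mul two_pos.le, ← Real.rpow_add two_pos,
              ← Real.rpow_natCast _ n, ← Real.rpow_mul two_pos.le, ← Real.rpow_add two_pos]
            congr 1; push_cast; ring
          rw [e0 (n + 1)]
          calc _ ≤ (ENNReal.ofReal x / 2 ^ n) ^ k *
                (K * ENNReal.ofReal ((2 ^ (n + 1)) ^ l) * M i * ENNReal.ofReal (G x)) := by gcongr
            _ = ((ENNReal.ofReal x / 2 ^ n) ^ k * ENNReal.ofReal ((2 ^ (n + 1)) ^ l)) *
                (K * M i * ENNReal.ofReal (G x)) := by ring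
            _ = _ := by rw [e3]; ring
      _ = _ := by
          rw [ENNReal.tsum_mul_right, ENNReal.tsum_mul_left, ENNReal.tsum_mul_right,
            ENNReal.tsum_mul_left]
  intro ε hε
  have hconst : K * D + K ≠ ⊤ := ENNReal.add_ne_top.2 ⟨ENNReal.mul_ne_top hK hDtop, hK⟩
  obtain ⟨δ, hδ0, hδ⟩ : ∃ δ : ℝ≥0∞, δ ≠ 0 ∧ (K * D + K) * δ ^ k ≤ ε := by
    have h1 : Tendsto (fun δ : ℝ≥0∞ => (K * D + K) * δ ^ k)
        (𝓝[>] 0) (𝓝 ((K * D + K) * 0 ^ k)) := by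
      refine ENNReal.Tendsto.const_mul ?_ (Or.inr hconst)
      exact tendsto_nhdsWithin_of_tendsto_nhds (ENNReal.continuous_rpow_const.tendsto 0)
    rw [ENNReal.zero_rpow_of_pos hk0, mul_zero] at h1
    obtain ⟨δ, h3, h5⟩ := ((h1.eventually (ge_mem_nhds (pos_iff_ne_zero.2 hε))).and
      self_mem_nhdsWithin).exists
    exact ⟨δ, (ne_of_gt h5), h3⟩
  obtain ⟨m, hm⟩ := ENNReal.exists_tsum_nat_add_le hM hδ0
  have hm := hm m le_rfl
  refine ⟨m, max x₀ 1, fun x hx => ?_⟩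
  have hx0 : 0 < x := lt_of_lt_of_le one_pos ((le_max_right _ _).trans hx)
  set c := ENNReal.ofReal x ^ k with hc
  have hc0 : c ≠ 0 := by
    rw [hc, ENNReal.ofReal_rpow_of_pos hx0]; simpa using Real.rpow_pos_of_pos hx0 k
  have hctop : c ≠ ⊤ := ENNReal.rpow_ne_top_of_nonneg hk0.le ENNReal.ofReal_ne_top
  have hsub : {ω | ENNReal.ofReal x < ∑' i, Z (i + m) ω} ⊆
      (⋃ i, {ω | ENNReal.ofReal (x / 1) < Z (i + m) ω}) ∪
        {ω | c ≤ (∑' i, Y x (i + m) ω) ^ k} := by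
    intro ω hω
    by_cases hex : ∃ i, ENNReal.ofReal x < Z (i + m) ω
    · left; simpa using hex
    · right
      push Not at hex
      have : ∀ i, Y x (i + m) ω = Z (i + m) ω := fun i => by simp [hY, hex i]
      refine ENNReal.rpow_le_rpow ?_ hk0.le
      rw [tsum_congr this]
      exact le_of_lt hω
  have hA : P (⋃ i, {ω | ENNReal.ofReal (x / 1) < Z (i + m) ω}) ≤
      K * δ ^ k * ENNReal.ofReal (G x) := by
    calc _ ≤ ∑' i, P {ω | ENNReal.ofReal (x / 1) < Z (i + m) ω} := measure_iUnion_le _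
      _ ≤ ∑' i, K * M (i + m) * ENNReal.ofReal (G x) := by
          refine ENNReal.tsum_le_tsum fun i => ?_
          simpa using H (i + m) x ((le_max_left _ _).trans hx) 1 le_rfl
      _ = K * (∑' i, (M (i + m) ^ (1 / k)) ^ k) * ENNReal.ofReal (G x) := by
          rw [ENNReal.tsum_mul_right, ENNReal.tsum_mul_left]
          congr with i
          rw [← ENNReal.rpow_mul, one_div, inv_mul_cancel₀ hk0.ne', ENNReal.rpow_one]
      _ ≤ _ := by
          gcongr
          exact (ENNReal.tsum_rpow_le_rpow_tsum _ hk).trans (ENNReal.rpow_le_rpow hm hk0.le)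
  have hB : P {ω | c ≤ (∑' i, Y x (i + m) ω) ^ k} ≤ K * D * δ ^ k * ENNReal.ofReal (G x) := by
    have h1 := mul_meas_ge_le_lintegral (μ := P) (f := fun ω => (∑' i, Y x (i + m) ω) ^ k)
      ((Measurable.tsum fun i => hYm x _).pow_const k) c
    have h2 : c * P {ω | c ≤ (∑' i, Y x (i + m) ω) ^ k} ≤
        c * (K * D * δ ^ k * ENNReal.ofReal (G x)) := by
      refine h1.trans ((lintegral_tsum_rpow_le (fun i => hYm x _) hk).trans ?_)
      calc (∑' i, (∫⁻ ω, Y x (i + m) ω ^ k ∂P) ^ (1 / k)) ^ k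
          ≤ (∑' i, ((c * (K * D * ENNReal.ofReal (G x))) ^ (1 / k) * M (i + m) ^ (1 / k))) ^ k := by
            refine ENNReal.rpow_le_rpow (ENNReal.tsum_le_tsum fun i => ?_) hk0.le
            rw [← ENNReal.mul_rpow_of_nonneg _ _ (by positivity)]
            exact ENNReal.rpow_le_rpow (step _ _ hx) (by positivity)
        _ ≤ ((c * (K * D * ENNReal.ofReal (G x))) ^ (1 / k) * δ) ^ k := by
            rw [ENNReal.tsum_mul_left]
            exact ENNReal.rpow_le_rpow (by gcongr) hk0.le
        _ = _ := by
            rw [ENNReal.mul_rpow_of_nonneg _ _ hk0.le, ← ENNReal.rpow_mul, one_div,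
              inv_mul_cancel₀ hk0.ne', ENNReal.rpow_one]
            ring
    rwa [ENNReal.mul_le_mul_iff_right hc0 hctop] at h2
  calc _ ≤ _ := measure_mono hsub
    _ ≤ _ := measure_union_le _ _
    _ ≤ K * δ ^ k * ENNReal.ofReal (G x) + K * D * δ ^ k * ENNReal.ofReal (G x) :=
        add_le_add hA hB
    _ = (K * D + K) * δ ^ k * ENNReal.ofReal (G x) := by ring
    _ ≤ _ := by gcongr

/-- Negligible tails force almost sure convergence of the series. -/
theorem HasNegligibleTails.ae_tsum_ne_top {Z : ℕ → Ω → ℝ≥0∞} (h : HasNegligibleTails P G Z)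
    (hG : ∀ x, G x ≤ 1) (hZfin : ∀ i ω, Z i ω ≠ ⊤) : ∀ᵐ ω ∂P, ∑' i, Z i ω ≠ ⊤ := by
  have hle : ∀ ε : ℝ≥0∞, ε ≠ 0 → P {ω | ¬ ∑' i, Z i ω ≠ ⊤} ≤ ε := by
    intro ε hε
    obtain ⟨m, x₁, H⟩ := h ε hε
    refine le_trans (measure_mono fun ω hω => ?_) ((H x₁ le_rfl).trans ?_)
    · simp only [ne_eq, not_not, mem_ofPred_eq] at hω ⊢
      -- A divergent series with finite terms has infinite remainders, so divergence lies in every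
      -- remainder event.
      have h1 := ENNReal.summable.sum_add_tsum_nat_add' (f := fun i => Z i ω) (k := m)
      rw [hω] at h1
      have h2 : ∑ i ∈ Finset.range m, Z i ω ≠ ⊤ := ENNReal.sum_ne_top.2 fun i _ => hZfin i ω
      rcases ENNReal.add_eq_top.1 h1 with h3 | h3
      · exact absurd h3 h2
      · rw [h3]; exact ENNReal.ofReal_lt_top
    · exact mul_le_of_le_one_right zero_le (ENNReal.ofReal_le_one.2 (hG x₁))
  refine le_antisymm (le_of_forall_gt fun ε hε => ?_) zero_le
  obtain ⟨δ, hδ, hδ'⟩ := exists_between hε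
  exact (hle δ hδ.ne').trans_lt hδ'

end TailSums

/-! ### Discounted tails and the moment conditions -/

section DiscountedTails

variable {Ω : Type*} [MeasurableSpace Ω] {P : Measure Ω} {G : ℝ → ℝ} {α : ℝ}

/-- The constants depend on neither `μ` nor `θ`. This lets the bound be used for restrictions of `P`
to arbitrary events and for rescaled discount factors. -/
lemma IsRegVarTail.lintegral_le (h : IsRegVarTail G α) {k₁ k₂ : ℝ} (hk₁ : 0 < k₁) (h1 : k₁ < α)
    (h2 : α < k₂) :
    ∃ C x₀ : ℝ, 0 < C ∧ 0 < x₀ ∧ ∀ x, x₀ ≤ x → ∀ (μ : Measure Ω) (θ : Ω → ℝ), (∀ ω, 0 < θ ω) →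
      ∫⁻ ω, ENNReal.ofReal (G (x / θ ω)) ∂μ ≤
        ENNReal.ofReal C * ENNReal.ofReal (G x) *
          ∫⁻ ω, ENNReal.ofReal (θ ω ^ k₁ + θ ω ^ k₂) ∂μ := by
  obtain ⟨C, x₀, hC, hx₀, H⟩ := h.potter hk₁ h1 h2
  refine ⟨C, x₀, hC, hx₀, fun x hx μ θ hθ => ?_⟩
  rw [← lintegral_const_mul' _ _ (ENNReal.mul_ne_top ENNReal.ofReal_ne_top ENNReal.ofReal_ne_top)]
  refine lintegral_mono fun ω => ?_
  rw [← ENNReal.ofReal_mul hC.le, ← ENNReal.ofReal_mul (mul_nonneg hC.le (h.nonneg _))]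
  refine ENNReal.ofReal_le_ofReal ((H x hx _ (hθ ω)).trans (le_of_eq ?_))
  ring

/-- A two-sided, quantitative form of Breiman's lemma. Applied to `P.restrict S`, it has an error
governed by full moments of `θ`, hence uniform in `S`. -/
lemma IsRegVarTail.lintegral_uniform (h : IsRegVarTail G α) {k₁ k₂ : ℝ} (hk₁ : 0 < k₁)
    (h1 : k₁ < α) (h2 : α < k₂) {η : ℝ} (hη : 0 < η) :
    ∃ x₁ : ℝ, 0 < x₁ ∧ ∀ x, x₁ ≤ x → ∀ (μ : Measure Ω) (θ : Ω → ℝ), Measurable θ →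
      (∀ ω, 0 < θ ω) →
      ∫⁻ ω, ENNReal.ofReal (G (x / θ ω)) ∂μ ≤
        ENNReal.ofReal (G x) * (∫⁻ ω, ENNReal.ofReal (θ ω ^ α) ∂μ +
          ENNReal.ofReal η * ∫⁻ ω, ENNReal.ofReal (θ ω ^ k₁ + θ ω ^ k₂) ∂μ) ∧
      ENNReal.ofReal (G x) * ∫⁻ ω, ENNReal.ofReal (θ ω ^ α) ∂μ ≤
        ∫⁻ ω, ENNReal.ofReal (G (x / θ ω)) ∂μ + ENNReal.ofReal (G x) *
          (ENNReal.ofReal η * ∫⁻ ω, ENNReal.ofReal (θ ω ^ k₁ + θ ω ^ k₂) ∂μ) := by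
  obtain ⟨x₁, hx₁, H⟩ := h.uniform hk₁ h1 h2 hη
  refine ⟨x₁, hx₁, fun x hx μ θ hθm hθ => ?_⟩
  have hG := h.nonneg x
  have key := fun ω => abs_le.1 (H x hx _ (hθ ω))
  have p1 : ∀ ω, 0 < θ ω ^ k₁ + θ ω ^ k₂ := fun ω => by have := hθ ω; positivity
  have p2 : ∀ ω, 0 < θ ω ^ α := fun ω => by have := hθ ω; positivity
  have m1 : Measurable fun ω => ENNReal.ofReal (θ ω ^ α) :=
    (hθm.pow_const α).ennreal_ofReal
  have m2 : Measurable fun ω => ENNReal.ofReal (θ ω ^ k₁ + θ ω ^ k₂) :=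
    ((hθm.pow_const k₁).add (hθm.pow_const k₂)).ennreal_ofReal
  have m3 : Measurable fun ω => ENNReal.ofReal (G (x / θ ω)) :=
    (h.antitone.measurable.comp (hθm.const_div x)).ennreal_ofReal
  have m4 : Measurable fun ω =>
      ENNReal.ofReal (θ ω ^ α) + ENNReal.ofReal η * ENNReal.ofReal (θ ω ^ k₁ + θ ω ^ k₂) :=
    m1.add (m2.const_mul _)
  constructor
  · rw [← lintegral_const_mul _ m2, ← lintegral_add_left m1,
      ← lintegral_const_mul _ m4]
    refine lintegral_mono fun ω => ?_
    rw [← ENNReal.ofReal_mul hη.le, ← ENNReal.ofReal_add (p2 ω).le (mul_pos hη (p1 ω)).le,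
      ← ENNReal.ofReal_mul hG]
    refine ENNReal.ofReal_le_ofReal ?_
    have := (key ω).2
    nlinarith
  · rw [← lintegral_const_mul _ m2, ← lintegral_const_mul _ (m2.const_mul _),
      ← lintegral_add_left m3, ← lintegral_const_mul _ m1]
    refine lintegral_mono fun ω => ?_
    rw [← ENNReal.ofReal_mul hη.le, ← ENNReal.ofReal_mul hG, ← ENNReal.ofReal_mul hG,
      ← ENNReal.ofReal_add (h.nonneg _) (mul_nonneg hG (mul_pos hη (p1 ω)).le)]
    refine ENNReal.ofReal_le_ofReal ?_
    have := (key ω).1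
    nlinarith

lemma IsRegVarTail.exists_scale_le (h : IsRegVarTail G α) {c : ℝ} (hc : 0 < c) {L : ℝ}
    (hL : c ^ (-α) < L) : ∃ x₁ : ℝ, ∀ x, x₁ ≤ x → G (c * x) ≤ L * G x := by
  obtain ⟨x₁, hx₁⟩ := eventually_atTop.1 ((h.tendsto c hc).eventually (gt_mem_nhds hL))
  refine ⟨x₁, fun x hx => ?_⟩
  have := hx₁ x hx
  rw [div_lt_iff₀ (h.pos x)] at this
  exact this.le

/-- The moment `E[θᵏ]`. -/
def posMoment (P : Measure Ω) (θ : Ω → ℝ) (k : ℝ) : ℝ≥0∞ :=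
  ∫⁻ ω, ENNReal.ofReal (θ ω ^ k) ∂P

lemma lintegral_ofReal_rpow_add {θ : Ω → ℝ} (hθm : Measurable θ) (hθ : ∀ ω, 0 < θ ω)
    (k₁ k₂ : ℝ) : ∫⁻ ω, ENNReal.ofReal (θ ω ^ k₁ + θ ω ^ k₂) ∂P =
      posMoment P θ k₁ + posMoment P θ k₂ := by
  rw [posMoment, posMoment, ← lintegral_add_left (hθm.pow_const k₁).ennreal_ofReal]
  refine lintegral_congr fun ω => ?_
  have := hθ ω
  exact ENNReal.ofReal_add (by positivity) (by positivity)

lemma posMoment_ne_zero [NeZero P] {θ : Ω → ℝ} (hθm : Measurable θ) (hθ : ∀ ω, 0 < θ ω)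
    (k : ℝ) : posMoment P θ k ≠ 0 := by
  have hpos : ∀ ω, ENNReal.ofReal (θ ω ^ k) ≠ 0 := fun ω => by
    have h0 : 0 < θ ω ^ k := Real.rpow_pos_of_pos (hθ ω) k
    simpa using h0
  rw [posMoment, ← pos_iff_ne_zero, lintegral_pos_iff_support (hθm.pow_const k).ennreal_ofReal,
    show (Function.support fun ω => ENNReal.ofReal (θ ω ^ k)) = univ from
      eq_univ_of_forall hpos]
  exact NeZero.pos _

lemma posMoment_le_one_add [IsProbabilityMeasure P] {θ : Ω → ℝ} (hθ : ∀ ω, 0 < θ ω)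
    {k l : ℝ} (hk : 0 ≤ k) (hkl : k ≤ l) : posMoment P θ k ≤ 1 + posMoment P θ l := by
  have : (1 : ℝ≥0∞) = ∫⁻ _, 1 ∂P := by simp
  rw [posMoment, posMoment, this, ← lintegral_add_left measurable_const]
  refine lintegral_mono fun ω => ?_
  have h0 := hθ ω
  rw [← ENNReal.ofReal_one, ← ENNReal.ofReal_add zero_le_one (by positivity)]
  refine ENNReal.ofReal_le_ofReal ?_
  have p1 : 0 < θ ω ^ l := by positivity
  rcases le_total (θ ω) 1 with h | h
  · have := Real.rpow_le_one h0.le h hk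
    linarith
  · have := Real.rpow_le_rpow_of_exponent_le h hkl
    linarith

lemma posMoment_div {θ : Ω → ℝ} (hθ : ∀ ω, 0 < θ ω) {w : ℝ}
    (hw : 0 < w) (k : ℝ) :
    posMoment P θ k = ENNReal.ofReal (w ^ k) * posMoment P (fun ω => θ ω / w) k := by
  rw [posMoment, posMoment, ← lintegral_const_mul' _ _ ENNReal.ofReal_ne_top]
  refine lintegral_congr fun ω => ?_
  rw [← ENNReal.ofReal_mul (by positivity), ← Real.mul_rpow hw.le (by have := hθ ω; positivity)]
  rw [mul_div_cancel₀ _ hw.ne']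

variable {θ W : ℕ → Ω → ℝ}

/-- With `w i` the `L^k₂` norm of `θ i`, the ratio `θ i / w i` has `k₂`-th moment 1 and `k₁`-th
moment at most 2, so one constant serves all `i` in `hasNegligibleTails_of_one_lt`. Choosing `k₁ >
1` makes `∑ w i ^ k₁` finite. Only an upper bound on the tail of `W` enters, so both the gauge and
the norm of the claims can take its place. -/
theorem negligibleTails_and_moments_of_one_lt [IsProbabilityMeasure P] (h : IsRegVarTail G α)
    (hα : 1 < α) (hθm : ∀ i, Measurable (θ i)) (hθ : ∀ i ω, 0 < θ i ω)
    (hWm : ∀ i, Measurable (W i)) {K : ℝ≥0∞} (hK : K ≠ ⊤)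
    (H : ∀ i x, 0 < x → P {ω | x < θ i ω * W i ω} ≤
      K * ∫⁻ ω, ENNReal.ofReal (G (x / θ i ω)) ∂P)
    {k₂ : ℝ} (hk₂ : α < k₂) (hsum : ∑' i, posMoment P (θ i) k₂ ^ (1 / k₂) ≠ ⊤) :
    HasNegligibleTails P G (fun i ω => ENNReal.ofReal (θ i ω * W i ω)) ∧
      ∃ k₁ : ℝ, 0 < k₁ ∧ k₁ < α ∧ ∑' i, posMoment P (θ i) k₁ ≠ ⊤ ∧
        ∑' i, posMoment P (θ i) k₂ ≠ ⊤ := by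
  obtain ⟨k₁, hk1, hk1α⟩ := exists_between hα
  have hk₂0 : 0 < k₂ := by linarith
  set w : ℕ → ℝ≥0∞ := fun i => posMoment P (θ i) k₂ ^ (1 / k₂) with hw
  have hwtop : ∀ i, w i ≠ ⊤ := ENNReal.ne_top_of_tsum_ne_top hsum
  have hw0 : ∀ i, w i ≠ 0 := fun i => by
    rw [hw, Ne, ENNReal.rpow_eq_zero_iff_of_pos (by positivity)]
    exact posMoment_ne_zero (hθm i) (hθ i) k₂
  have hwr : ∀ i, 0 < (w i).toReal := fun i => ENNReal.toReal_pos (hw0 i) (hwtop i)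
  have hwk : ∀ i, posMoment P (θ i) k₂ = w i ^ k₂ := fun i => by
    rw [hw, ← ENNReal.rpow_mul, one_div, inv_mul_cancel₀ hk₂0.ne', ENNReal.rpow_one]
  have hwre : ∀ (i : ℕ) (k : ℝ), 0 < k → ENNReal.ofReal ((w i).toReal ^ k) = w i ^ k := fun i k hk => by
    rw [← ENNReal.ofReal_rpow_of_pos (hwr i), ENNReal.ofReal_toReal (hwtop i)]
  have hnorm : ∀ i, posMoment P (fun ω => θ i ω / (w i).toReal) k₂ = 1 := fun i => by
    have h1 := posMoment_div (P := P) (hθ i) (hwr i) k₂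
    rw [hwre i k₂ hk₂0, hwk i] at h1
    have h2 : w i ^ k₂ ≠ 0 := by simp [hw0 i, hwtop i, ENNReal.rpow_eq_zero_iff]
    have h3 : w i ^ k₂ ≠ ⊤ := ENNReal.rpow_ne_top_of_nonneg hk₂0.le (hwtop i)
    nth_rewrite 1 [← mul_one (w i ^ k₂)] at h1
    exact ((ENNReal.mul_right_inj h2 h3).1 h1).symm
  have hdpos : ∀ i ω, 0 < θ i ω / (w i).toReal := fun i ω => div_pos (hθ i ω) (hwr i)
  have hnorm1 : ∀ i, posMoment P (fun ω => θ i ω / (w i).toReal) k₁ ≤ 2 := fun i => by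
    refine (posMoment_le_one_add (hdpos i) (by linarith) (show k₁ ≤ k₂ by linarith)).trans ?_
    rw [hnorm, one_add_one_eq_two]
  constructor
  · obtain ⟨C, x₀, hC, hx₀, HC⟩ := h.lintegral_le (Ω := Ω) (by linarith) hk1α hk₂
    refine hasNegligibleTails_of_one_lt h hα (fun i => ((hθm i).mul (hWm i)).ennreal_ofReal)
      (fun i ω => ENNReal.ofReal_ne_top) hw0 hsum (K := K * (ENNReal.ofReal C * 3))
      (ENNReal.mul_ne_top hK (ENNReal.mul_ne_top ENNReal.ofReal_ne_top (by simp))) (x₀ := x₀) ?_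
    intro i x hx
    have hx0 : 0 < x := hx₀.trans_le hx
    have e : {ω | ENNReal.ofReal x * w i < ENNReal.ofReal (θ i ω * W i ω)} =
        {ω | x * (w i).toReal < θ i ω * W i ω} := by
      ext ω
      simp only [mem_ofPred_eq]
      rw [← ENNReal.ofReal_toReal (hwtop i), ← ENNReal.ofReal_mul hx0.le,
        ENNReal.ofReal_lt_ofReal_iff_of_nonneg (by positivity),
        ENNReal.toReal_ofReal ENNReal.toReal_nonneg]
    rw [e]
    refine (H i _ (mul_pos hx0 (hwr i))).trans ?_
    rw [mul_assoc K]
    gcongr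
    have e2 : ∀ ω, x * (w i).toReal / θ i ω = x / (θ i ω / (w i).toReal) := fun ω => by
      rw [div_div_eq_mul_div]
    simp only [e2]
    refine (HC x hx P _ (hdpos i)).trans ?_
    rw [lintegral_ofReal_rpow_add ((hθm i).div_const _) (hdpos i), hnorm]
    calc _ ≤ ENNReal.ofReal C * ENNReal.ofReal (G x) * (2 + 1) := by gcongr; exact hnorm1 i
      _ = _ := by rw [show (2 : ℝ≥0∞) + 1 = 3 by norm_num]; ring
  · refine ⟨k₁, by linarith, hk1α, ?_, ?_⟩
    · have hle : ∑' i, posMoment P (θ i) k₁ ≤ (∑' i, w i) ^ k₁ * 2 := by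
        calc ∑' i, posMoment P (θ i) k₁ ≤ ∑' i, w i ^ k₁ * 2 := by
              refine ENNReal.tsum_le_tsum fun i => ?_
              rw [posMoment_div (hθ i) (hwr i) k₁, hwre i k₁ (by linarith)]
              gcongr
              exact hnorm1 i
          _ ≤ _ := by
              rw [ENNReal.tsum_mul_right]
              gcongr
              exact ENNReal.tsum_rpow_le_rpow_tsum _ hk1.le
      exact ne_top_of_le_ne_top (ENNReal.mul_ne_top
        (ENNReal.rpow_ne_top_of_nonneg (by linarith) hsum) (by simp)) hle
    · have hle : ∑' i, posMoment P (θ i) k₂ ≤ (∑' i, w i) ^ k₂ := by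
        simp only [hwk]
        exact ENNReal.tsum_rpow_le_rpow_tsum _ (by linarith)
      exact ne_top_of_le_ne_top (ENNReal.rpow_ne_top_of_nonneg hk₂0.le hsum) hle

/-- Serves both `α < 1`, with `k = 1`, and `α = 1`, with `k = k₂`. Potter's bound with an exponent
`l ∈ (α, k)` absorbs the factor `u`, and the moments at `k₁` and `k₂` absorb `θ i`. -/
theorem negligibleTails_and_moments_of_max (h : IsRegVarTail G α)
    (hθm : ∀ i, Measurable (θ i)) (hθ : ∀ i ω, 0 < θ i ω)
    (hWm : ∀ i, Measurable (W i)) {K : ℝ≥0∞} (hK : K ≠ ⊤)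
    (H : ∀ i x, 0 < x → P {ω | x < θ i ω * W i ω} ≤
      K * ∫⁻ ω, ENNReal.ofReal (G (x / θ i ω)) ∂P)
    {k k₁ k₂ : ℝ} (hk : 1 ≤ k) (hαk : α < k) (hk₁0 : 0 < k₁) (hk₁ : k₁ < α) (hk₂ : α < k₂)
    (hsum : ∑' i, max (posMoment P (θ i) k₁) (posMoment P (θ i) k₂) ^ (1 / k) ≠ ⊤) :
    HasNegligibleTails P G (fun i ω => ENNReal.ofReal (θ i ω * W i ω)) ∧
      ∑' i, posMoment P (θ i) k₁ ≠ ⊤ ∧ ∑' i, posMoment P (θ i) k₂ ≠ ⊤ := by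
  have hk0 : 0 < k := by linarith
  set M : ℕ → ℝ≥0∞ := fun i => max (posMoment P (θ i) k₁) (posMoment P (θ i) k₂) with hM
  have hMsum : ∑' i, M i ≠ ⊤ := by
    refine ne_top_of_le_ne_top (ENNReal.rpow_ne_top_of_nonneg hk0.le hsum)
      (le_trans (le_of_eq ?_) (ENNReal.tsum_rpow_le_rpow_tsum _ hk))
    congr with i
    rw [← ENNReal.rpow_mul, one_div, inv_mul_cancel₀ hk0.ne', ENNReal.rpow_one]
  refine ⟨?_, ne_top_of_le_ne_top hMsum (ENNReal.tsum_le_tsum fun i => le_max_left _ _),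
    ne_top_of_le_ne_top hMsum (ENNReal.tsum_le_tsum fun i => le_max_right _ _)⟩
  obtain ⟨l, hl, hlk⟩ := exists_between hαk
  obtain ⟨C, x₀, hC, hx₀, HC⟩ := h.lintegral_le (Ω := Ω) hk₁0 hk₁ hk₂
  obtain ⟨C', hC', HC'⟩ := h.potter_up hl
  refine hasNegligibleTails_of_truncation (fun i => ((hθm i).mul (hWm i)).ennreal_ofReal) hk hlk
    hsum (K := K * ENNReal.ofReal C' * ENNReal.ofReal C * 2) (x₀ := x₀) ?_ ?_
  · exact ENNReal.mul_ne_top (ENNReal.mul_ne_top (ENNReal.mul_ne_top hK ENNReal.ofReal_ne_top)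
      ENNReal.ofReal_ne_top) (by simp)
  intro i x hx u hu
  have hx0 : 0 < x := hx₀.trans_le hx
  have hu0 : 0 < u := by linarith
  have e : {ω | ENNReal.ofReal (x / u) < ENNReal.ofReal (θ i ω * W i ω)} =
      {ω | x / u < θ i ω * W i ω} := by
    ext ω
    simp only [mem_ofPred_eq]
    rw [ENNReal.ofReal_lt_ofReal_iff_of_nonneg (by positivity)]
  rw [e]
  calc P {ω | x / u < θ i ω * W i ω}
      ≤ K * ∫⁻ ω, ENNReal.ofReal (G (x / u / θ i ω)) ∂P := H i _ (by positivity)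
    _ ≤ K * (ENNReal.ofReal C' * ENNReal.ofReal (u ^ l) *
          ∫⁻ ω, ENNReal.ofReal (G (x / θ i ω)) ∂P) := by
        gcongr
        rw [← lintegral_const_mul' _ _
          (ENNReal.mul_ne_top ENNReal.ofReal_ne_top ENNReal.ofReal_ne_top)]
        refine lintegral_mono fun ω => ?_
        rw [← ENNReal.ofReal_mul hC'.le, ← ENNReal.ofReal_mul (by positivity)]
        refine ENNReal.ofReal_le_ofReal ?_
        rw [div_right_comm]
        exact HC' _ (div_pos hx0 (hθ i ω)) u hu
    _ ≤ K * (ENNReal.ofReal C' * ENNReal.ofReal (u ^ l) *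
          (ENNReal.ofReal C * ENNReal.ofReal (G x) * (M i + M i))) := by
        gcongr
        refine (HC x hx P _ (hθ i)).trans ?_
        rw [lintegral_ofReal_rpow_add (hθm i) (hθ i)]
        gcongr
        · exact le_max_left _ _
        · exact le_max_right _ _
    _ = _ := by ring

end DiscountedTails

/-! ### One large term versus a large sum -/

section MaxSum

/-- A large sum is large because of a single term, of two terms, or of its tail. -/
lemma large_tsum_cases {b : ℕ → ℝ} (hb : ∀ i, 0 ≤ b i) {x δ : ℝ} (hx : 0 < x) (hδ : 0 < δ)
    (hδ' : δ < 1 / 2) {m : ℕ} (h : ENNReal.ofReal x < ∑' i, ENNReal.ofReal (b i)) :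
    (∃ i ∈ Finset.range m, (1 - 2 * δ) * x < b i) ∨
      (∃ i ∈ Finset.range m, ∃ j ∈ (Finset.range m).erase i,
        δ / (m + 1) * x < b i ∧ δ / (m + 1) * x < b j) ∨
      ENNReal.ofReal (δ * x) < ∑' i, ENNReal.ofReal (b (i + m)) := by
  by_contra! hcon
  obtain ⟨h1, h2, h3⟩ := hcon
  have hm0 : (0 : ℝ) < m + 1 := by positivity
  -- Terms at most `δ / (m + 1) * x` add up to at most `δ * x`. Hence some term exceeds this
  -- threshold, no second one does, and it must carry more than `(1 - δ) * x - δ * x`.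
  have hsum : (1 - δ) * x < ∑ i ∈ Finset.range m, b i := by
    rw [← ENNReal.summable.sum_add_tsum_nat_add' (f := fun i => ENNReal.ofReal (b i)) (k := m),
      ← ENNReal.ofReal_sum_of_nonneg fun i _ => hb i] at h
    have h4 := h.trans_le (add_le_add_right h3 _)
    rw [← ENNReal.ofReal_add (Finset.sum_nonneg fun i _ => hb i) (by positivity),
      ENNReal.ofReal_lt_ofReal_iff_of_nonneg hx.le] at h4
    linarith
  have hcard : ∀ s ⊆ Finset.range m, (∀ i ∈ s, b i ≤ δ / (m + 1) * x) →
      ∑ i ∈ s, b i ≤ δ * x := by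
    intro s hs hbs
    calc ∑ i ∈ s, b i ≤ ∑ i ∈ s, δ / (m + 1) * x := Finset.sum_le_sum hbs
      _ = s.card * (δ / (m + 1) * x) := by rw [Finset.sum_const, nsmul_eq_mul]
      _ ≤ (m + 1) * (δ / (m + 1) * x) := by
          have : (s.card : ℝ) ≤ m := by
            have := Finset.card_le_card hs
            rw [Finset.card_range] at this
            exact_mod_cast this
          gcongr
          linarith
      _ = δ * x := by field_simp
  obtain ⟨i, hi, hbi⟩ : ∃ i ∈ Finset.range m, δ / (m + 1) * x < b i := by
    by_contra! hc
    have := hcard _ subset_rfl hc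
    nlinarith
  have h4 := hcard _ (Finset.erase_subset i _) fun j hj => h2 i hi j hj hbi
  rw [← Finset.add_sum_erase _ _ hi] at hsum
  have := h1 i hi
  linarith

/-- A Bonferroni inequality. -/
lemma sum_measure_le_measure_biUnion_add {Ω : Type*} [MeasurableSpace Ω] {P : Measure Ω}
    {A : ℕ → Set Ω} (hA : ∀ i, MeasurableSet (A i)) (m : ℕ) :
    ∑ i ∈ Finset.range m, P (A i) ≤ P (⋃ i ∈ Finset.range m, A i) +
      ∑ i ∈ Finset.range m, ∑ j ∈ Finset.range i, P (A i ∩ A j) := by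
  induction m with
  | zero => simp
  | succ m ih =>
    set U := ⋃ i ∈ Finset.range m, A i with hU
    have hUm : MeasurableSet U := Finset.measurableSet_biUnion _ fun i _ => hA i
    have h1 : P (⋃ i ∈ Finset.range (m + 1), A i) = P U + P (A m \ U) := by
      rw [Finset.range_add_one, Finset.set_biUnion_insert, ← hU, union_comm, ← union_sdiff_self,
        measure_union disjoint_sdiff_right ((hA m).diff hUm)]
    have h2 : P (A m) ≤ P (A m \ U) + ∑ j ∈ Finset.range m, P (A m ∩ A j) := by
      calc P (A m) = P (A m \ U) + P (A m ∩ U) := by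
            rw [add_comm, measure_inter_add_sdiff _ hUm]
        _ ≤ _ := by
            gcongr
            rw [hU, inter_iUnion₂]
            exact measure_biUnion_finset_le _ _
    rw [Finset.sum_range_succ, Finset.sum_range_succ, h1]
    calc _ ≤ (P U + ∑ i ∈ Finset.range m, ∑ j ∈ Finset.range i, P (A i ∩ A j)) +
          (P (A m \ U) + ∑ j ∈ Finset.range m, P (A m ∩ A j)) := add_le_add ih h2
      _ = _ := by ring

end MaxSum

/-! ### Scalar discounted claims and pairs of large claims -/

section Core

variable {Ω : Type*} {m : MeasurableSpace Ω} [mΩ : MeasurableSpace Ω] {P : Measure Ω}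
  {G : ℝ → ℝ} {α : ℝ} {θ Y : ℕ → Ω → ℝ}

/-- Discounted claims `θ i * Y i` with discount factors that are measurable with respect to `m`,
where the claims have tail function `G` and are independent of `m`. -/
structure IsDiscountedModel {Ω : Type*} (m : MeasurableSpace Ω) [mΩ : MeasurableSpace Ω]
    (P : Measure Ω) (G : ℝ → ℝ)
    (θ Y : ℕ → Ω → ℝ) : Prop where
  le : m ≤ mΩ
  measurable_discount : ∀ i, Measurable[m] (θ i)
  discount_pos : ∀ i ω, 0 < θ i ω
  measurable_claim : ∀ i, Measurable (Y i)
  claim_nonneg : ∀ i ω, 0 ≤ Y i ω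
  claim_tail : ∀ i x, P {ω | x < Y i ω} = ENNReal.ofReal (G x)
  tail : ∀ i x S, 0 < x → MeasurableSet[m] S →
    P (S ∩ {ω | x < θ i ω * Y i ω}) = ∫⁻ ω in S, ENNReal.ofReal (G (x / θ i ω)) ∂P

/-- Pairs of claims are asymptotically independent. -/
def PairwiseTAI (P : Measure Ω) (G : ℝ → ℝ) (Y : ℕ → Ω → ℝ) : Prop :=
  ∀ i j, i ≠ j → ∀ ε : ℝ≥0∞, ε ≠ 0 → ∃ x₁ : ℝ, ∀ x, x₁ ≤ x →
    P ({ω | x < Y i ω} ∩ {ω | x < Y j ω}) ≤ ε * ENNReal.ofReal (G x)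

namespace IsDiscountedModel

lemma measurable_discount' (D : IsDiscountedModel m P G θ Y) (i : ℕ) : Measurable (θ i) :=
  (D.measurable_discount i).mono D.le le_rfl

lemma measurableSet_gt (D : IsDiscountedModel m P G θ Y) (i : ℕ) (x : ℝ) :
    MeasurableSet {ω | x < θ i ω * Y i ω} :=
  measurableSet_lt measurable_const ((D.measurable_discount' i).mul (D.measurable_claim i))

/-- Asymptotic independence of two discounted claims. -/
lemma pair_le [IsProbabilityMeasure P] (D : IsDiscountedModel m P G θ Y)
    (h : IsRegVarTail G α) (hTAI : PairwiseTAI P G Y)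
    {k₁ k₂ : ℝ} (hk₁0 : 0 < k₁) (hk₁ : k₁ < α) (hk₂ : α < k₂)
    (hM : ∀ i, ∫⁻ ω, ENNReal.ofReal (θ i ω ^ k₁ + θ i ω ^ k₂) ∂P ≠ ⊤)
    {i j : ℕ} (hij : i ≠ j) {c : ℝ} (hc : 0 < c) {ε : ℝ≥0∞} (hε : ε ≠ 0) :
    ∃ x₁ : ℝ, ∀ x, x₁ ≤ x →
      P ({ω | c * x < θ i ω * Y i ω} ∩ {ω | c * x < θ j ω * Y j ω}) ≤
        ε * ENNReal.ofReal (G x) := by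
  have hε2 : ε / 2 ≠ 0 := by simpa using hε
  obtain ⟨C, x₀, hC, hx₀, HC⟩ := h.lintegral_le (Ω := Ω) hk₁0 hk₁ hk₂
  obtain ⟨L, hL0, xL, hL⟩ : ∃ L : ℝ, 0 < L ∧ ∃ x₁ : ℝ, ∀ x, x₁ ≤ x → G (c * x) ≤ L * G x :=
    ⟨c ^ (-α) + 1, by positivity, h.exists_scale_le hc (lt_add_one _)⟩
  -- Off `S n` both discount factors are at most `n`, so both claims exceed `c / n * x` and
  -- asymptotic independence applies. On `S n` the claim `i` is dropped, and integrability of the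
  -- moments of `θ j` makes the rest small.
  set S : ℕ → Set Ω := fun n => {ω | (n : ℝ) < θ i ω} ∪ {ω | (n : ℝ) < θ j ω} with hS
  have hSm : ∀ n, MeasurableSet[m] (S n) := fun n =>
    MeasurableSet.union (measurableSet_lt (measurable_const) (D.measurable_discount i))
      (measurableSet_lt (measurable_const) (D.measurable_discount j))
  have hSlim : Tendsto (fun n => P (S n)) atTop (𝓝 0) := by
    have hanti : Antitone S := by
      intro a b hab
      have hab' : (a : ℝ) ≤ b := Nat.cast_le.2 hab
      exact union_subset_union (fun ω (hω : (b : ℝ) < θ i ω) => hab'.trans_lt hω)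
        (fun ω (hω : (b : ℝ) < θ j ω) => hab'.trans_lt hω)
    have h1 := tendsto_measure_iInter_atTop (μ := P)
      (fun n => (D.le _ (hSm n)).nullMeasurableSet) hanti ⟨0, measure_ne_top _ _⟩
    have h2 : ⋂ n, S n = ∅ := by
      refine eq_empty_of_forall_notMem fun ω hω => ?_
      obtain ⟨n, hn⟩ := exists_nat_ge (max (θ i ω) (θ j ω))
      rcases mem_iInter.1 hω n with h3 | h3
      · exact absurd ((le_max_left _ _).trans hn) (not_le.2 h3)
      · exact absurd ((le_max_right _ _).trans hn) (not_le.2 h3)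
    rwa [h2, measure_empty] at h1
  have hint := tendsto_setLIntegral_zero (hM j) hSlim
  have hint2 : Tendsto (fun n => ENNReal.ofReal C * ENNReal.ofReal L *
      ∫⁻ ω in S n, ENNReal.ofReal (θ j ω ^ k₁ + θ j ω ^ k₂) ∂P) atTop (𝓝 0) := by
    have := ENNReal.Tendsto.const_mul (a := ENNReal.ofReal C * ENNReal.ofReal L) hint
      (Or.inr (ENNReal.mul_ne_top ENNReal.ofReal_ne_top ENNReal.ofReal_ne_top))
    rwa [mul_zero] at this
  obtain ⟨n, hn, hn1⟩ := ((hint2.eventually (ge_mem_nhds (pos_iff_ne_zero.2 hε2))).and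
    (eventually_ge_atTop 1)).exists
  have hn0 : (0 : ℝ) < n := by exact_mod_cast hn1
  obtain ⟨L', hL'0, xL', hL'⟩ : ∃ L : ℝ, 0 < L ∧ ∃ x₁ : ℝ, ∀ x, x₁ ≤ x →
      G (c / n * x) ≤ L * G x :=
    ⟨(c / n) ^ (-α) + 1, by positivity, h.exists_scale_le (by positivity) (lt_add_one _)⟩
  have hL'e : ENNReal.ofReal L' ≠ 0 := by simpa using hL'0
  obtain ⟨xT, hT⟩ := hTAI i j hij (ε / 2 / ENNReal.ofReal L')
    (ENNReal.div_ne_zero.2 ⟨hε2, ENNReal.ofReal_ne_top⟩)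
  refine ⟨max (max (max xL xL') 1) (max (x₀ / c) (xT * n / c)), fun x hx => ?_⟩
  have hxa := (le_max_left _ _).trans hx
  have hxb := (le_max_right _ _).trans hx
  have hx1 : 0 < x := lt_of_lt_of_le one_pos ((le_max_right _ _).trans hxa)
  have hxx0 : x₀ ≤ c * x := by
    have := (le_max_left _ _).trans hxb
    rwa [div_le_iff₀ hc, mul_comm] at this
  have hxT : xT ≤ c / n * x := by
    have := (le_max_right _ _).trans hxb
    rw [div_le_iff₀ hc] at this
    rw [div_mul_eq_mul_div, le_div_iff₀ hn0]
    linarith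
  have hsub : {ω | c * x < θ i ω * Y i ω} ∩ {ω | c * x < θ j ω * Y j ω} ⊆
      ({ω | c / n * x < Y i ω} ∩ {ω | c / n * x < Y j ω}) ∪
        (S n ∩ {ω | c * x < θ j ω * Y j ω}) := by
    rintro ω ⟨h1, h2⟩
    by_cases hω : ω ∈ S n
    · exact Or.inr ⟨hω, h2⟩
    · left
      simp only [hS, mem_union, mem_ofPred_eq, not_or, not_lt] at hω
      have aux : ∀ l, θ l ω ≤ n → c * x < θ l ω * Y l ω → c / n * x < Y l ω := by
        intro l h3 h4
        rw [div_mul_eq_mul_div, div_lt_iff₀ hn0]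
        have := mul_le_mul_of_nonneg_right h3 (D.claim_nonneg l ω)
        linarith
      exact ⟨aux i hω.1 h1, aux j hω.2 h2⟩
  calc _ ≤ _ := measure_mono hsub
    _ ≤ _ := measure_union_le _ _
    _ ≤ ε / 2 * ENNReal.ofReal (G x) + ε / 2 * ENNReal.ofReal (G x) := by
        gcongr
        · calc _ ≤ ε / 2 / ENNReal.ofReal L' * ENNReal.ofReal (G (c / n * x)) := hT _ hxT
            _ ≤ ε / 2 / ENNReal.ofReal L' * (ENNReal.ofReal L' * ENNReal.ofReal (G x)) := by
                rw [← ENNReal.ofReal_mul hL'0.le]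
                gcongr
                exact hL' x (((le_max_right _ _).trans (le_max_left _ _)).trans hxa)
            _ = _ := by rw [← mul_assoc, ENNReal.div_mul_cancel hL'e ENNReal.ofReal_ne_top]
        · rw [D.tail j _ _ (by positivity) (hSm n)]
          calc _ ≤ ENNReal.ofReal C * ENNReal.ofReal (G (c * x)) *
                ∫⁻ ω in S n, ENNReal.ofReal (θ j ω ^ k₁ + θ j ω ^ k₂) ∂P :=
                HC _ hxx0 (P.restrict (S n)) _ (D.discount_pos j)
            _ ≤ ENNReal.ofReal C * (ENNReal.ofReal L * ENNReal.ofReal (G x)) *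
                ∫⁻ ω in S n, ENNReal.ofReal (θ j ω ^ k₁ + θ j ω ^ k₂) ∂P := by
                rw [← ENNReal.ofReal_mul hL0.le]
                gcongr
                exact hL x (((le_max_left _ _).trans (le_max_left _ _)).trans hxa)
            _ = (ENNReal.ofReal C * ENNReal.ofReal L *
                ∫⁻ ω in S n, ENNReal.ofReal (θ j ω ^ k₁ + θ j ω ^ k₂) ∂P) *
                ENNReal.ofReal (G x) := by ring
            _ ≤ _ := by gcongr
    _ = ε * ENNReal.ofReal (G x) := by rw [← add_mul, ENNReal.add_halves]

lemma exists_forall_pair_le [IsProbabilityMeasure P] (D : IsDiscountedModel m P G θ Y)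
    (h : IsRegVarTail G α) (hTAI : PairwiseTAI P G Y)
    {k₁ k₂ : ℝ} (hk₁0 : 0 < k₁) (hk₁ : k₁ < α) (hk₂ : α < k₂)
    (hM : ∀ i, ∫⁻ ω, ENNReal.ofReal (θ i ω ^ k₁ + θ i ω ^ k₂) ∂P ≠ ⊤)
    (n : ℕ) {c : ℝ} (hc : 0 < c) {ε : ℝ≥0∞} (hε : ε ≠ 0) :
    ∃ x₁ : ℝ, ∀ x, x₁ ≤ x → ∀ i ∈ Finset.range n, ∀ j ∈ Finset.range n, i ≠ j →
      P ({ω | c * x < θ i ω * Y i ω} ∩ {ω | c * x < θ j ω * Y j ω}) ≤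
        ε * ENNReal.ofReal (G x) := by
  have key : ∀ i j, ∃ x₁ : ℝ, ∀ x, x₁ ≤ x → i ≠ j →
      P ({ω | c * x < θ i ω * Y i ω} ∩ {ω | c * x < θ j ω * Y j ω}) ≤
        ε * ENNReal.ofReal (G x) := by
    intro i j
    by_cases hij : i = j
    · exact ⟨0, fun _ _ h => absurd hij h⟩
    · obtain ⟨x₁, hx₁⟩ := D.pair_le h hTAI hk₁0 hk₁ hk₂ hM hij hc hε
      exact ⟨x₁, fun x hx _ => hx₁ x hx⟩
  choose f hf using key
  have hev : ∀ᶠ x in atTop, ∀ i ∈ Finset.range n, ∀ j ∈ Finset.range n, f i j ≤ x := by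
    rw [Filter.eventually_all_finset]
    intro i _
    rw [Filter.eventually_all_finset]
    exact fun j _ => eventually_ge_atTop _
  obtain ⟨x₁, hx₁⟩ := eventually_atTop.1 hev
  exact ⟨x₁, fun x hx i hi j hj hij => hf i j x (hx₁ x hx i hi j hj) hij⟩

end IsDiscountedModel

end Core

/-! ### Upper and lower bounds with an error uniform over events -/

section CoreBounds

variable {Ω : Type*} {m : MeasurableSpace Ω} [mΩ : MeasurableSpace Ω] {P : Measure Ω}
  {G : ℝ → ℝ} {α : ℝ} {θ Y : ℕ → Ω → ℝ}

lemma ENNReal.exists_ofReal_mul_le {W : ℝ≥0∞} (hW : W ≠ ⊤) {ε : ℝ≥0∞} (hε : ε ≠ 0) :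
    ∃ η : ℝ, 0 < η ∧ η ≤ 1 ∧ ENNReal.ofReal η * W ≤ ε := by
  have h1 : Tendsto (fun η : ℝ => ENNReal.ofReal η * W) (𝓝[>] 0) (𝓝 (ENNReal.ofReal 0 * W)) :=
    ENNReal.Tendsto.mul_const (tendsto_nhdsWithin_of_tendsto_nhds
      (ENNReal.continuous_ofReal.tendsto 0)) (Or.inr hW)
  rw [ENNReal.ofReal_zero, zero_mul] at h1
  have h2 : ∀ᶠ δ : ℝ in 𝓝[>] 0, δ < 1 :=
    tendsto_nhdsWithin_of_tendsto_nhds tendsto_id |>.eventually (gt_mem_nhds one_pos)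
  obtain ⟨η, ⟨h3, h4⟩, h5⟩ := ((h1.eventually (ge_mem_nhds (pos_iff_ne_zero.2 hε))).and
    h2).and self_mem_nhdsWithin |>.exists
  exact ⟨η, h5, h4.le, h3⟩

lemma exists_one_sub_two_mul_rpow_lt (α : ℝ) {η : ℝ} (hη : 0 < η) :
    ∃ δ : ℝ, 0 < δ ∧ δ < 1 / 2 ∧ (1 - 2 * δ) ^ (-α) < 1 + η := by
  have h1 : ContinuousAt (fun δ : ℝ => (1 - 2 * δ) ^ (-α)) 0 :=
    ContinuousAt.rpow_const (by fun_prop) (Or.inl (by norm_num))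
  have h2 : Tendsto (fun δ : ℝ => (1 - 2 * δ) ^ (-α)) (𝓝[>] 0) (𝓝 1) := by
    have := h1.tendsto
    simp only [mul_zero, sub_zero, Real.one_rpow] at this
    exact tendsto_nhdsWithin_of_tendsto_nhds this
  have h3 : ∀ᶠ δ : ℝ in 𝓝[>] 0, δ < 1 / 2 :=
    tendsto_nhdsWithin_of_tendsto_nhds tendsto_id |>.eventually (gt_mem_nhds (by norm_num))
  obtain ⟨δ, ⟨h4, h5⟩, h6⟩ := ((h2.eventually (gt_mem_nhds (by linarith : (1 : ℝ) < 1 + η))).and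
    h3).and self_mem_nhdsWithin |>.exists
  exact ⟨δ, h6, h5, h4⟩

lemma ENNReal.exists_nat_mul_le {ε : ℝ≥0∞} (hε : ε ≠ 0) (n : ℕ) :
    ∃ ε' : ℝ≥0∞, ε' ≠ 0 ∧ (n : ℝ≥0∞) * ε' ≤ ε := by
  refine ⟨ε / (n + 1), ENNReal.div_ne_zero.2 ⟨hε, by finiteness⟩, ?_⟩
  calc (n : ℝ≥0∞) * (ε / (n + 1)) ≤ (n + 1) * (ε / (n + 1)) := by gcongr; simp
    _ ≤ ε := ENNReal.mul_div_le

lemma lintegral_rpow_le_lintegral_add {μ : Measure Ω} {θ : Ω → ℝ} (hθ : ∀ ω, 0 < θ ω)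
    {k₁ k₂ : ℝ} (hk₁ : k₁ < α) (hk₂ : α < k₂) :
    ∫⁻ ω, ENNReal.ofReal (θ ω ^ α) ∂μ ≤ ∫⁻ ω, ENNReal.ofReal (θ ω ^ k₁ + θ ω ^ k₂) ∂μ := by
  refine lintegral_mono fun ω => ENNReal.ofReal_le_ofReal ?_
  have h0 := hθ ω
  have p1 : 0 < θ ω ^ k₁ := by positivity
  have p2 : 0 < θ ω ^ k₂ := by positivity
  rcases le_total (θ ω) 1 with h | h
  · have := Real.rpow_le_rpow_of_exponent_ge h0 h hk₁.le
    linarith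
  · have := Real.rpow_le_rpow_of_exponent_le h hk₂.le
    linarith

namespace IsDiscountedModel

lemma mul_nonneg (D : IsDiscountedModel m P G θ Y) (i : ℕ) (ω : Ω) : 0 ≤ θ i ω * Y i ω :=
  _root_.mul_nonneg (D.discount_pos i ω).le (D.claim_nonneg i ω)

/-- The three cases of `large_tsum_cases` each receive `ε / 3`: a single large term gives the main
contribution, a pair is negligible by asymptotic independence, and the remainder by `hneg`. Only the
first case involves `S`, with an error governed by the full moments `w i`; hence one `x₁` for all
`S`. -/
theorem measure_sum_gt_le [IsProbabilityMeasure P] (D : IsDiscountedModel m P G θ Y)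
    (h : IsRegVarTail G α) (hTAI : PairwiseTAI P G Y)
    (hneg : HasNegligibleTails P G fun i ω => ENNReal.ofReal (θ i ω * Y i ω))
    {k₁ k₂ : ℝ} (hk₁0 : 0 < k₁) (hk₁ : k₁ < α) (hk₂ : α < k₂)
    (hM : ∑' i, ∫⁻ ω, ENNReal.ofReal (θ i ω ^ k₁ + θ i ω ^ k₂) ∂P ≠ ⊤)
    {ε : ℝ≥0∞} (hε : ε ≠ 0) :
    ∃ x₁ : ℝ, ∀ x, x₁ ≤ x → ∀ S : ℕ → Set Ω, (∀ i, MeasurableSet[m] (S i)) →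
      P {ω | ENNReal.ofReal x <
          ∑' i, ENNReal.ofReal ((S i).indicator (fun ω => θ i ω * Y i ω) ω)} ≤
        ENNReal.ofReal (G x) *
          (∑' i, ∫⁻ ω in S i, ENNReal.ofReal (θ i ω ^ α) ∂P + ε) := by
  set w : ℕ → ℝ≥0∞ := fun i => ∫⁻ ω, ENNReal.ofReal (θ i ω ^ k₁ + θ i ω ^ k₂) ∂P with hw
  set W := ∑' i, w i with hW
  have hε3 : ε / 3 ≠ 0 := by simpa using hε
  -- Expanding `(1 + η) * (∑ I i + η * W)` costs at most `η * (W + W + W)`, as `∑ I i ≤ W` and `η ≤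
  -- 1`.
  obtain ⟨η, hη0, hη1, hη⟩ := ENNReal.exists_ofReal_mul_le (W := 3 * W)
    (ENNReal.mul_ne_top (by simp) hM) hε3
  obtain ⟨δ, hδ0, hδ1, hδ⟩ := exists_one_sub_two_mul_rpow_lt α hη0
  have hδ2 : 0 < 1 - 2 * δ := by linarith
  obtain ⟨xa, hxa⟩ := h.exists_scale_le hδ2 hδ
  obtain ⟨xb, hxb0, hxb⟩ := h.lintegral_uniform (Ω := Ω) hk₁0 hk₁ hk₂ hη0
  obtain ⟨L, hL0, xL, hL⟩ : ∃ L : ℝ, 0 < L ∧ ∃ x₁ : ℝ, ∀ x, x₁ ≤ x → G (δ * x) ≤ L * G x :=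
    ⟨δ ^ (-α) + 1, by positivity, h.exists_scale_le hδ0 (lt_add_one _)⟩
  have hLe : ENNReal.ofReal L ≠ 0 := by simpa using hL0
  obtain ⟨n, xc, hxc⟩ := hneg (ε / 3 / ENNReal.ofReal L)
    (ENNReal.div_ne_zero.2 ⟨hε3, ENNReal.ofReal_ne_top⟩)
  obtain ⟨ε', hε'0, hε'⟩ := ENNReal.exists_nat_mul_le hε3 (n * n)
  have hn0 : (0 : ℝ) < n + 1 := by positivity
  obtain ⟨xd, hxd⟩ := D.exists_forall_pair_le h hTAI hk₁0 hk₁ hk₂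
    (ENNReal.ne_top_of_tsum_ne_top hM) n (c := δ / (n + 1)) (by positivity) hε'0
  refine ⟨max (max (max xa xL) (max xd 1)) (max (xb / (1 - 2 * δ)) (xc / δ)),
    fun x hx S hS => ?_⟩
  simp only [max_le_iff] at hx
  obtain ⟨⟨⟨hx1, hx2⟩, hx3, hx4⟩, hx5, hx6⟩ := hx
  have hx0 : 0 < x := by linarith
  rw [div_le_iff₀ hδ2, mul_comm] at hx5
  rw [div_le_iff₀ hδ0, mul_comm] at hx6
  set I : ℕ → ℝ≥0∞ := fun i => ∫⁻ ω in S i, ENNReal.ofReal (θ i ω ^ α) ∂P with hI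
  set g := ENNReal.ofReal (G x) with hg
  have hSΩ : ∀ i, MeasurableSet (S i) := fun i => D.le _ (hS i)
  have hIw : ∀ i, I i ≤ w i := fun i =>
    (lintegral_rpow_le_lintegral_add (D.discount_pos i) hk₁ hk₂).trans (setLIntegral_le_lintegral _ _)
  set A : ℕ → Set Ω := fun i => {ω | δ / (n + 1) * x < θ i ω * Y i ω} with hA
  have hsub : {ω | ENNReal.ofReal x <
      ∑' i, ENNReal.ofReal ((S i).indicator (fun ω => θ i ω * Y i ω) ω)} ⊆
      (⋃ i ∈ Finset.range n, S i ∩ {ω | (1 - 2 * δ) * x < θ i ω * Y i ω}) ∪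
      ((⋃ i ∈ Finset.range n, ⋃ j ∈ (Finset.range n).erase i, A i ∩ A j) ∪
      {ω | ENNReal.ofReal (δ * x) < ∑' i, ENNReal.ofReal (θ (i + n) ω * Y (i + n) ω)}) := by
    intro ω hω
    have hle : ∀ i, (S i).indicator (fun ω => θ i ω * Y i ω) ω ≤ θ i ω * Y i ω := fun i =>
      indicator_le_self' (fun _ _ => D.mul_nonneg i _) _
    rcases large_tsum_cases (b := fun i => (S i).indicator (fun ω => θ i ω * Y i ω) ω)
      (fun i => indicator_apply_nonneg fun _ => D.mul_nonneg i ω) hx0 hδ0 hδ1 (m := n) hω with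
      ⟨i, hi, h1⟩ | ⟨i, hi, j, hj, h1, h2⟩ | h1
    · left
      have hiS : ω ∈ S i := by
        by_contra hiS
        rw [indicator_of_notMem hiS] at h1
        have : 0 < (1 - 2 * δ) * x := by positivity
        linarith
      exact mem_biUnion hi ⟨hiS, h1.trans_le (hle i)⟩
    · right; left
      exact mem_biUnion hi (mem_biUnion hj ⟨h1.trans_le (hle i), h2.trans_le (hle j)⟩)
    · right; right
      exact h1.trans_le (ENNReal.tsum_le_tsum fun i => ENNReal.ofReal_le_ofReal (hle _))
  have b1 : P (⋃ i ∈ Finset.range n, S i ∩ {ω | (1 - 2 * δ) * x < θ i ω * Y i ω}) ≤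
      g * (∑' i, I i + ε / 3) := by
    calc _ ≤ ∑ i ∈ Finset.range n, P (S i ∩ {ω | (1 - 2 * δ) * x < θ i ω * Y i ω}) :=
          measure_biUnion_finset_le _ _
      _ ≤ ∑ i ∈ Finset.range n, ENNReal.ofReal (G ((1 - 2 * δ) * x)) *
            (I i + ENNReal.ofReal η * w i) := by
          refine Finset.sum_le_sum fun i _ => ?_
          rw [D.tail i _ _ (by positivity) (hS i)]
          refine (hxb _ hx5 _ _ (D.measurable_discount' i) (D.discount_pos i)).1.trans ?_
          gcongr
          exact setLIntegral_le_lintegral _ _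
      _ ≤ ∑' i, ENNReal.ofReal (G ((1 - 2 * δ) * x)) * (I i + ENNReal.ofReal η * w i) :=
          ENNReal.sum_le_tsum _
      _ = ENNReal.ofReal (G ((1 - 2 * δ) * x)) * (∑' i, I i + ENNReal.ofReal η * W) := by
          rw [ENNReal.tsum_mul_left, ENNReal.tsum_add, ENNReal.tsum_mul_left]
      _ ≤ ((1 + ENNReal.ofReal η) * g) * (∑' i, I i + ENNReal.ofReal η * W) := by
          gcongr
          rw [← ENNReal.ofReal_one, ← ENNReal.ofReal_add zero_le_one hη0.le,
            ← ENNReal.ofReal_mul (by positivity)]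
          exact ENNReal.ofReal_le_ofReal (hxa x hx1)
      _ = g * (∑' i, I i + (ENNReal.ofReal η * (∑' i, I i + W + ENNReal.ofReal η * W))) := by
          ring
      _ ≤ g * (∑' i, I i + (ENNReal.ofReal η * (W + W + 1 * W))) := by
          gcongr
          · exact ENNReal.tsum_le_tsum hIw
          · exact ENNReal.ofReal_le_one.2 hη1
      _ ≤ g * (∑' i, I i + ε / 3) := by
          gcongr
          refine le_trans (le_of_eq ?_) hη
          ring
  have b2 : P (⋃ i ∈ Finset.range n, ⋃ j ∈ (Finset.range n).erase i, A i ∩ A j) ≤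
      g * (ε / 3) := by
    calc _ ≤ ∑ i ∈ Finset.range n, P (⋃ j ∈ (Finset.range n).erase i, A i ∩ A j) :=
          measure_biUnion_finset_le _ _
      _ ≤ ∑ i ∈ Finset.range n, ∑ j ∈ (Finset.range n).erase i, P (A i ∩ A j) :=
          Finset.sum_le_sum fun i _ => measure_biUnion_finset_le _ _
      _ ≤ ∑ i ∈ Finset.range n, ∑ j ∈ (Finset.range n).erase i, ε' * g := by
          refine Finset.sum_le_sum fun i hi => Finset.sum_le_sum fun j hj => ?_
          exact hxd x hx3 i hi j (Finset.mem_of_mem_erase hj) (Finset.ne_of_mem_erase hj).symm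
      _ ≤ ∑ i ∈ Finset.range n, ∑ j ∈ Finset.range n, ε' * g :=
          Finset.sum_le_sum fun i _ =>
            Finset.sum_le_sum_of_subset (Finset.erase_subset _ _)
      _ = ((n * n : ℕ) * ε') * g := by
          simp only [Finset.sum_const, Finset.card_range, nsmul_eq_mul]
          push_cast; ring
      _ ≤ g * (ε / 3) := by rw [mul_comm]; gcongr
  have b3 : P {ω | ENNReal.ofReal (δ * x) <
      ∑' i, ENNReal.ofReal (θ (i + n) ω * Y (i + n) ω)} ≤ g * (ε / 3) := by
    calc _ ≤ ε / 3 / ENNReal.ofReal L * ENNReal.ofReal (G (δ * x)) := hxc _ hx6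
      _ ≤ ε / 3 / ENNReal.ofReal L * (ENNReal.ofReal L * g) := by
          rw [hg, ← ENNReal.ofReal_mul hL0.le]
          gcongr
          exact hL x hx2
      _ = _ := by
          rw [← mul_assoc, ENNReal.div_mul_cancel hLe ENNReal.ofReal_ne_top, mul_comm]
  calc _ ≤ _ := measure_mono hsub
    _ ≤ g * (∑' i, I i + ε / 3) + (g * (ε / 3) + g * (ε / 3)) :=
        (measure_union_le _ _).trans (add_le_add b1 ((measure_union_le _ _).trans
          (add_le_add b2 b3)))
    _ = g * (∑' i, I i + (ε / 3 + ε / 3 + ε / 3)) := by ring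
    _ = _ := by rw [ENNReal.add_thirds]

/-- Bonferroni's inequality on the first `n` claims; the limiting mass of the other claims is at
most `ε / 3`. -/
theorem le_measure_exists_gt [IsProbabilityMeasure P] (D : IsDiscountedModel m P G θ Y)
    (h : IsRegVarTail G α) (hTAI : PairwiseTAI P G Y)
    {k₁ k₂ : ℝ} (hk₁0 : 0 < k₁) (hk₁ : k₁ < α) (hk₂ : α < k₂)
    (hM : ∑' i, ∫⁻ ω, ENNReal.ofReal (θ i ω ^ k₁ + θ i ω ^ k₂) ∂P ≠ ⊤)
    {ε : ℝ≥0∞} (hε : ε ≠ 0) :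
    ∃ x₁ : ℝ, ∀ x, x₁ ≤ x → ∀ S : ℕ → Set Ω, (∀ i, MeasurableSet[m] (S i)) →
      ENNReal.ofReal (G x) * ∑' i, ∫⁻ ω in S i, ENNReal.ofReal (θ i ω ^ α) ∂P ≤
        P (⋃ i, S i ∩ {ω | x < θ i ω * Y i ω}) + ENNReal.ofReal (G x) * ε := by
  set w : ℕ → ℝ≥0∞ := fun i => ∫⁻ ω, ENNReal.ofReal (θ i ω ^ k₁ + θ i ω ^ k₂) ∂P with hw
  set W := ∑' i, w i with hW
  have hε3 : ε / 3 ≠ 0 := by simpa using hε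
  obtain ⟨η, hη0, -, hη⟩ := ENNReal.exists_ofReal_mul_le hM hε3
  obtain ⟨xb, hxb0, hxb⟩ := h.lintegral_uniform (Ω := Ω) hk₁0 hk₁ hk₂ hη0
  obtain ⟨n, hn⟩ := ENNReal.exists_tsum_nat_add_le hM hε3
  obtain ⟨ε', hε'0, hε'⟩ := ENNReal.exists_nat_mul_le hε3 (n * n)
  obtain ⟨xd, hxd⟩ := D.exists_forall_pair_le h hTAI hk₁0 hk₁ hk₂
    (ENNReal.ne_top_of_tsum_ne_top hM) n one_pos hε'0
  refine ⟨max (max xb xd) 1, fun x hx S hS => ?_⟩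
  simp only [max_le_iff] at hx
  obtain ⟨⟨hx1, hx2⟩, hx3⟩ := hx
  have hx0 : 0 < x := by linarith
  set I : ℕ → ℝ≥0∞ := fun i => ∫⁻ ω in S i, ENNReal.ofReal (θ i ω ^ α) ∂P with hI
  set g := ENNReal.ofReal (G x) with hg
  have hIw : ∀ i, I i ≤ w i := fun i =>
    (lintegral_rpow_le_lintegral_add (D.discount_pos i) hk₁ hk₂).trans (setLIntegral_le_lintegral _ _)
  set A : ℕ → Set Ω := fun i => S i ∩ {ω | x < θ i ω * Y i ω} with hA
  have hAm : ∀ i, MeasurableSet (A i) := fun i =>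
    (D.le _ (hS i)).inter (D.measurableSet_gt i x)
  have b1 : ∑ i ∈ Finset.range n, g * I i ≤ ∑ i ∈ Finset.range n, P (A i) + g * (ε / 3) := by
    calc ∑ i ∈ Finset.range n, g * I i
        ≤ ∑ i ∈ Finset.range n, (P (A i) + g * (ENNReal.ofReal η * w i)) := by
          refine Finset.sum_le_sum fun i _ => ?_
          rw [hA, D.tail i _ _ hx0 (hS i)]
          refine (hxb _ hx1 _ _ (D.measurable_discount' i) (D.discount_pos i)).2.trans ?_
          gcongr
          exact setLIntegral_le_lintegral _ _
      _ = ∑ i ∈ Finset.range n, P (A i) + g * (ENNReal.ofReal η * ∑ i ∈ Finset.range n, w i) := by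
          rw [Finset.sum_add_distrib, Finset.mul_sum, Finset.mul_sum]
      _ ≤ _ := by
          gcongr
          refine le_trans ?_ hη
          gcongr
          exact ENNReal.sum_le_tsum _
  have b2 : ∑ i ∈ Finset.range n, P (A i) ≤ P (⋃ i, A i) + g * (ε / 3) := by
    refine (sum_measure_le_measure_biUnion_add hAm n).trans ?_
    refine add_le_add (measure_mono (iUnion₂_subset fun i _ => subset_iUnion A i)) ?_
    calc ∑ i ∈ Finset.range n, ∑ j ∈ Finset.range i, P (A i ∩ A j)
        ≤ ∑ i ∈ Finset.range n, ∑ j ∈ Finset.range i, ε' * g := by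
          refine Finset.sum_le_sum fun i hi => Finset.sum_le_sum fun j hj => ?_
          have hi' := Finset.mem_range.1 hi
          have hj' := Finset.mem_range.1 hj
          have h1 := hxd x hx2 i hi j (Finset.mem_range.2 (by omega)) (by omega)
          simp only [one_mul] at h1
          exact le_trans (measure_mono (inter_subset_inter inter_subset_right inter_subset_right)) h1
      _ ≤ ∑ i ∈ Finset.range n, ∑ j ∈ Finset.range n, ε' * g := by
          refine Finset.sum_le_sum fun i hi => Finset.sum_le_sum_of_subset ?_
          exact Finset.range_mono (Finset.mem_range.1 hi).le
      _ = ((n * n : ℕ) * ε') * g := by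
          simp only [Finset.sum_const, Finset.card_range, nsmul_eq_mul]
          push_cast; ring
      _ ≤ g * (ε / 3) := by rw [mul_comm]; gcongr
  have b3 : ∑' i, I (i + n) ≤ ε / 3 :=
    (ENNReal.tsum_le_tsum fun i => hIw _).trans (hn n le_rfl)
  calc g * ∑' i, I i = ∑ i ∈ Finset.range n, g * I i + g * ∑' i, I (i + n) := by
        rw [← ENNReal.summable.sum_add_tsum_nat_add' (f := I) (k := n), mul_add, Finset.mul_sum]
    _ ≤ ((P (⋃ i, A i) + g * (ε / 3)) + g * (ε / 3)) + g * (ε / 3) := by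
        gcongr
        exact b1.trans (by gcongr)
    _ = P (⋃ i, A i) + g * (ε / 3 + ε / 3 + ε / 3) := by ring
    _ = _ := by rw [ENNReal.add_thirds]

end IsDiscountedModel

end CoreBounds

/-! ### Events of small probability, with a relative error -/

section SmallTimes

variable {Ω : Type*} {m : MeasurableSpace Ω} [mΩ : MeasurableSpace Ω] {P : Measure Ω}
  {G : ℝ → ℝ} {α : ℝ} {θ Y : ℕ → Ω → ℝ}

/-- The exponent `max i 1 + 1` ensures a factor `q ^ 2` already at `i = 0`; the other powers of `q`
offset the growth of `r ^ (i + 1)` and leave a geometric series. -/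
lemma ENNReal.pow_succ_mul_pow_max_le {r q : ℝ≥0∞} (hr : 1 ≤ r) (hrq : r * q ≤ 2⁻¹) (i : ℕ) :
    r ^ (i + 1) * q ^ (max i 1 + 1) ≤ 2 * r ^ 2 * q * 2⁻¹ ^ i * q := by
  rcases Nat.eq_zero_or_pos i with rfl | hi
  · simp only [zero_add, pow_one, zero_le, sup_of_le_right, pow_zero, mul_one]
    calc r * q ^ (1 + 1) = (1 * (1 * r)) * (q * q) := by ring
      _ ≤ (2 * (r * r)) * (q * q) := by gcongr; norm_num
      _ = _ := by ring
  · obtain ⟨n, rfl⟩ := Nat.exists_eq_succ_of_ne_zero hi.ne'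
    have h2 : (2 : ℝ≥0∞) * 2⁻¹ = 1 := ENNReal.mul_inv_cancel (by simp) (by simp)
    rw [max_eq_left (by omega)]
    calc r ^ (n + 1 + 1) * q ^ (n + 1 + 1) = (r ^ 2 * q) * (r * q) ^ n * q := by
          rw [mul_pow]; ring
      _ ≤ (r ^ 2 * q) * 2⁻¹ ^ n * q := by gcongr
      _ = (2 * 2⁻¹) * (r ^ 2 * q) * 2⁻¹ ^ n * q := by rw [h2, one_mul]
      _ = _ := by rw [Nat.succ_eq_add_one, pow_succ]; ring

/-- A sum exceeds `x` only if its `i`-th term exceeds `x / 2 ^ (i + 1)` for some `i`. -/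
lemma exists_lt_of_lt_tsum {b : ℕ → ℝ} {x : ℝ} (hx : 0 < x)
    (h : ENNReal.ofReal x < ∑' i, ENNReal.ofReal (b i)) : ∃ i, x / 2 ^ (i + 1) < b i := by
  by_contra! hcon
  refine absurd h (not_lt.2 ?_)
  calc ∑' i, ENNReal.ofReal (b i) ≤ ∑' i, ENNReal.ofReal (x / 2 / 2 ^ i) := by
        refine ENNReal.tsum_le_tsum fun i => ENNReal.ofReal_le_ofReal ((hcon i).trans ?_)
        rw [pow_succ', div_div]
    _ = ENNReal.ofReal (∑' i : ℕ, x / 2 / 2 ^ i) :=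
        (ENNReal.ofReal_tsum_of_nonneg (fun i => by positivity) (summable_geometric_two' x)).symm
    _ = ENNReal.ofReal x := by rw [tsum_geometric_two']

namespace IsDiscountedModel

/-- The bounds for events of small probability, with an error relative to that probability. -/
theorem bounds_of_small [IsProbabilityMeasure P] (D : IsDiscountedModel m P G θ Y)
    (h : IsRegVarTail G α) {k₁ k₂ : ℝ} (hk₁0 : 0 < k₁) (hk₁ : k₁ < α) (hk₂ : α < k₂)
    {K : ℝ≥0∞} (hK : K ≠ ⊤) {ε : ℝ≥0∞} (hε : ε ≠ 0) :
    ∃ q₀ : ℝ≥0∞, q₀ ≠ 0 ∧ ∃ x₁ : ℝ, ∀ x, x₁ ≤ x → ∀ S : ℕ → Set Ω,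
      (∀ i, MeasurableSet[m] (S i)) → Antitone S → (∀ i, P (S i) ≤ P (S 0) ^ (i + 1)) →
      (∀ i j, i ≤ j → ∫⁻ ω in S j, ENNReal.ofReal (θ i ω ^ k₁ + θ i ω ^ k₂) ∂P ≤ K * P (S j)) →
      P (S 0) ≤ q₀ →
      P {ω | ENNReal.ofReal x <
          ∑' i, ENNReal.ofReal ((S i).indicator (fun ω => θ i ω * Y i ω) ω)} ≤
        ENNReal.ofReal (G x) *
          (∑' i, ∫⁻ ω in S i, ENNReal.ofReal (θ i ω ^ α) ∂P + ε * P (S 0)) ∧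
      ENNReal.ofReal (G x) * ∑' i, ∫⁻ ω in S i, ENNReal.ofReal (θ i ω ^ α) ∂P ≤
        P (⋃ i, S i ∩ {ω | x < θ i ω * Y i ω}) + ENNReal.ofReal (G x) * (ε * P (S 0)) := by
  have hk₂0 : 0 < k₂ := hk₁0.trans (hk₁.trans hk₂)
  have hε2 : ε / 2 ≠ 0 := by simpa using hε
  obtain ⟨C, x₀, hC, hx₀, HC⟩ := h.lintegral_le (Ω := Ω) hk₁0 hk₁ hk₂
  obtain ⟨η, hη0, -, hη⟩ := ENNReal.exists_ofReal_mul_le hK hε2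
  obtain ⟨xb, hxb0, hxb⟩ := h.lintegral_uniform (Ω := Ω) hk₁0 hk₁ hk₂ hη0
  set r : ℝ≥0∞ := ENNReal.ofReal (2 ^ k₂) with hr
  have hr1 : 1 ≤ r := by
    rw [hr, ← ENNReal.ofReal_one]
    exact ENNReal.ofReal_le_ofReal (Real.one_le_rpow one_le_two hk₂0.le)
  have hrtop : r ≠ ⊤ := ENNReal.ofReal_ne_top
  -- The two summands are the coefficients of `q ^ 2` in the upper bound and in the lower bound.
  obtain ⟨a, ha0, -, ha⟩ := ENNReal.exists_ofReal_mul_le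
    (W := ENNReal.ofReal C * K * (4 * r ^ 2) + 2 * K) (by finiteness) hε2
  obtain ⟨b, hb0, -, hb⟩ := ENNReal.exists_ofReal_mul_le hrtop (ε := 2⁻¹) (by simp)
  refine ⟨min (ENNReal.ofReal a) (ENNReal.ofReal b),
    (lt_min (by simpa using ha0) (by simpa using hb0)).ne', max (max x₀ xb) 1,
    fun x hx S hS hanti hSpow hSK hq => ?_⟩
  simp only [max_le_iff] at hx
  obtain ⟨⟨hx1, hx2⟩, hx3⟩ := hx
  have hx0 : 0 < x := by linarith
  set I : ℕ → ℝ≥0∞ := fun i => ∫⁻ ω in S i, ENNReal.ofReal (θ i ω ^ α) ∂P with hI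
  set g := ENNReal.ofReal (G x) with hg
  set q := P (S 0) with hqdef
  have hqa : q ≤ ENNReal.ofReal a := hq.trans (min_le_left _ _)
  have hrq : r * q ≤ 2⁻¹ := by
    rw [mul_comm]
    exact le_trans (by gcongr; exact hq.trans (min_le_right _ _)) hb
  have hq2 : q ≤ 2⁻¹ := le_trans (le_mul_of_one_le_left zero_le hr1) hrq
  have hqW : (ENNReal.ofReal C * K * (4 * r ^ 2) + 2 * K) * q ≤ ε / 2 := by
    rw [mul_comm]
    exact le_trans (by gcongr) ha
  have hηK : ENNReal.ofReal η * (K * q) ≤ ε / 2 * q := by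
    rw [← mul_assoc]; gcongr
  have hgeo : ∑' i : ℕ, (2⁻¹ : ℝ≥0∞) ^ i = 2 := by
    rw [ENNReal.tsum_geometric, ENNReal.one_sub_inv_two, inv_inv]
  have main := hxb x hx2 (P.restrict (S 0)) (θ 0) (D.measurable_discount' 0) (D.discount_pos 0)
  rw [← D.tail 0 x _ hx0 (hS 0)] at main
  constructor
  -- Outside `S 1` only the first term is present. Inside it, some term exceeds its share `x / 2 ^
  -- (i + 1)`, and intersecting with `S 1` as well costs the term `i = 0` a second factor `q`.
  · have hsub : {ω | ENNReal.ofReal x <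
        ∑' i, ENNReal.ofReal ((S i).indicator (fun ω => θ i ω * Y i ω) ω)} ⊆
        (S 0 ∩ {ω | x < θ 0 ω * Y 0 ω}) ∪
          ⋃ i, S (max i 1) ∩ {ω | x / 2 ^ (i + 1) < θ i ω * Y i ω} := by
      intro ω hω
      by_cases h1 : ω ∈ S 1
      · right
        obtain ⟨i, hi⟩ := exists_lt_of_lt_tsum hx0 hω
        have hiS : ω ∈ S i := by
          by_contra hiS
          rw [indicator_of_notMem hiS] at hi
          have : 0 < x / 2 ^ (i + 1) := by positivity
          linarith
        rw [indicator_of_mem hiS] at hi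
        refine mem_iUnion.2 ⟨i, ?_, hi⟩
        rcases max_choice i 1 with h2 | h2 <;> rw [h2]
        · exact hiS
        · exact h1
      · left
        have hzero : ∀ i, i ≠ 0 →
            ENNReal.ofReal ((S i).indicator (fun ω => θ i ω * Y i ω) ω) = 0 := by
          intro i hi
          rw [indicator_of_notMem fun h2 => h1 (hanti (Nat.one_le_iff_ne_zero.2 hi) h2),
            ENNReal.ofReal_zero]
        have hω' : ENNReal.ofReal x <
          ∑' i, ENNReal.ofReal ((S i).indicator (fun ω => θ i ω * Y i ω) ω) := hω
        rw [tsum_eq_single 0 hzero, ENNReal.ofReal_lt_ofReal_iff_of_nonneg hx0.le] at hω'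
        have hiS : ω ∈ S 0 := by
          by_contra hiS
          rw [indicator_of_notMem hiS] at hω'
          linarith
        rw [indicator_of_mem hiS] at hω'
        exact ⟨hiS, hω'⟩
    have hterm : ∀ i, P (S (max i 1) ∩ {ω | x / 2 ^ (i + 1) < θ i ω * Y i ω}) ≤
        ENNReal.ofReal C * g * K * (2 * r ^ 2 * q * 2⁻¹ ^ i * q) := by
      intro i
      set u : ℝ := 2 ^ (i + 1) with hu
      have hu0 : 0 < u := by positivity
      have hu1 : 1 ≤ u := one_le_pow₀ one_le_two
      have hur : ENNReal.ofReal (u ^ k₂) = r ^ (i + 1) := by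
        rw [hr, ← ENNReal.ofReal_pow (by positivity), hu, ← Real.rpow_natCast,
          ← Real.rpow_natCast, ← Real.rpow_mul two_pos.le, ← Real.rpow_mul two_pos.le, mul_comm]
      rw [D.tail i _ _ (by positivity) (hS _)]
      simp only [div_div]
      calc _ ≤ ENNReal.ofReal C * g * ∫⁻ ω in S (max i 1),
            ENNReal.ofReal ((u * θ i ω) ^ k₁ + (u * θ i ω) ^ k₂) ∂P :=
            HC x hx1 _ (fun ω => u * θ i ω) fun ω => mul_pos hu0 (D.discount_pos i ω)
        _ ≤ ENNReal.ofReal C * g * (ENNReal.ofReal (u ^ k₂) * ∫⁻ ω in S (max i 1),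
            ENNReal.ofReal (θ i ω ^ k₁ + θ i ω ^ k₂) ∂P) := by
            gcongr
            rw [← lintegral_const_mul' _ _ ENNReal.ofReal_ne_top]
            refine lintegral_mono fun ω => ?_
            rw [← ENNReal.ofReal_mul (by positivity)]
            refine ENNReal.ofReal_le_ofReal ?_
            have h0 := D.discount_pos i ω
            rw [Real.mul_rpow hu0.le h0.le, Real.mul_rpow hu0.le h0.le, mul_add]
            have : u ^ k₁ ≤ u ^ k₂ := Real.rpow_le_rpow_of_exponent_le hu1 (by linarith)
            gcongr
        _ ≤ ENNReal.ofReal C * g * (r ^ (i + 1) * (K * q ^ (max i 1 + 1))) := by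
            rw [hur]
            gcongr
            exact (hSK i _ (le_max_left _ _)).trans (by gcongr; exact hSpow _)
        _ = ENNReal.ofReal C * g * K * (r ^ (i + 1) * q ^ (max i 1 + 1)) := by ring
        _ ≤ _ := by
            exact mul_le_mul_right (ENNReal.pow_succ_mul_pow_max_le hr1 hrq i) _
    calc _ ≤ _ := measure_mono hsub
      _ ≤ P (S 0 ∩ {ω | x < θ 0 ω * Y 0 ω}) +
            ∑' i, P (S (max i 1) ∩ {ω | x / 2 ^ (i + 1) < θ i ω * Y i ω}) :=
          (measure_union_le _ _).trans (by gcongr; exact measure_iUnion_le _)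
      _ ≤ g * (I 0 + ENNReal.ofReal η * (K * q)) +
            ∑' i, ENNReal.ofReal C * g * K * (2 * r ^ 2 * q * 2⁻¹ ^ i * q) := by
          refine add_le_add (main.1.trans ?_) (ENNReal.tsum_le_tsum hterm)
          gcongr
          exact hSK 0 0 le_rfl
      _ = g * (I 0 + ENNReal.ofReal η * (K * q)) +
            ENNReal.ofReal C * g * K * (2 * r ^ 2 * q * 2 * q) := by
          rw [ENNReal.tsum_mul_left, ENNReal.tsum_mul_right, ENNReal.tsum_mul_left, hgeo]
      _ = g * (I 0 + ENNReal.ofReal η * (K * q) +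
            (ENNReal.ofReal C * K * (4 * r ^ 2)) * q * q) := by ring
      _ ≤ g * (∑' i, I i + ε / 2 * q + ε / 2 * q) := by
          gcongr
          · exact ENNReal.le_tsum 0
          · exact le_trans (by gcongr; exact le_self_add) hqW
      _ = _ := by rw [add_assoc, ← add_mul, ENNReal.add_halves]
  · have hrest : ∑' i, I (i + 1) ≤ ε / 2 * q := by
      calc ∑' i, I (i + 1) ≤ ∑' i : ℕ, K * (q * q * 2⁻¹ ^ i) := by
            refine ENNReal.tsum_le_tsum fun i => ?_
            calc I (i + 1) ≤ K * P (S (i + 1)) :=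
                  (lintegral_rpow_le_lintegral_add (D.discount_pos _) hk₁ hk₂).trans
                    (hSK _ _ le_rfl)
              _ ≤ K * (q * q * q ^ i) := by
                  gcongr
                  exact (hSpow _).trans (le_of_eq (by ring))
              _ ≤ _ := by gcongr
        _ = (2 * K * q) * q := by
            rw [ENNReal.tsum_mul_left, ENNReal.tsum_mul_left, hgeo]; ring
        _ ≤ _ := by
            gcongr
            exact le_trans (by gcongr; exact le_add_self) hqW
    have hsplit : ∑' i, I i = I 0 + ∑' i, I (i + 1) := tsum_eq_zero_add' ENNReal.summable
    calc g * ∑' i, I i = g * I 0 + g * ∑' i, I (i + 1) := by rw [hsplit, mul_add]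
      _ ≤ (P (S 0 ∩ {ω | x < θ 0 ω * Y 0 ω}) + g * (ε / 2 * q)) + g * (ε / 2 * q) := by
          gcongr
          refine main.2.trans (add_le_add le_rfl (mul_le_mul_right (le_trans ?_ hηK) _))
          gcongr
          exact hSK 0 0 le_rfl
      _ ≤ (P (⋃ i, S i ∩ {ω | x < θ i ω * Y i ω}) + g * (ε / 2 * q)) + g * (ε / 2 * q) := by
          gcongr
          exact subset_iUnion (fun i => S i ∩ {ω | x < θ i ω * Y i ω}) 0
      _ = P (⋃ i, S i ∩ {ω | x < θ i ω * Y i ω}) + g * ((ε / 2 + ε / 2) * q) := by ring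
      _ = _ := by rw [ENNReal.add_halves]

end IsDiscountedModel

end SmallTimes

/-! ### Freezing an independent variable and joint measurability -/

section Independence

lemma IndepFun.lintegral_comp_prodMk {Ω E E' : Type*} [MeasurableSpace Ω] [MeasurableSpace E]
    [MeasurableSpace E'] {P : Measure Ω} [IsProbabilityMeasure P] {U : Ω → E} {V : Ω → E'}
    (hU : Measurable U) (hV : Measurable V) (hUV : IndepFun U V P) {f : E × E' → ℝ≥0∞}
    (hf : Measurable f) :
    ∫⁻ ω, f (U ω, V ω) ∂P = ∫⁻ ω, ∫⁻ ω', f (U ω', V ω) ∂P ∂P := by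
  have h1 := (indepFun_iff_map_prod_eq_prod_map_map hU.aemeasurable hV.aemeasurable).1 hUV
  have hPU : IsProbabilityMeasure (P.map U) := Measure.isProbabilityMeasure_map hU.aemeasurable
  have hPV : IsProbabilityMeasure (P.map V) := Measure.isProbabilityMeasure_map hV.aemeasurable
  rw [← lintegral_map hf (hU.prodMk hV), h1, lintegral_prod_symm' _ hf,
    lintegral_map hf.lintegral_prod_left' hV]
  refine lintegral_congr fun ω => ?_
  exact lintegral_map (hf.comp measurable_prodMk_right) hU

/-- Integration of a function of two independent arguments, the second one being the sample point
seen by a sub-σ-algebra. -/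
lemma Indep.lintegral_freeze {Ω E : Type*} {m : MeasurableSpace Ω} [mΩ : MeasurableSpace Ω]
    [mE : MeasurableSpace E] {P : Measure Ω} [IsProbabilityMeasure P] (hm : m ≤ mΩ) {U : Ω → E}
    (hU : Measurable U) (hind : Indep (MeasurableSpace.comap U mE) m P) {f : E × Ω → ℝ≥0∞}
    (hf : Measurable[mE.prod m] f) :
    ∫⁻ ω, f (U ω, ω) ∂P = ∫⁻ ω, ∫⁻ ω', f (U ω', ω) ∂P ∂P := by
  -- The second variable is the identity from `(Ω, mΩ)` to `(Ω, m)`, whose generated σ-algebra is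
  -- `m`.
  refine @IndepFun.lintegral_comp_prodMk Ω E Ω mΩ mE m P _ U id hU
    (fun s hs => hm s hs) ?_ f hf
  change Indep (MeasurableSpace.comap U mE) (MeasurableSpace.comap id m) P
  rwa [MeasurableSpace.comap_id]

lemma measurable_comp_nat {Ω : Type*} [MeasurableSpace Ω] {ξ : ℝ≥0 → Ω → ℝ}
    (hm : ∀ t, Measurable (ξ t)) {g : ℕ → ℝ≥0} {N : ℝ≥0 × Ω → ℕ} (hN : Measurable N) :
    Measurable fun p : ℝ≥0 × Ω => ξ (g (N p)) p.2 := by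
  have h1 : Measurable fun q : ℕ × Ω => ξ (g q.1) q.2 :=
    measurable_from_prod_countable_right fun k => hm (g k)
  exact h1.comp (hN.prodMk measurable_snd)

/-- Evaluation at the next grid point to the right takes countably many times, hence is jointly
measurable; right-continuity passes to the limit. The σ-algebra on `Ω` is arbitrary, so the lemma
applies to the one generated by the process. -/
lemma measurable_uncurry_of_rightContinuous {Ω : Type*} [MeasurableSpace Ω] {ξ : ℝ≥0 → Ω → ℝ}
    (hm : ∀ t, Measurable (ξ t))
    (hrc : ∀ ω t, ContinuousWithinAt (fun s => ξ s ω) (Ici t) t) :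
    Measurable fun p : ℝ≥0 × Ω => ξ p.1 p.2 := by
  have happrox : ∀ n : ℕ, Measurable fun p : ℝ≥0 × Ω =>
      ξ (((⌊p.1 * (n + 1)⌋₊ : ℝ≥0) + 1) / (n + 1)) p.2 := by
    intro n
    exact measurable_comp_nat (g := fun k : ℕ => ((k : ℝ≥0) + 1) / (n + 1)) hm
      (Nat.measurable_floor.comp (measurable_fst.mul_const _))
  refine measurable_of_tendsto_metrizable happrox (tendsto_pi_nhds.2 fun p => ?_)
  obtain ⟨t, ω⟩ := p
  refine (hrc ω t).tendsto.comp (tendsto_nhdsWithin_iff.2 ⟨?_, Eventually.of_forall fun n => ?_⟩)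
  · have hup : ∀ n : ℕ, ((⌊t * (n + 1)⌋₊ : ℝ≥0) + 1) / (n + 1) ≤ t + 1 / (n + 1) := by
      intro n
      rw [add_div]
      gcongr
      rw [div_le_iff₀ (by positivity)]
      exact Nat.floor_le zero_le
    have hlo : ∀ n : ℕ, t ≤ ((⌊t * (n + 1)⌋₊ : ℝ≥0) + 1) / (n + 1) := by
      intro n
      rw [le_div_iff₀ (by positivity)]
      exact (Nat.lt_floor_add_one _).le
    have hlim : Tendsto (fun n : ℕ => t + 1 / ((n : ℝ≥0) + 1)) atTop (𝓝 t) := by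
      have h1 : Tendsto (fun n : ℕ => 1 / ((n : ℝ≥0) + 1)) atTop (𝓝 0) := by
        rw [← NNReal.tendsto_coe]
        simpa using tendsto_one_div_add_atTop_nhds_zero_nat (𝕜 := ℝ)
      simpa using h1.const_add t
    exact tendsto_of_tendsto_of_tendsto_of_le_of_le tendsto_const_nhds hlim hlo hup
  · change t ≤ _
    rw [le_div_iff₀ (by positivity)]
    exact (Nat.lt_floor_add_one _).le

lemma measurable_exp_neg_process {Ω : Type*} [MeasurableSpace Ω] {ξ : ℝ≥0 → Ω → ℝ}
    (hξ : Measurable fun p : ℝ≥0 × Ω => ξ p.1 p.2) {S : Ω → ℝ≥0} (hS : Measurable S) :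
    Measurable fun ω => Real.exp (-ξ (S ω) ω) :=
  Real.measurable_exp.comp (hξ.comp (hS.prodMk measurable_id)).neg

lemma measurableSet_gt_mul {Ω E : Type*} [MeasurableSpace Ω] [MeasurableSpace E] {S : Set Ω}
    (hS : MeasurableSet S) {θ : Ω → ℝ} (hθ : Measurable θ) {φ : E → ℝ} (hφ : Measurable φ)
    (x : ℝ) : MeasurableSet {p : E × Ω | p.2 ∈ S ∧ x < θ p.2 * φ p.1} :=
  (measurable_snd hS).inter (measurableSet_lt measurable_const
    ((hθ.comp measurable_snd).mul (hφ.comp measurable_fst)))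

lemma measurable_indicator_mul_exp {Ω : Type*} [MeasurableSpace Ω] {ξ : ℝ≥0 → Ω → ℝ}
    (hξ : Measurable fun p : ℝ≥0 × Ω => ξ p.1 p.2) {B : Set (ℕ → ℝ≥0)} (hB : MeasurableSet B)
    (k : ℝ) (i : ℕ) :
    Measurable fun p : (ℕ → ℝ≥0) × Ω =>
      B.indicator (fun _ => (1 : ℝ≥0∞)) p.1 *
        ENNReal.ofReal (Real.exp (-k * ξ (p.1 i) p.2)) := by
  refine Measurable.mul ((measurable_const.indicator hB).comp measurable_fst) ?_
  refine ENNReal.measurable_ofReal.comp (Real.measurable_exp.comp (Measurable.const_mul ?_ _))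
  have h1 : Measurable fun p : (ℕ → ℝ≥0) × Ω => (p.1 i, p.2) :=
    ((measurable_pi_apply i).comp measurable_fst).prodMk measurable_snd
  exact hξ.comp h1

end Independence

/-! ### Discount factors at the arrival times -/

section Discount

variable {Ω : Type*} {T : ℕ → Ω → ℝ≥0} {ξ : ℝ≥0 → Ω → ℝ}

/-- The σ-algebra generated by the arrival times and the return process. -/
@[reducible]
def discountSigma (T : ℕ → Ω → ℝ≥0) (ξ : ℝ≥0 → Ω → ℝ) : MeasurableSpace Ω :=
  MeasurableSpace.comap (fun ω i => T i ω) inferInstance ⊔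
    MeasurableSpace.comap (fun ω t => ξ t ω) inferInstance

/-- The discount factor at the `i`-th arrival time. -/
def discountFactor (T : ℕ → Ω → ℝ≥0) (ξ : ℝ≥0 → Ω → ℝ) (i : ℕ) (ω : Ω) : ℝ :=
  Real.exp (-ξ (T i ω) ω)

lemma discountFactor_pos (i : ℕ) (ω : Ω) : 0 < discountFactor T ξ i ω := Real.exp_pos _

lemma measurable_arrival_discountSigma (i : ℕ) : Measurable[discountSigma T ξ] (T i) := by
  have h1 : Measurable[MeasurableSpace.comap (fun ω i => T i ω) inferInstance] (T i) :=
    (measurable_pi_apply i).comp (comap_measurable (fun ω i => T i ω))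
  exact h1.mono le_sup_left le_rfl

variable [mΩ : MeasurableSpace Ω] {P : Measure Ω} {d : ℕ} {X : ℕ → Ω → Fin d → ℝ}

lemma exp_neg_rpow (y k : ℝ) : Real.exp (-y) ^ k = Real.exp (-k * y) := by
  rw [← Real.exp_mul]; congr 1; ring

lemma posMoment_discountFactor (k : ℝ) (i : ℕ) :
    posMoment P (discountFactor T ξ i) k = discountMoment P ξ k (T i) := by
  simp only [posMoment, discountFactor, discountMoment, exp_neg_rpow]

lemma comap_process_le (hξ : IsCadlagProcess ξ) :
    MeasurableSpace.comap (fun ω t => ξ t ω) inferInstance ≤ mΩ :=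
  (measurable_pi_iff.2 fun t => hξ.measurable t).comap_le

lemma discountSigma_le (hT : ∀ i, Measurable (T i)) (hξ : IsCadlagProcess ξ) :
    discountSigma T ξ ≤ mΩ :=
  sup_le (measurable_pi_iff.2 hT).comap_le (comap_process_le hξ)

lemma measurable_process_comap (hξ : IsCadlagProcess ξ) :
    Measurable[(inferInstance : MeasurableSpace ℝ≥0).prod
      (MeasurableSpace.comap (fun ω t => ξ t ω) inferInstance)]
      fun p : ℝ≥0 × Ω => ξ p.1 p.2 :=
  @measurable_uncurry_of_rightContinuous Ω
    (MeasurableSpace.comap (fun ω t => ξ t ω) inferInstance) ξ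
    (fun t => (measurable_pi_apply t).comp (comap_measurable (fun ω t => ξ t ω)))
    hξ.right_continuous

lemma measurable_process_discountSigma (hξ : IsCadlagProcess ξ) :
    Measurable[(inferInstance : MeasurableSpace ℝ≥0).prod (discountSigma T ξ)]
      fun p : ℝ≥0 × Ω => ξ p.1 p.2 :=
  @measurable_uncurry_of_rightContinuous Ω (discountSigma T ξ) ξ
    (fun t => Measurable.mono ((measurable_pi_apply t).comp (comap_measurable (fun ω t => ξ t ω)))
      le_sup_right le_rfl)
    hξ.right_continuous

lemma measurable_discountFactor (hξ : IsCadlagProcess ξ) (i : ℕ) :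
    Measurable[discountSigma T ξ] (discountFactor T ξ i) :=
  @measurable_exp_neg_process Ω (discountSigma T ξ) ξ (measurable_process_discountSigma hξ) (T i)
    (measurable_arrival_discountSigma i)

lemma IndepIngredients.indep_claims (h : IndepIngredients P X T ξ) (hX : ∀ i, Measurable (X i))
    (hT : ∀ i, Measurable (T i)) (hξ : IsCadlagProcess ξ) :
    Indep (MeasurableSpace.comap (fun ω i => X i ω) inferInstance) (discountSigma T ξ) P := by
  have hle : ∀ j : Fin 3, ![MeasurableSpace.comap (fun ω i => X i ω) inferInstance,
    MeasurableSpace.comap (fun ω i => T i ω) inferInstance,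
    MeasurableSpace.comap (fun ω t => ξ t ω) inferInstance] j ≤ mΩ := by
    intro j
    fin_cases j
    · exact (measurable_pi_iff.2 hX).comap_le
    · exact (measurable_pi_iff.2 hT).comap_le
    · exact comap_process_le hξ
  have := indep_iSup_of_disjoint hle h (S := {0}) (T := {1, 2}) (by simp)
  simpa [iSup_insert, discountSigma] using this

lemma IndepIngredients.indep_times (h : IndepIngredients P X T ξ) :
    Indep (MeasurableSpace.comap (fun ω i => T i ω) inferInstance)
      (MeasurableSpace.comap (fun ω t => ξ t ω) inferInstance) P :=
  iIndep.indep h (i := 1) (j := 2) (by decide)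

/-- The discounted claims, measured by a function `φ` of the claim vector. -/
lemma isDiscountedModel [IsProbabilityMeasure P] (hX : ∀ i, Measurable (X i))
    (hT : ∀ i, Measurable (T i)) (hξ : IsCadlagProcess ξ) (hind : IndepIngredients P X T ξ)
    {F : Measure (Fin d → ℝ)} (hF : ∀ i, P.map (X i) = F) {φ : (Fin d → ℝ) → ℝ}
    (hφ : Measurable φ) (hφ0 : ∀ v, 0 ≤ φ v) :
    IsDiscountedModel (discountSigma T ξ) P (fun x => F.real {v | x < φ v})
      (discountFactor T ξ) (fun i ω => φ (X i ω)) := by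
  have htail : ∀ i x, P {ω | x < φ (X i ω)} = ENNReal.ofReal (F.real {v | x < φ v}) := by
    intro i x
    have hFp : IsProbabilityMeasure F := hF i ▸ Measure.isProbabilityMeasure_map (hX i).aemeasurable
    rw [ofReal_measureReal, ← hF i,
      Measure.map_apply (hX i) (measurableSet_lt measurable_const hφ)]
    rfl
  refine ⟨discountSigma_le hT hξ, measurable_discountFactor hξ, discountFactor_pos,
    fun i => hφ.comp (hX i), fun i ω => hφ0 _, htail, fun i x S hx hS => ?_⟩
  have hle := discountSigma_le hT hξ
  have hindX : Indep (MeasurableSpace.comap (X i) inferInstance) (discountSigma T ξ) P := by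
    refine indep_of_indep_of_le_left (hind.indep_claims hX hT hξ) ?_
    have h1 : Measurable[MeasurableSpace.comap (fun ω i => X i ω) inferInstance] (X i) :=
      (measurable_pi_apply i).comp (comap_measurable (fun ω i => X i ω))
    exact h1.comap_le
  set B : Set ((Fin d → ℝ) × Ω) :=
    {p | p.2 ∈ S ∧ x < discountFactor T ξ i p.2 * φ p.1} with hB
  have hBm : MeasurableSet[(inferInstance : MeasurableSpace (Fin d → ℝ)).prod
      (discountSigma T ξ)] B :=
    @measurableSet_gt_mul Ω (Fin d → ℝ) (discountSigma T ξ) _ S hS (discountFactor T ξ i)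
      (measurable_discountFactor hξ i) φ hφ x
  have hfm : Measurable[(inferInstance : MeasurableSpace (Fin d → ℝ)).prod
      (discountSigma T ξ)] (B.indicator (fun _ => (1 : ℝ≥0∞))) :=
    Measurable.indicator measurable_const hBm
  have hfreeze := Indep.lintegral_freeze hle (hX i) hindX hfm
  have hSm : MeasurableSet S := hle _ hS
  have hθm : Measurable (discountFactor T ξ i) := (measurable_discountFactor hξ i).mono hle le_rfl
  have hAm : MeasurableSet (S ∩ {ω | x < discountFactor T ξ i ω * φ (X i ω)}) :=
    hSm.inter (measurableSet_lt measurable_const (hθm.mul (hφ.comp (hX i))))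
  have h1 : ∫⁻ ω, B.indicator (fun _ => (1 : ℝ≥0∞)) (X i ω, ω) ∂P =
      P (S ∩ {ω | x < discountFactor T ξ i ω * φ (X i ω)}) := by
    rw [← lintegral_indicator_one hAm]
    rfl
  -- With the discount factor frozen, the inner integral is the tail of the claim at `x / θ`.
  rw [← h1, hfreeze, ← lintegral_indicator hSm]
  refine lintegral_congr fun ω => ?_
  by_cases hω : ω ∈ S
  · rw [indicator_of_mem hω, ← htail i,
      ← lintegral_indicator_one (s := {ω' | x / discountFactor T ξ i ω < φ (X i ω')})
        (measurableSet_lt measurable_const (hφ.comp (hX i)))]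
    refine lintegral_congr fun ω' => ?_
    by_cases hx' : x < discountFactor T ξ i ω * φ (X i ω')
    · rw [indicator_of_mem (show (X i ω', ω) ∈ B from ⟨hω, hx'⟩), indicator_of_mem]
      · rfl
      · exact (div_lt_iff₀' (discountFactor_pos i ω)).2 hx'
    · rw [indicator_of_notMem (show (X i ω', ω) ∉ B from fun h => hx' h.2), indicator_of_notMem]
      exact fun h => hx' ((div_lt_iff₀' (discountFactor_pos i ω)).1 h)
  · rw [indicator_of_notMem hω]
    simp [hB, hω]

/-- Conditioning on the arrival times. -/
lemma setLIntegral_discountFactor [IsProbabilityMeasure P]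
    (hT : ∀ i, Measurable (T i)) (hξ : IsCadlagProcess ξ) (hind : IndepIngredients P X T ξ)
    {B : Set (ℕ → ℝ≥0)} (hB : MeasurableSet B) (k : ℝ) (i : ℕ) :
    ∫⁻ ω in {ω | (fun j => T j ω) ∈ B}, ENNReal.ofReal (discountFactor T ξ i ω ^ k) ∂P =
      ∫⁻ ω in {ω | (fun j => T j ω) ∈ B}, discountMoment P ξ k (fun _ => T i ω) ∂P := by
  have hTm : Measurable fun ω j => T j ω := measurable_pi_iff.2 hT
  set f : (ℕ → ℝ≥0) × Ω → ℝ≥0∞ := fun p =>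
    B.indicator (fun _ => 1) p.1 * ENNReal.ofReal (Real.exp (-k * ξ (p.1 i) p.2)) with hf
  have hfm : Measurable[(inferInstance : MeasurableSpace (ℕ → ℝ≥0)).prod
      (MeasurableSpace.comap (fun ω t => ξ t ω) inferInstance)] f :=
    @measurable_indicator_mul_exp Ω (MeasurableSpace.comap (fun ω t => ξ t ω) inferInstance) ξ
      (measurable_process_comap hξ) B hB k i
  have hfreeze := Indep.lintegral_freeze (comap_process_le hξ) hTm hind.indep_times hfm
  have hBm : MeasurableSet {ω | (fun j => T j ω) ∈ B} := hTm hB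
  have hfm' : Measurable f := measurable_indicator_mul_exp
    (measurable_uncurry_of_rightContinuous hξ.measurable hξ.right_continuous) hB k i
  -- Freezing leaves the process as the outer variable; Tonelli moves the arrival times outside.
  have hswap : ∫⁻ ω, ∫⁻ ω', f ((fun j => T j ω'), ω) ∂P ∂P =
      ∫⁻ ω', ∫⁻ ω, f ((fun j => T j ω'), ω) ∂P ∂P := by
    refine lintegral_lintegral_swap (f := fun ω ω' => f ((fun j => T j ω'), ω)) ?_
    exact (hfm'.comp ((hTm.comp measurable_snd).prodMk measurable_fst)).aemeasurable
  rw [hswap] at hfreeze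
  rw [← lintegral_indicator hBm, ← lintegral_indicator hBm]
  refine Eq.trans (lintegral_congr fun ω => ?_) (hfreeze.trans (lintegral_congr fun ω => ?_))
  · by_cases hω : (fun j => T j ω) ∈ B
    · simp [hf, hω, discountFactor, exp_neg_rpow]
    · simp [hf, hω]
  · by_cases hω : (fun j => T j ω) ∈ B
    · simp [hf, hω, discountMoment]
    · simp [hf, hω]

lemma measurable_discountMoment [IsProbabilityMeasure P] (hξ : IsCadlagProcess ξ) (k : ℝ) :
    Measurable fun s : ℝ≥0 => discountMoment P ξ k (fun _ => s) := by
  have h1 : Measurable fun p : ℝ≥0 × Ω => ENNReal.ofReal (Real.exp (-k * ξ p.1 p.2)) :=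
    ENNReal.measurable_ofReal.comp (Real.measurable_exp.comp (Measurable.const_mul
      (measurable_uncurry_of_rightContinuous hξ.measurable hξ.right_continuous) _))
  exact h1.lintegral_prod_right'

/-- The renewal measure is the sum of the laws of the `T i`, and conditioning on `T i` turns the
moment at a fixed time into the moment of the discount factor. -/
lemma discountIntegral_eq [IsProbabilityMeasure P]
    (hT : ∀ i, Measurable (T i)) (hξ : IsCadlagProcess ξ) (hind : IndepIngredients P X T ξ)
    (α : ℝ) (t : ℝ≥0∞) :
    discountIntegral P T ξ α t = ∑' i, ∫⁻ ω in {ω | (T i ω : ℝ≥0∞) ≤ t},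
      ENNReal.ofReal (discountFactor T ξ i ω ^ α) ∂P := by
  have hS : MeasurableSet {s : ℝ≥0 | (s : ℝ≥0∞) ≤ t} :=
    measurableSet_le measurable_coe_nnreal_ennreal measurable_const
  rw [discountIntegral, renewalMeasure, Measure.restrict_sum _ hS, lintegral_sum_measure]
  congr with i
  have h1 := setLIntegral_discountFactor hT hξ hind
    (B := {τ | (τ i : ℝ≥0∞) ≤ t}) ((measurable_pi_apply i : Measurable fun τ : ℕ → ℝ≥0 => τ i) hS) α i
  refine Eq.trans ?_ h1.symm
  rw [setLIntegral_map hS (measurable_discountMoment hξ α) (hT i)]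
  rfl

end Discount

/-! ### The gauge of the complement of a rare set -/

section RareSets

variable {d : ℕ} {A : Set (Fin d → ℝ)}

namespace IsRareSet

lemma compl_mem_nhds (hA : IsRareSet A) : Aᶜ ∈ 𝓝 (0 : Fin d → ℝ) := by
  have h1 : (closure A)ᶜ ∈ 𝓝 (0 : Fin d → ℝ) :=
    isClosed_closure.isOpen_compl.mem_nhds hA.zero_notMem_closure
  exact mem_of_superset h1 (compl_subset_compl.2 subset_closure)

lemma continuous_gauge (hA : IsRareSet A) : Continuous (gauge Aᶜ) :=
  _root_.continuous_gauge hA.convex_compl hA.compl_mem_nhds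

/-- As `A` is open, its complement is closed and is exactly the unit sublevel set of its gauge. -/
lemma one_lt_gauge_iff (hA : IsRareSet A) {v : Fin d → ℝ} : 1 < gauge Aᶜ v ↔ v ∈ A := by
  rw [← not_le, gauge_le_one_iff_mem_closure hA.convex_compl hA.compl_mem_nhds,
    hA.isOpen.isClosed_compl.closure_eq]
  simp

lemma mem_smul_iff (hA : IsRareSet A) {x : ℝ} (hx : 0 < x) {v : Fin d → ℝ} :
    v ∈ x • A ↔ x < gauge Aᶜ v := by
  rw [mem_smul_set_iff_inv_smul_mem₀ hx.ne', ← hA.one_lt_gauge_iff,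
    gauge_smul_of_nonneg (inv_nonneg.2 hx.le), smul_eq_mul, ← div_eq_inv_mul, one_lt_div hx]

lemma smul_eq (hA : IsRareSet A) {x : ℝ} (hx : 0 < x) : x • A = {v | x < gauge Aᶜ v} :=
  ext fun _ => hA.mem_smul_iff hx

lemma gauge_add_le (hA : IsRareSet A) (v w : Fin d → ℝ) :
    gauge Aᶜ (v + w) ≤ gauge Aᶜ v + gauge Aᶜ w :=
  _root_.gauge_add_le hA.convex_compl (absorbent_nhds_zero hA.compl_mem_nhds) v w

lemma gauge_sum_le (hA : IsRareSet A) {ι : Type*} (s : Finset ι) (v : ι → Fin d → ℝ) :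
    gauge Aᶜ (∑ i ∈ s, v i) ≤ ∑ i ∈ s, gauge Aᶜ (v i) :=
  Finset.le_sum_of_subadditive _ gauge_zero.le hA.gauge_add_le s v

lemma exists_gauge_le (hA : IsRareSet A) :
    ∃ R : ℝ, 0 < R ∧ ∀ v, gauge Aᶜ v ≤ R * ‖v‖ := by
  obtain ⟨r, hr, hball⟩ := Metric.mem_nhds_iff.1 hA.compl_mem_nhds
  refine ⟨r⁻¹, inv_pos.2 hr, fun v => ?_⟩
  have := mul_gauge_le_norm (x := v) hball
  rw [← div_eq_inv_mul, le_div_iff₀ hr]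
  linarith

lemma zero_notMem (hA : IsRareSet A) : (0 : Fin d → ℝ) ∉ A :=
  fun h => hA.zero_notMem_closure (subset_closure h)

/-- On the orthant, the level `Y_A` is the gauge of the complement. -/
lemma rareLevel_eq_gauge (hA : IsRareSet A) {v : Fin d → ℝ} (hv : 0 ≤ v) :
    rareLevel A v = gauge Aᶜ v := by
  -- A negative multiple of `v ≥ 0` in `A` could be shifted upwards to 0, which is not in `A`.
  have hneg : ∀ u : ℝ, u < 0 → v ∉ u • A := by
    intro u hu h
    rw [mem_smul_set_iff_inv_smul_mem₀ hu.ne] at h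
    refine hA.zero_notMem ?_
    have h1 := hA.increasing _ h ((-u⁻¹) • v)
      (smul_nonneg (neg_nonneg.2 (inv_nonpos.2 hu.le)) hv)
    simpa using h1
  have hle : ∀ u ∈ {u : ℝ | v ∈ u • A}, u ≤ gauge Aᶜ v := by
    intro u hu
    rcases lt_or_ge 0 u with h0 | h0
    · exact ((hA.mem_smul_iff h0).1 hu).le
    · exact h0.trans (gauge_nonneg v)
  unfold rareLevel
  -- For gauge 0 the set of levels is either empty, where `sSup` takes the default value 0, or
  -- `{0}`.
  rcases (gauge_nonneg (s := Aᶜ) v).eq_or_lt with h0 | h0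
  · rw [← h0] at hle ⊢
    refine le_antisymm (Real.sSup_nonpos hle) ?_
    rcases eq_empty_or_nonempty {u : ℝ | v ∈ u • A} with he | ⟨u, hu⟩
    · rw [he, Real.sSup_empty]
    · have hu0 : u = 0 := le_antisymm (hle u hu) (not_lt.1 fun h => hneg u h hu)
      exact le_csSup ⟨0, hle⟩ (hu0 ▸ hu)
  · refine le_antisymm (csSup_le ⟨gauge Aᶜ v / 2, ?_⟩ hle) (le_of_forall_lt fun c hc => ?_)
    · exact (hA.mem_smul_iff (half_pos h0)).2 (half_lt_self h0)
    · obtain ⟨u, hu, hu'⟩ := exists_between (max_lt hc h0)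
      refine lt_of_lt_of_le ((le_max_left _ _).trans_lt hu) (le_csSup ⟨_, hle⟩ ?_)
      exact (hA.mem_smul_iff ((le_max_right _ _).trans_lt hu)).2 hu'

end IsRareSet

end RareSets

/-! ### From multivariate regular variation to scalar tails -/

section RegularVariation

variable {d : ℕ} {F : Measure (Fin d → ℝ)} {α : ℝ} {V : Measure ℝ} {ν : Measure (Fin d → ℝ)}

namespace IsMRV

/-- Convergence of the tail of a positively homogeneous function at a continuity level. -/
lemma exists_level (hF : IsMRV F α V ν) {φ : (Fin d → ℝ) → ℝ} (hφ : Continuous φ)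
    (hφh : ∀ (c : ℝ) v, 0 ≤ c → φ (c • v) = c * φ v) {R : ℝ} (hR : 0 < R)
    (hφR : ∀ v, φ v ≤ R * ‖v‖) {a b : ℝ} (ha : 0 < a) (hab : a < b) :
    ∃ s, a < s ∧ s < b ∧ ν {v | s < φ v} ≠ ⊤ ∧
      Tendsto (fun x : ℝ => F {v | s * x < φ v} / V (Ioi x)) atTop (𝓝 (ν {v | s < φ v})) := by
  have hfin : ∀ s, 0 < s → ν {v | s ≤ φ v} < ⊤ := by
    intro s hs
    refine lt_of_le_of_lt (measure_mono fun v (hv : s ≤ φ v) => ?_) (hF.finite_away (s / R)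
      (by positivity))
    change s / R ≤ ‖v‖
    rw [div_le_iff₀ hR]
    linarith [hφR v]
  have hrest : IsFiniteMeasure (ν.restrict {v | a ≤ φ v}) :=
    ⟨by rw [Measure.restrict_apply_univ]; exact hfin a ha⟩
  -- A finite measure charges only countably many of the disjoint sets `{φ = s}`; any other `s`
  -- gives a continuity set.
  have hc := Measure.countable_meas_level_set_pos (μ := ν.restrict {v | a ≤ φ v}) hφ.measurable
  obtain ⟨s, hs, has, hsb⟩ := (hc.dense_compl ℝ).exists_between hab
  have hs0 : 0 < s := ha.trans has
  have hnull : ν {v | φ v = s} = 0 := by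
    simp only [mem_compl_iff, mem_ofPred_eq, not_lt, nonpos_iff_eq_zero] at hs
    rw [Measure.restrict_apply (measurableSet_eq_fun hφ.measurable measurable_const)] at hs
    refine measure_mono_null (fun v (hv : φ v = s) => ?_) hs
    exact ⟨hv, show a ≤ φ v from hv ▸ has.le⟩
  refine ⟨s, has, hsb, ((measure_mono fun v (hv : s < φ v) => hv.le).trans_lt (hfin s hs0)).ne, ?_⟩
  have hφ0 : φ 0 = 0 := by simpa using hφh 0 0 le_rfl
  have h1 := hF.tendsto {v | s < φ v} (measurableSet_lt measurable_const hφ.measurable)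
    (fun h => by
      have : (0 : Fin d → ℝ) ∈ {v | s ≤ φ v} :=
        closure_minimal (fun v (hv : s < φ v) => hv.le) (isClosed_le continuous_const hφ) h
      rw [mem_ofPred_eq, hφ0] at this
      linarith)
    (measure_mono_null (fun v hv => ((frontier_lt_subset_eq continuous_const hφ) hv).symm) hnull)
  refine h1.congr' ?_
  filter_upwards [eventually_gt_atTop 0] with x hx
  congr 2
  ext v
  rw [mem_smul_set_iff_inv_smul_mem₀ hx.ne']
  simp only [mem_ofPred_eq]
  rw [hφh _ _ (inv_nonneg.2 hx.le), ← div_eq_inv_mul, lt_div_iff₀ hx]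

lemma tail_ne_zero (hF : IsMRV F α V ν) (x : ℝ) : V (Ioi x) ≠ 0 := by
  have hVp := hF.isProbabilityMeasure
  have h1 := hF.regVar 1 one_pos
  simp only [one_mul, Real.one_rpow] at h1
  obtain ⟨y, hy, hxy⟩ := ((h1.eventually (lt_mem_nhds one_pos)).and (eventually_ge_atTop x)).exists
  intro h0
  have h2 : V (Ioi y) = 0 := measure_mono_null (Ioi_subset_Ioi hxy) h0
  simp [measureReal_def, h2] at hy

/-- The tail of a positively homogeneous function of the claim is regularly varying. -/
lemma isRegVarTail [IsProbabilityMeasure F] (hF : IsMRV F α V ν) {φ : (Fin d → ℝ) → ℝ}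
    (hφ : Continuous φ) (hφh : ∀ (c : ℝ) v, 0 ≤ c → φ (c • v) = c * φ v) {R : ℝ} (hR : 0 < R)
    (hφR : ∀ v, φ v ≤ R * ‖v‖) (hpos : 0 < ν {v | 1 < φ v}) :
    IsRegVarTail (fun x => F.real {v | x < φ v}) α ∧
      ∃ s c : ℝ, 1 < s ∧ 0 < c ∧
        Tendsto (fun x : ℝ => F.real {v | s * x < φ v} / V.real (Ioi x)) atTop (𝓝 c) := by
  have hVp := hF.isProbabilityMeasure
  -- Level 1 need not be a continuity level. Some `b > 1` still carries mass, so a continuity level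
  -- in `(1, b)` has a positive limit.
  obtain ⟨b, hb1, hb⟩ : ∃ b : ℝ, 1 < b ∧ 0 < ν {v | b < φ v} := by
    by_contra! hcon
    refine hpos.ne' ?_
    have hU : {v | 1 < φ v} ⊆ ⋃ n : ℕ, {v | 1 + 1 / ((n : ℝ) + 1) < φ v} := by
      intro v hv
      obtain ⟨n, hn⟩ := exists_nat_one_div_lt (show 0 < φ v - 1 from sub_pos.2 hv)
      exact mem_iUnion.2 ⟨n, (by linarith : 1 + 1 / ((n : ℝ) + 1) < φ v)⟩
    refine measure_mono_null hU (measure_iUnion_null fun n => ?_)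
    exact nonpos_iff_eq_zero.1 (hcon _ (by have : (0 : ℝ) < 1 / ((n : ℝ) + 1) := by positivity
                                           linarith))
  obtain ⟨s, hs1, hsb, hsfin, hs⟩ := hF.exists_level hφ hφh hR hφR one_pos hb1
  have hs0 : 0 < s := by linarith
  set c := (ν {v | s < φ v}).toReal with hc
  have hc0 : 0 < c := ENNReal.toReal_pos
    (hb.trans_le (measure_mono fun v (hv : b < φ v) => hsb.trans hv)).ne' hsfin
  have hlim : Tendsto (fun x : ℝ => F.real {v | s * x < φ v} / V.real (Ioi x)) atTop (𝓝 c) := by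
    have := (ENNReal.tendsto_toReal hsfin).comp hs
    refine this.congr fun x => ?_
    simp [measureReal_def, ENNReal.toReal_div]
  refine ⟨⟨hF.index_pos, fun x y hxy => ?_, fun x => measureReal_nonneg, fun x => measureReal_le_one,
    fun t ht => ?_⟩, s, c, hs1, hc0, hlim⟩
  · exact measureReal_mono fun v (hv : y < φ v) => hxy.trans_lt hv
  · have h1 : Tendsto (fun y : ℝ => t * (y / s)) atTop atTop :=
      (tendsto_id.atTop_div_const hs0).const_mul_atTop ht
    have h2 : Tendsto (fun y : ℝ => y / s) atTop atTop := tendsto_id.atTop_div_const hs0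
    -- The ratio at `t * y` and `y` telescopes through the tails of `V` at `t * (y / s)` and `y /
    -- s`; the two limits `c` cancel.
    have h3 := ((hlim.comp h1).mul ((hF.regVar t ht).comp h2)).div (hlim.comp h2) hc0.ne'
    rw [mul_div_cancel_left₀ _ hc0.ne'] at h3
    refine h3.congr fun y => ?_
    have e1 : s * (t * (y / s)) = t * y := by field_simp
    have e2 : s * (y / s) = y := by field_simp
    have hV1 : V.real (Ioi (t * (y / s))) ≠ 0 :=
      (ENNReal.toReal_pos (hF.tail_ne_zero _) (measure_ne_top _ _)).ne'
    have hV2 : V.real (Ioi (y / s)) ≠ 0 :=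
      (ENNReal.toReal_pos (hF.tail_ne_zero _) (measure_ne_top _ _)).ne'
    simp only [Function.comp_apply, Pi.div_apply, e1, e2]
    rw [div_mul_div_cancel₀ hV1, div_div_div_cancel_right₀ hV2]

/-- The tail of the norm is dominated by the tail of a charged homogeneous function. -/
lemma exists_norm_tail_le [IsProbabilityMeasure F] (hF : IsMRV F α V ν) {φ : (Fin d → ℝ) → ℝ}
    (hφ : Continuous φ) (hφh : ∀ (c : ℝ) v, 0 ≤ c → φ (c • v) = c * φ v) {R : ℝ} (hR : 0 < R)
    (hφR : ∀ v, φ v ≤ R * ‖v‖) (hpos : 0 < ν {v | 1 < φ v}) :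
    ∃ K : ℝ, 0 < K ∧ ∀ x, 0 < x → F.real {v | x < ‖v‖} ≤ K * F.real {v | x < φ v} := by
  have hVp := hF.isProbabilityMeasure
  obtain ⟨hG, s, c, hs1, hc, hlim⟩ := hF.isRegVarTail hφ hφh hR hφR hpos
  -- A level `r < 1 < s` makes `r * x ≤ s * x`, so both tails are compared through `V (Ioi x)` at
  -- the same `x`.
  obtain ⟨r, hr0, hr1, hrfin, hr⟩ := hF.exists_level continuous_norm
    (fun c v hc => by rw [norm_smul, Real.norm_of_nonneg hc]) one_pos
    (fun v => (one_mul ‖v‖).ge) (show (0 : ℝ) < 1 / 2 by norm_num) (show (1 : ℝ) / 2 < 1 by norm_num)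
  set e := (ν {v | r < ‖v‖}).toReal with he
  have hlim' : Tendsto (fun x : ℝ => F.real {v | r * x < ‖v‖} / V.real (Ioi x)) atTop (𝓝 e) := by
    have := (ENNReal.tendsto_toReal hrfin).comp hr
    refine this.congr fun x => ?_
    simp [measureReal_def, ENNReal.toReal_div]
  have he0 : 0 ≤ e := ENNReal.toReal_nonneg
  obtain ⟨x₀, hx₀⟩ := eventually_atTop.1
    (((hlim.eventually (lt_mem_nhds (half_lt_self hc))).and
    (hlim'.eventually (gt_mem_nhds (lt_add_one e)))).and (eventually_gt_atTop 0))
  have hx₀0 : 0 < x₀ := (hx₀ x₀ le_rfl).2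
  have hG0 := hG.pos (s * x₀)
  set K₁ := (e + 1) / (c / 2) with hK₁
  have hK₁0 : 0 < K₁ := by positivity
  refine ⟨max K₁ (F.real {v | s * x₀ < φ v})⁻¹, by positivity, fun y hy => ?_⟩
  have hGy := hG.nonneg y
  rcases le_or_gt (s * x₀) y with h1 | h1
  · set x := y / s with hx
    have hs0 : 0 < s := by linarith
    have hxx₀ : x₀ ≤ x := by rw [hx, le_div_iff₀ hs0]; linarith
    have hsx : s * x = y := by rw [hx]; field_simp
    have hV : 0 < V.real (Ioi x) :=
      ENNReal.toReal_pos (hF.tail_ne_zero _) (measure_ne_top _ _)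
    obtain ⟨⟨h2, h3⟩, h4⟩ := hx₀ x hxx₀
    rw [lt_div_iff₀ hV, hsx] at h2
    rw [div_lt_iff₀ hV] at h3
    have h5 : F.real {v | y < ‖v‖} ≤ F.real {v | r * x < ‖v‖} := by
      refine measureReal_mono fun v (hv : y < ‖v‖) => lt_of_le_of_lt ?_ hv
      rw [← hsx]; gcongr; linarith
    calc F.real {v | y < ‖v‖} ≤ (e + 1) * V.real (Ioi x) := by linarith
      _ = K₁ * (c / 2 * V.real (Ioi x)) := by rw [hK₁]; field_simp
      _ ≤ K₁ * F.real {v | y < φ v} := by gcongr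
      _ ≤ _ := by gcongr; exact le_max_left _ _
  · calc F.real {v | y < ‖v‖} ≤ 1 := measureReal_le_one
      _ = (F.real {v | s * x₀ < φ v})⁻¹ * F.real {v | s * x₀ < φ v} :=
          (inv_mul_cancel₀ hG0.ne').symm
      _ ≤ _ := mul_le_mul (le_max_right _ _) (hG.antitone h1.le) measureReal_nonneg (by positivity)

end IsMRV

end RegularVariation

/-! ### From error bounds to ratios -/

section Ratio

lemma abs_toReal_div_sub_one_le {p Δ : ℝ≥0∞} {g ε : ℝ} (hg : 0 < g) (hε : 0 ≤ ε) (hp : p ≠ ⊤)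
    (hΔ0 : Δ ≠ 0) (hΔ : Δ ≠ ⊤)
    (hu : p ≤ ENNReal.ofReal g * (Δ + ENNReal.ofReal ε * Δ))
    (hl : ENNReal.ofReal g * Δ ≤ p + ENNReal.ofReal g * (ENNReal.ofReal ε * Δ)) :
    |p.toReal / (g * Δ.toReal) - 1| ≤ ε := by
  have hΔr : 0 < Δ.toReal := ENNReal.toReal_pos hΔ0 hΔ
  have hu' := ENNReal.toReal_mono (by finiteness) hu
  have hl' := ENNReal.toReal_mono (by finiteness) hl
  rw [ENNReal.toReal_mul, ENNReal.toReal_add hΔ (by finiteness), ENNReal.toReal_mul,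
    ENNReal.toReal_ofReal hg.le, ENNReal.toReal_ofReal hε] at hu'
  rw [ENNReal.toReal_add hp (by finiteness), ENNReal.toReal_mul, ENNReal.toReal_mul,
    ENNReal.toReal_mul, ENNReal.toReal_ofReal hg.le, ENNReal.toReal_ofReal hε] at hl'
  have hpos : 0 < g * Δ.toReal := by positivity
  have e : p.toReal / (g * Δ.toReal) - 1 = (p.toReal - g * Δ.toReal) / (g * Δ.toReal) := by
    field_simp
  rw [e, abs_div, abs_of_pos hpos, div_le_iff₀ hpos, abs_le]
  constructor <;> nlinarith

variable {Ω : Type*} {m : MeasurableSpace Ω} [mΩ : MeasurableSpace Ω] {P : Measure Ω}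
  {G : ℝ → ℝ} {α : ℝ} {θ Y : ℕ → Ω → ℝ}

namespace IsDiscountedModel

lemma tsum_setLIntegral_ne_top (D : IsDiscountedModel m P G θ Y)
    {k₁ k₂ : ℝ} (hk₁ : k₁ < α) (hk₂ : α < k₂)
    (hM : ∑' i, ∫⁻ ω, ENNReal.ofReal (θ i ω ^ k₁ + θ i ω ^ k₂) ∂P ≠ ⊤) (S : ℕ → Set Ω) :
    ∑' i, ∫⁻ ω in S i, ENNReal.ofReal (θ i ω ^ α) ∂P ≠ ⊤ :=
  ne_top_of_le_ne_top hM (ENNReal.tsum_le_tsum fun i =>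
    (lintegral_rpow_le_lintegral_add (D.discount_pos i) hk₁ hk₂).trans
      (setLIntegral_le_lintegral _ _))

/-- Uniform relative asymptotics over events of non-negligible limiting mass. -/
theorem ratio_of_le [IsProbabilityMeasure P] (D : IsDiscountedModel m P G θ Y)
    (h : IsRegVarTail G α) (hTAI : PairwiseTAI P G Y)
    (hneg : HasNegligibleTails P G fun i ω => ENNReal.ofReal (θ i ω * Y i ω))
    {k₁ k₂ : ℝ} (hk₁0 : 0 < k₁) (hk₁ : k₁ < α) (hk₂ : α < k₂)
    (hM : ∑' i, ∫⁻ ω, ENNReal.ofReal (θ i ω ^ k₁ + θ i ω ^ k₂) ∂P ≠ ⊤)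
    {c : ℝ≥0∞} (hc : c ≠ 0) {ε : ℝ} (hε : 0 < ε) :
    ∃ x₁ : ℝ, ∀ x, x₁ ≤ x → ∀ (S : ℕ → Set Ω) (E : Set Ω), (∀ i, MeasurableSet[m] (S i)) →
      c ≤ ∑' i, ∫⁻ ω in S i, ENNReal.ofReal (θ i ω ^ α) ∂P →
      P E ≤ P {ω | ENNReal.ofReal x <
        ∑' i, ENNReal.ofReal ((S i).indicator (fun ω => θ i ω * Y i ω) ω)} →
      P (⋃ i, S i ∩ {ω | x < θ i ω * Y i ω}) ≤ P E →
      |P.real E / (G x * (∑' i, ∫⁻ ω in S i, ENNReal.ofReal (θ i ω ^ α) ∂P).toReal) - 1| ≤ ε := by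
  -- An error `ε * c` is at most `ε` times the limiting mass, which is at least `c`.
  have hε' : ENNReal.ofReal ε * c ≠ 0 := mul_ne_zero (by simpa using hε) hc
  obtain ⟨xa, ha⟩ := D.measure_sum_gt_le h hTAI hneg hk₁0 hk₁ hk₂ hM hε'
  obtain ⟨xb, hb⟩ := D.le_measure_exists_gt h hTAI hk₁0 hk₁ hk₂ hM hε'
  refine ⟨max xa xb, fun x hx S E hS hcS hu hl => ?_⟩
  refine abs_toReal_div_sub_one_le (h.pos x) hε.le (measure_ne_top _ _)
    (fun h0 => hc (nonpos_iff_eq_zero.1 (h0 ▸ hcS)))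
    (D.tsum_setLIntegral_ne_top hk₁ hk₂ hM S) ?_ ?_
  · refine hu.trans ((ha x ((le_max_left _ _).trans hx) S hS).trans ?_)
    gcongr
  · refine (hb x ((le_max_right _ _).trans hx) S hS).trans ?_
    gcongr

/-- Uniform relative asymptotics over events of small probability. -/
theorem ratio_of_small [IsProbabilityMeasure P] (D : IsDiscountedModel m P G θ Y)
    (h : IsRegVarTail G α) {k₁ k₂ : ℝ} (hk₁0 : 0 < k₁) (hk₁ : k₁ < α) (hk₂ : α < k₂)
    (hfin : ∀ S : ℕ → Set Ω, ∑' i, ∫⁻ ω in S i, ENNReal.ofReal (θ i ω ^ α) ∂P ≠ ⊤)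
    {K : ℝ≥0∞} (hK : K ≠ ⊤) {c : ℝ≥0∞} (hc : c ≠ 0) {ε : ℝ} (hε : 0 < ε) :
    ∃ q₀ : ℝ≥0∞, q₀ ≠ 0 ∧ ∃ x₁ : ℝ, ∀ x, x₁ ≤ x → ∀ (S : ℕ → Set Ω) (E : Set Ω),
      (∀ i, MeasurableSet[m] (S i)) → Antitone S → (∀ i, P (S i) ≤ P (S 0) ^ (i + 1)) →
      (∀ i j, i ≤ j → ∫⁻ ω in S j, ENNReal.ofReal (θ i ω ^ k₁ + θ i ω ^ k₂) ∂P ≤ K * P (S j)) →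
      P (S 0) ≤ q₀ → P (S 0) ≠ 0 → c * P (S 0) ≤ ∫⁻ ω in S 0, ENNReal.ofReal (θ 0 ω ^ α) ∂P →
      P E ≤ P {ω | ENNReal.ofReal x <
        ∑' i, ENNReal.ofReal ((S i).indicator (fun ω => θ i ω * Y i ω) ω)} →
      P (⋃ i, S i ∩ {ω | x < θ i ω * Y i ω}) ≤ P E →
      |P.real E / (G x * (∑' i, ∫⁻ ω in S i, ENNReal.ofReal (θ i ω ^ α) ∂P).toReal) - 1| ≤ ε := by
  -- The mass is now only at least `c * P (S 0)`, and the available error is proportional to `P (S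
  -- 0)` too.
  have hε' : ENNReal.ofReal ε * c ≠ 0 := mul_ne_zero (by simpa using hε) hc
  obtain ⟨q₀, hq₀, x₁, H⟩ := D.bounds_of_small h hk₁0 hk₁ hk₂ hK hε'
  refine ⟨q₀, hq₀, x₁, fun x hx S E hS hanti hpow hSK hq hq0 hcS hu hl => ?_⟩
  obtain ⟨ha, hb⟩ := H x hx S hS hanti hpow hSK hq
  have hcS' : c * P (S 0) ≤ ∑' i, ∫⁻ ω in S i, ENNReal.ofReal (θ i ω ^ α) ∂P :=
    hcS.trans (ENNReal.le_tsum (f := fun i => ∫⁻ ω in S i, ENNReal.ofReal (θ i ω ^ α) ∂P) 0)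
  refine abs_toReal_div_sub_one_le (h.pos x) hε.le (measure_ne_top _ _)
    (fun h0 => mul_ne_zero hc hq0 (nonpos_iff_eq_zero.1 (h0 ▸ hcS'))) (hfin S) ?_ ?_
  · refine hu.trans (ha.trans ?_)
    rw [mul_assoc (ENNReal.ofReal ε)]
    gcongr
  · refine hb.trans ?_
    rw [mul_assoc (ENNReal.ofReal ε)]
    gcongr

end IsDiscountedModel

end Ratio

/-! ### Sandwiching the vector sum -/

section RareSum

variable {d : ℕ} {A : Set (Fin d → ℝ)}

/-- Subadditivity bounds the gauge of every partial sum, and continuity of the gauge carries this to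
the limit. -/
lemma IsRareSet.lt_tsum_of_tsum_mem (hA : IsRareSet A) {x : ℝ} (hx : 0 < x)
    {v : ℕ → Fin d → ℝ} (hv : Summable v) (h : ∑' i, v i ∈ x • A) :
    ENNReal.ofReal x < ∑' i, ENNReal.ofReal (gauge Aᶜ (v i)) := by
  by_contra! hcon
  rw [hA.mem_smul_iff hx] at h
  refine absurd h (not_lt.2 ?_)
  refine le_of_tendsto ((hA.continuous_gauge.tendsto _).comp hv.hasSum)
    (Eventually.of_forall fun s => (hA.gauge_sum_le s v).trans ?_)
  have h1 := (ENNReal.sum_le_tsum (f := fun i => ENNReal.ofReal (gauge Aᶜ (v i))) s).trans hcon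
  rw [← ENNReal.ofReal_sum_of_nonneg fun i _ => gauge_nonneg _,
    ENNReal.ofReal_le_ofReal_iff hx.le] at h1
  exact h1

/-- The sum is one term plus a nonnegative vector, and `A` is increasing. -/
lemma IsRareSet.tsum_mem_of_lt (hA : IsRareSet A) {x : ℝ} (hx : 0 < x)
    {v : ℕ → Fin d → ℝ} (hv : Summable v) (hv0 : ∀ i, 0 ≤ v i) {i : ℕ}
    (hi : x < gauge Aᶜ (v i)) : ∑' i, v i ∈ x • A := by
  have hle : v i ≤ ∑' j, v j := hv.le_tsum i fun j _ => hv0 j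
  rw [← hA.mem_smul_iff hx, mem_smul_set_iff_inv_smul_mem₀ hx.ne'] at hi
  rw [mem_smul_set_iff_inv_smul_mem₀ hx.ne']
  have h1 := hA.increasing _ hi (x⁻¹ • (∑' j, v j - v i))
    (smul_nonneg (inv_nonneg.2 hx.le) (sub_nonneg.2 hle))
  rwa [← smul_add, add_sub_cancel] at h1

end RareSum

/-! ### Arrival times -/

section Renewal

variable {Ω : Type*} [MeasurableSpace Ω] {P : Measure Ω} {T : ℕ → Ω → ℝ≥0}

namespace IsRenewalTimes

lemma measurable (hT : IsRenewalTimes P T) (i : ℕ) : Measurable (T i) := by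
  obtain ⟨τ, hτ, -, -, -, hTτ⟩ := hT
  have : T i = fun ω => ∑ j ∈ Finset.range (i + 1), τ j ω := funext (hTτ i)
  rw [this]
  exact Finset.measurable_sum _ fun j _ => hτ j

lemma monotone (hT : IsRenewalTimes P T) (ω : Ω) : Monotone fun i => T i ω := by
  obtain ⟨τ, -, -, -, -, hTτ⟩ := hT
  intro i j hij
  simp only [hTτ]
  exact Finset.sum_le_sum_of_subset (Finset.range_mono (by omega))

/-- `T i ≤ t` forces each of the `i + 1` independent nonnegative inter-arrival times to be at most
`t`, and `T 0` is the first of them. -/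
lemma measure_le_pow (hT : IsRenewalTimes P T) (i : ℕ) (t : ℝ≥0∞) :
    P {ω | (T i ω : ℝ≥0∞) ≤ t} ≤ P {ω | (T 0 ω : ℝ≥0∞) ≤ t} ^ (i + 1) := by
  obtain ⟨τ, hτ, hind, hid, -, hTτ⟩ := hT
  have hB : MeasurableSet {s : ℝ≥0 | (s : ℝ≥0∞) ≤ t} :=
    measurableSet_le measurable_coe_nnreal_ennreal measurable_const
  have h0 : ∀ ω, T 0 ω = τ 0 ω := fun ω => by simp [hTτ]
  have hsub : {ω | (T i ω : ℝ≥0∞) ≤ t} ⊆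
      ⋂ j ∈ Finset.range (i + 1), τ j ⁻¹' {s : ℝ≥0 | (s : ℝ≥0∞) ≤ t} := by
    intro ω hω
    refine mem_iInter₂.2 fun j hj => ?_
    refine le_trans (ENNReal.coe_le_coe.2 ?_) hω
    rw [hTτ]
    exact Finset.single_le_sum_of_canonicallyOrdered (f := fun j => τ j ω) hj
  refine (measure_mono hsub).trans ?_
  rw [hind.measure_inter_preimage_eq_mul (Finset.range (i + 1)) fun j _ => hB]
  have h1 : ∀ j, P (τ j ⁻¹' {s : ℝ≥0 | (s : ℝ≥0∞) ≤ t}) = P {ω | (T 0 ω : ℝ≥0∞) ≤ t} := by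
    intro j
    rw [(hid j).measure_preimage_eq hB]
    simp only [h0]
    rfl
  rw [Finset.prod_congr rfl fun j _ => h1 j, Finset.prod_const, Finset.card_range]

lemma mem_renewalSupport_iff (hT : IsRenewalTimes P T) {t : ℝ≥0∞} :
    t ∈ renewalSupport P T ↔ P {ω | (T 0 ω : ℝ≥0∞) ≤ t} ≠ 0 := by
  change 0 < renewalFunction P T t ↔ _
  rw [renewalFunction, pos_iff_ne_zero, Ne, ENNReal.tsum_eq_zero, not_iff_not]
  refine ⟨fun h => h 0, fun h i => measure_mono_null (fun ω hω => ?_) h⟩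
  exact (ENNReal.coe_le_coe.2 (hT.monotone ω (Nat.zero_le i))).trans hω

end IsRenewalTimes

end Renewal

/-! ### The three moment regimes -/

section Summability

variable {Ω : Type*} [MeasurableSpace Ω] {P : Measure Ω} [IsProbabilityMeasure P]
  {T : ℕ → Ω → ℝ≥0} {ξ : ℝ≥0 → Ω → ℝ} {G : ℝ → ℝ} {α : ℝ}

theorem MomentSummability.negligibleTails_and_moments (hm : MomentSummability P T ξ α)
    (h : IsRegVarTail G α) (hθm : ∀ i, Measurable (discountFactor T ξ i)) {W : ℕ → Ω → ℝ}
    (hWm : ∀ i, Measurable (W i)) {K : ℝ≥0∞} (hK : K ≠ ⊤)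
    (H : ∀ i x, 0 < x → P {ω | x < discountFactor T ξ i ω * W i ω} ≤
      K * ∫⁻ ω, ENNReal.ofReal (G (x / discountFactor T ξ i ω)) ∂P) :
    HasNegligibleTails P G (fun i ω => ENNReal.ofReal (discountFactor T ξ i ω * W i ω)) ∧
      ∃ k₁ k₂ : ℝ, 0 < k₁ ∧ k₁ < α ∧ α < k₂ ∧
        ∑' i, ∫⁻ ω, ENNReal.ofReal (discountFactor T ξ i ω ^ k₁ +
          discountFactor T ξ i ω ^ k₂) ∂P ≠ ⊤ := by
  have hsum : ∀ k₁ k₂, ∑' i, posMoment P (discountFactor T ξ i) k₁ ≠ ⊤ →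
      ∑' i, posMoment P (discountFactor T ξ i) k₂ ≠ ⊤ →
      ∑' i, ∫⁻ ω, ENNReal.ofReal (discountFactor T ξ i ω ^ k₁ +
          discountFactor T ξ i ω ^ k₂) ∂P ≠ ⊤ := by
    intro k₁ k₂ h1 h2
    simp only [lintegral_ofReal_rpow_add (hθm _) (discountFactor_pos _)]
    rw [ENNReal.tsum_add]
    exact ENNReal.add_ne_top.2 ⟨h1, h2⟩
  obtain ⟨m1, m2, m3⟩ := hm
  simp only [← posMoment_discountFactor] at m1 m2 m3
  rcases lt_trichotomy α 1 with hα | hα | hα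
  · obtain ⟨k₁, k₂, a1, a2, a3, a4, a5⟩ := m3 hα
    obtain ⟨b1, b2, b3⟩ := negligibleTails_and_moments_of_max h hθm discountFactor_pos hWm hK H
      le_rfl hα a1 a2 a3 (by simpa using a5.ne)
    exact ⟨b1, k₁, k₂, a1, a2, a3, hsum _ _ b2 b3⟩
  · obtain ⟨k₁, k₂, a1, a2, a3, a4⟩ := m2 hα
    have e : ∀ i, max (posMoment P (discountFactor T ξ i) k₁ ^ (1 / k₂))
        (posMoment P (discountFactor T ξ i) k₂ ^ (1 / k₂)) =
        max (posMoment P (discountFactor T ξ i) k₁) (posMoment P (discountFactor T ξ i) k₂) ^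
          (1 / k₂) := fun i =>
      ((ENNReal.monotone_rpow_of_nonneg (by
        have := h.index_pos.trans a3; positivity)).map_max).symm
    simp only [e] at a4
    obtain ⟨b1, b2, b3⟩ := negligibleTails_and_moments_of_max h hθm discountFactor_pos hWm hK H
      (hα ▸ a3.le) a3 a1 a2 a3 a4.ne
    exact ⟨b1, k₁, k₂, a1, a2, a3, hsum _ _ b2 b3⟩
  · obtain ⟨k₁, k₂, a1, a2, a3, a4⟩ := m1 hα
    obtain ⟨b1, l₁, b2, b3, b4, b5⟩ := negligibleTails_and_moments_of_one_lt h hα hθm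
      discountFactor_pos hWm hK H a3
      (ne_top_of_le_ne_top a4.ne (ENNReal.tsum_le_tsum fun i => le_max_right _ _))
    exact ⟨b1, l₁, k₂, b2, b3, a3, hsum _ _ b4 b5⟩

end Summability

/-! ### Transfer to the discounted aggregate claims -/

section Assembly

variable {d : ℕ} {Ω : Type*} [MeasurableSpace Ω] {P : Measure Ω}
  {X : ℕ → Ω → Fin d → ℝ} {T : ℕ → Ω → ℝ≥0} {ξ : ℝ≥0 → Ω → ℝ} {A : Set (Fin d → ℝ)}
  {G : ℝ → ℝ} {α : ℝ}

/-- Asymptotic independence is used on the diagonal only. The level and the gauge agree on the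
orthant, hence almost surely at the claims. -/
lemma IsTAI.pairwiseTAI [IsFiniteMeasure P] (hTAI : IsTAI P A X) (hA : IsRareSet A) (hX : ∀ i, Measurable (X i))
    (hX0 : ∀ i, ∀ᵐ ω ∂P, 0 ≤ X i ω)
    (hG : ∀ i x, P {ω | x < gauge Aᶜ (X i ω)} = ENNReal.ofReal (G x)) :
    PairwiseTAI P G (fun i ω => gauge Aᶜ (X i ω)) := by
  intro i j hij ε hε
  have hdiag : Tendsto (fun x : ℝ => (x, x)) atTop (atTop ×ˢ atTop) := tendsto_id.prodMk tendsto_id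
  obtain ⟨x₁, hx₁⟩ := eventually_atTop.1
    (((hTAI i j hij).comp hdiag).eventually (ge_mem_nhds (pos_iff_ne_zero.2 hε)))
  refine ⟨x₁, fun x hx => ?_⟩
  have h1 := hx₁ x hx
  simp only [Function.comp_apply] at h1
  have hae : ∀ l, {ω | x < rareLevel A (X l ω)} =ᵐ[P] {ω | x < gauge Aᶜ (X l ω)} := by
    intro l
    filter_upwards [hX0 l] with ω hω
    exact congrArg (x < ·) (hA.rareLevel_eq_gauge hω)
  have hm : ∀ l, MeasurableSet {ω | x < gauge Aᶜ (X l ω)} := fun l =>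
    measurableSet_lt measurable_const (hA.continuous_gauge.measurable.comp (hX l))
  have h2 : cond P {ω | x < rareLevel A (X j ω)} = cond P {ω | x < gauge Aᶜ (X j ω)} := by
    rw [ProbabilityTheory.cond, ProbabilityTheory.cond, measure_congr (hae j),
      Measure.restrict_congr_set (hae j)]
  rw [h2, measure_congr (cond_absolutelyContinuous.ae_eq (hae i)), cond_apply (hm j)] at h1
  by_cases h0 : P {ω | x < gauge Aᶜ (X j ω)} = 0
  · rw [measure_mono_null inter_subset_right h0]
    exact zero_le
  · rw [inter_comm, ← hG j, mul_comm ε]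
    rwa [ENNReal.inv_mul_le_iff h0 (measure_ne_top _ _)] at h1

/-- Almost sure summability is essential: a divergent series would give `tsum` its default value 0.
-/
lemma measure_discountedClaims_le (hA : IsRareSet A)
    (hsum : ∀ᵐ ω ∂P, Summable fun i => Real.exp (-ξ (T i ω) ω) • X i ω) {x : ℝ} (hx : 0 < x)
    (t : ℝ≥0∞) :
    P {ω | discountedClaims X T ξ t ω ∈ x • A} ≤ P {ω | ENNReal.ofReal x <
      ∑' i, ENNReal.ofReal ({ω | (T i ω : ℝ≥0∞) ≤ t}.indicator
        (fun ω => discountFactor T ξ i ω * gauge Aᶜ (X i ω)) ω)} := by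
  refine measure_mono_ae ?_
  filter_upwards [hsum] with ω hω h
  have h1 := hA.lt_tsum_of_tsum_mem hx (hω.indicator {j : ℕ | (T j ω : ℝ≥0∞) ≤ t}) h
  refine h1.trans_le (le_of_eq (tsum_congr fun i => ?_))
  by_cases hi : (T i ω : ℝ≥0∞) ≤ t
  · rw [indicator_of_mem (show i ∈ {j : ℕ | (T j ω : ℝ≥0∞) ≤ t} from hi),
      indicator_of_mem (show ω ∈ {ω | (T i ω : ℝ≥0∞) ≤ t} from hi),
      gauge_smul_of_nonneg (Real.exp_pos _).le]
    rfl
  · rw [indicator_of_notMem (show i ∉ {j : ℕ | (T j ω : ℝ≥0∞) ≤ t} from hi),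
      indicator_of_notMem (show ω ∉ {ω | (T i ω : ℝ≥0∞) ≤ t} from hi), gauge_zero]

lemma le_measure_discountedClaims (hA : IsRareSet A) (hX0 : ∀ i, ∀ᵐ ω ∂P, 0 ≤ X i ω)
    (hsum : ∀ᵐ ω ∂P, Summable fun i => Real.exp (-ξ (T i ω) ω) • X i ω) {x : ℝ} (hx : 0 < x)
    (t : ℝ≥0∞) :
    P (⋃ i, {ω | (T i ω : ℝ≥0∞) ≤ t} ∩
      {ω | x < discountFactor T ξ i ω * gauge Aᶜ (X i ω)}) ≤
      P {ω | discountedClaims X T ξ t ω ∈ x • A} := by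
  refine measure_mono_ae ?_
  filter_upwards [hsum, ae_all_iff.2 hX0] with ω hω hω0 h
  obtain ⟨i, hi, hi'⟩ := mem_iUnion.1 h
  refine hA.tsum_mem_of_lt hx (hω.indicator _) (fun j => ?_) (i := i) ?_
  · exact indicator_apply_nonneg fun _ => smul_nonneg (Real.exp_pos _).le (hω0 j)
  · rw [indicator_of_mem (show i ∈ {j : ℕ | (T j ω : ℝ≥0∞) ≤ t} from hi),
      gauge_smul_of_nonneg (Real.exp_pos _).le]
    exact hi'

/-- On an initial piece of `Λ`, the moments of the discount factors are controlled. -/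
lemma setLIntegral_add_le [IsProbabilityMeasure P] (hT : IsRenewalTimes P T) (hξ : IsCadlagProcess ξ)
    (hind : IndepIngredients P X T ξ) (hΛ : ∀ᵐ ω ∂P, (T 0 ω : ℝ≥0∞) ∈ renewalSupport P T)
    {k₁ k : ℝ} (hk₁ : 0 ≤ k₁) (hk : k₁ ≤ k) {t₁ : ℝ≥0∞} {C : ℝ≥0}
    (hC : ∀ s : ℝ≥0, (s : ℝ≥0∞) ∈ renewalSupport P T → (s : ℝ≥0∞) ≤ t₁ →
      discountMoment P ξ k (fun _ => s) ≤ C) {t : ℝ≥0∞} (ht : t ≤ t₁) {i j : ℕ} (hij : i ≤ j) :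
    ∫⁻ ω in {ω | (T j ω : ℝ≥0∞) ≤ t}, ENNReal.ofReal (discountFactor T ξ i ω ^ k₁ +
      discountFactor T ξ i ω ^ k) ∂P ≤ (1 + 2 * C) * P {ω | (T j ω : ℝ≥0∞) ≤ t} := by
  have hTm := hT.measurable
  have hS : MeasurableSet {s : ℝ≥0 | (s : ℝ≥0∞) ≤ t} :=
    measurableSet_le measurable_coe_nnreal_ennreal measurable_const
  have hB : MeasurableSet {τ : ℕ → ℝ≥0 | (τ j : ℝ≥0∞) ≤ t} :=
    (measurable_pi_apply j : Measurable fun τ : ℕ → ℝ≥0 => τ j) hS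
  have h1 : ∫⁻ ω in {ω | (T j ω : ℝ≥0∞) ≤ t}, ENNReal.ofReal (discountFactor T ξ i ω ^ k) ∂P ≤
      C * P {ω | (T j ω : ℝ≥0∞) ≤ t} := by
    refine (setLIntegral_discountFactor hTm hξ hind hB k i).trans_le ?_
    rw [← setLIntegral_const]
    refine setLIntegral_mono_ae measurable_const.aemeasurable ?_
    filter_upwards [hΛ] with ω hω hωt
    have h2 : (T i ω : ℝ≥0∞) ≤ t :=
      le_trans (ENNReal.coe_le_coe.2 (hT.monotone ω hij)) hωt
    refine hC _ ?_ (h2.trans ht)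
    -- `Λ` is upward closed, so it contains `T i ω ≥ T 0 ω` and the moment bound applies at that
    -- time.
    rw [hT.mem_renewalSupport_iff] at hω ⊢
    refine fun h0 => hω (measure_mono_null (fun ω' (hω' : (T 0 ω' : ℝ≥0∞) ≤ T 0 ω) => ?_) h0)
    exact le_trans hω' (ENNReal.coe_le_coe.2 (hT.monotone ω (Nat.zero_le i)))
  calc ∫⁻ ω in {ω | (T j ω : ℝ≥0∞) ≤ t}, ENNReal.ofReal (discountFactor T ξ i ω ^ k₁ +
        discountFactor T ξ i ω ^ k) ∂P
      ≤ ∫⁻ ω in {ω | (T j ω : ℝ≥0∞) ≤ t},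
          (1 + 2 * ENNReal.ofReal (discountFactor T ξ i ω ^ k)) ∂P := by
        refine lintegral_mono fun ω => ?_
        have h0 := discountFactor_pos (T := T) (ξ := ξ) i ω
        have p1 : 0 < discountFactor T ξ i ω ^ k := by positivity
        rw [← ENNReal.ofReal_one, ← ENNReal.ofReal_ofNat 2, ← ENNReal.ofReal_mul (by norm_num),
          ← ENNReal.ofReal_add zero_le_one (by positivity)]
        refine ENNReal.ofReal_le_ofReal ?_
        rcases le_total (discountFactor T ξ i ω) 1 with h | h
        · have := Real.rpow_le_one h0.le h hk₁
          linarith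
        · have := Real.rpow_le_rpow_of_exponent_le h hk
          linarith
    _ = P {ω | (T j ω : ℝ≥0∞) ≤ t} + 2 * ∫⁻ ω in {ω | (T j ω : ℝ≥0∞) ≤ t},
          ENNReal.ofReal (discountFactor T ξ i ω ^ k) ∂P := by
        rw [lintegral_add_left measurable_const, lintegral_const_mul' _ _ (by simp)]
        simp
    _ ≤ P {ω | (T j ω : ℝ≥0∞) ≤ t} + 2 * (C * P {ω | (T j ω : ℝ≥0∞) ≤ t}) := by gcongr
    _ = _ := by ring

/-- By right-continuity, moments of the discount factor are bounded below to the right of any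
time. -/
lemma exists_le_discountMoment [NeZero P] (hξ : IsCadlagProcess ξ) (k : ℝ) (s₀ : ℝ≥0) :
    ∃ c : ℝ≥0∞, c ≠ 0 ∧ ∀ᶠ s in 𝓝[≥] s₀, c ≤ discountMoment P ξ k (fun _ => s) := by
  have hm : ∀ s : ℝ≥0, Measurable fun ω => ENNReal.ofReal (Real.exp (-k * ξ s ω)) := fun s =>
    ENNReal.measurable_ofReal.comp (Real.measurable_exp.comp ((hξ.measurable s).const_mul _))
  have hpos : discountMoment P ξ k (fun _ => s₀) ≠ 0 := by
    rw [discountMoment, ← pos_iff_ne_zero, lintegral_pos_iff_support (hm s₀),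
      show (Function.support fun ω => ENNReal.ofReal (Real.exp (-k * ξ s₀ ω))) = univ from
        eq_univ_of_forall fun ω => by simpa using Real.exp_pos _]
    exact NeZero.pos _
  obtain ⟨c, hc0, hc⟩ := exists_between (pos_iff_ne_zero.2 hpos)
  refine ⟨c, hc0.ne', ?_⟩
  have hfatou := lintegral_liminf_le (μ := P) (u := 𝓝[≥] s₀) hm
  have hlim : ∀ ω, liminf (fun s => ENNReal.ofReal (Real.exp (-k * ξ s ω))) (𝓝[≥] s₀) =
      ENNReal.ofReal (Real.exp (-k * ξ s₀ ω)) := by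
    intro ω
    refine Tendsto.liminf_eq ?_
    refine (ENNReal.continuous_ofReal.tendsto _).comp ((Real.continuous_exp.tendsto _).comp ?_)
    exact (hξ.right_continuous ω s₀).tendsto.const_mul _
  simp only [hlim] at hfatou
  exact (eventually_lt_of_lt_liminf (hc.trans_le hfatou)).mono fun s hs => le_of_lt hs

section Uniform

variable [IsProbabilityMeasure P]

/-- The gauge may vanish on nonzero vectors, so convergence is proved for norms. Their tails are
`O(G)`, which is all that the negligibility criterion needs. -/
lemma summable_discounted (hT : ∀ i, Measurable (T i)) (hξ : IsCadlagProcess ξ)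
    (hX : ∀ i, Measurable (X i)) (hind : IndepIngredients P X T ξ) {F : Measure (Fin d → ℝ)}
    (hX_law : ∀ i, P.map (X i) = F) (h : IsRegVarTail G α) {K : ℝ} (hK0 : 0 < K)
    (hK : ∀ x, 0 < x → F.real {v | x < ‖v‖} ≤ K * G x) (hm : MomentSummability P T ξ α) :
    ∀ᵐ ω ∂P, Summable fun i => Real.exp (-ξ (T i ω) ω) • X i ω := by
  have D := isDiscountedModel hX hT hξ hind hX_law measurable_norm norm_nonneg
  have hneg := (hm.negligibleTails_and_moments h D.measurable_discount' D.measurable_claim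
    (K := ENNReal.ofReal K) ENNReal.ofReal_ne_top fun i x hx => by
      have h1 := D.tail i x univ hx MeasurableSet.univ
      rw [univ_inter, Measure.restrict_univ] at h1
      rw [h1, ← lintegral_const_mul' _ _ ENNReal.ofReal_ne_top]
      refine lintegral_mono fun ω => ?_
      rw [← ENNReal.ofReal_mul hK0.le]
      exact ENNReal.ofReal_le_ofReal (hK _ (div_pos hx (discountFactor_pos i ω)))).1
  filter_upwards [hneg.ae_tsum_ne_top h.le_one fun i ω => ENNReal.ofReal_ne_top] with ω hω
  refine Summable.of_norm ((ENNReal.summable_toReal hω).congr fun i => ?_)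
  rw [ENNReal.toReal_ofReal (D.mul_nonneg i ω), norm_smul, Real.norm_of_nonneg (Real.exp_pos _).le]
  rfl

lemma uniformlyEquivalent_of_eventually {F : Measure (Fin d → ℝ)} (hA : IsRareSet A)
    (hT : ∀ i, Measurable (T i)) (hξ : IsCadlagProcess ξ) (hind : IndepIngredients P X T ξ)
    {Δ : Set ℝ≥0∞}
    (H : ∀ ε : ℝ, 0 < ε → ∃ x₁ : ℝ, ∀ x, x₁ ≤ x → 0 < x → ∀ t ∈ Δ,
      |P.real {ω | discountedClaims X T ξ t ω ∈ x • A} / (F.real {v | x < gauge Aᶜ v} *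
        (∑' i, ∫⁻ ω in {ω | (T i ω : ℝ≥0∞) ≤ t},
          ENNReal.ofReal (discountFactor T ξ i ω ^ α) ∂P).toReal) - 1| ≤ ε) :
    UniformlyEquivalent
      (fun x t => P.real {ω | discountedClaims X T ξ t ω ∈ x • A})
      (fun x t => F.real (x • A) * (discountIntegral P T ξ α t).toReal) Δ := by
  refine Metric.tendstoUniformlyOn_iff.2 fun ε hε => ?_
  obtain ⟨x₁, hx₁⟩ := H (ε / 2) (half_pos hε)
  filter_upwards [eventually_ge_atTop x₁, eventually_gt_atTop 0] with x hx hx0 t ht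
  rw [dist_comm, Real.dist_eq, hA.smul_eq hx0, discountIntegral_eq hT hξ hind]
  have := hx₁ x hx hx0 t ht
  rw [hA.smul_eq hx0] at this
  exact this.trans_lt (half_lt_self hε)

end Uniform

end Assembly

end

/-! ### The main theorem -/

theorem mainTheorem3 {d : ℕ} {Ω : Type*} [MeasurableSpace Ω] (P : Measure Ω)
    [IsProbabilityMeasure P]
    (X : ℕ → Ω → Fin d → ℝ) (T : ℕ → Ω → ℝ≥0) (ξ : ℝ≥0 → Ω → ℝ)
    (A : Set (Fin d → ℝ)) (hA : IsRareSet A)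
    (F : Measure (Fin d → ℝ)) (α : ℝ) (V : Measure ℝ) (ν : Measure (Fin d → ℝ))
    (hX : ∀ i, Measurable (X i)) (hX_nonneg : ∀ i, ∀ᵐ ω ∂P, 0 ≤ X i ω)
    (hX_law : ∀ i, P.map (X i) = F)
    (hF : IsMRV F α V ν) (hνA : 0 < ν A)
    (hTAI : IsTAI P A X)
    (hT : IsRenewalTimes P T)
    (hξ : IsCadlagProcess ξ)
    (hindep : IndepIngredients P X T ξ)
    (hmoment : MomentSummability P T ξ α) :
    (∀ᵐ ω ∂P, Summable fun i => Real.exp (-ξ (T i ω) ω) • X i ω) ∧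
    (∀ t₀ ∈ renewalSupport P T,
      UniformlyEquivalent
        (fun x t => P.real {ω | discountedClaims X T ξ t ω ∈ x • A})
        (fun x t => F.real (x • A) * (discountIntegral P T ξ α t).toReal)
        (Ici t₀)) ∧
    (InitialMomentBound P T ξ α →
      UniformlyEquivalent
        (fun x t => P.real {ω | discountedClaims X T ξ t ω ∈ x • A})
        (fun x t => F.real (x • A) * (discountIntegral P T ξ α t).toReal)
        (renewalSupport P T)) := by
  have hFp : IsProbabilityMeasure F :=
    hX_law 0 ▸ Measure.isProbabilityMeasure_map (hX 0).aemeasurable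
  have hTm := hT.measurable
  have hgh : ∀ (c : ℝ) v, 0 ≤ c → gauge Aᶜ (c • v) = c * gauge Aᶜ v := fun c v hc => by
    rw [gauge_smul_of_nonneg hc, smul_eq_mul]
  obtain ⟨R, hR, hgR⟩ := hA.exists_gauge_le
  have hνpos : 0 < ν {v | 1 < gauge Aᶜ v} := by
    rwa [show {v | 1 < gauge Aᶜ v} = A from ext fun v => hA.one_lt_gauge_iff]
  have hG := (hF.isRegVarTail hA.continuous_gauge hgh hR hgR hνpos).1
  obtain ⟨K, hK0, hK⟩ := hF.exists_norm_tail_le hA.continuous_gauge hgh hR hgR hνpos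
  set G : ℝ → ℝ := fun x => F.real {v | x < gauge Aᶜ v} with hGdef
  have D := isDiscountedModel hX hTm hξ hindep hX_law hA.continuous_gauge.measurable
    (fun v => gauge_nonneg v)
  have hsum := summable_discounted hTm hξ hX hindep hX_law hG hK0 hK hmoment
  have hpair := hTAI.pairwiseTAI hA hX hX_nonneg D.claim_tail
  obtain ⟨hneg, k₁, k₂, hk₁0, hk₁, hk₂, hM⟩ := hmoment.negligibleTails_and_moments hG
    D.measurable_discount' D.measurable_claim (K := 1) ENNReal.one_ne_top fun i x hx => by
      have h1 := D.tail i x univ hx MeasurableSet.univ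
      rw [univ_inter, Measure.restrict_univ] at h1
      rw [h1, one_mul]
  have hSm : ∀ t i, MeasurableSet[discountSigma T ξ] {ω | (T i ω : ℝ≥0∞) ≤ t} := fun t i =>
    measurable_arrival_discountSigma i
      (measurableSet_le measurable_coe_nnreal_ennreal measurable_const :
        MeasurableSet {s : ℝ≥0 | (s : ℝ≥0∞) ≤ t})
  set I : ℝ≥0∞ → ℝ≥0∞ := fun t => ∑' i, ∫⁻ ω in {ω | (T i ω : ℝ≥0∞) ≤ t},
    ENNReal.ofReal (discountFactor T ξ i ω ^ α) ∂P with hI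
  have hImono : Monotone I := fun s t hst => ENNReal.tsum_le_tsum fun i =>
    lintegral_mono_set fun ω (hω : _ ≤ _) => le_trans hω hst
  have hIpos : ∀ t ∈ renewalSupport P T, I t ≠ 0 := by
    intro t ht h0
    rw [hT.mem_renewalSupport_iff] at ht
    have h1 := ENNReal.tsum_eq_zero.1 h0 0
    have hm : Measurable fun ω => ENNReal.ofReal (discountFactor T ξ 0 ω ^ α) :=
      ((D.measurable_discount' 0).pow_const α).ennreal_ofReal
    refine ((setLIntegral_pos_iff hm).2 ?_).ne' h1
    rw [show (Function.support fun ω => ENNReal.ofReal (discountFactor T ξ 0 ω ^ α)) = univ from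
      eq_univ_of_forall fun ω => by
        simpa using Real.rpow_pos_of_pos (discountFactor_pos (T := T) (ξ := ξ) 0 ω) α, univ_inter]
    exact pos_iff_ne_zero.2 ht
  have part1 : ∀ t₀ ∈ renewalSupport P T, ∀ ε : ℝ, 0 < ε → ∃ x₁ : ℝ, ∀ x, x₁ ≤ x → 0 < x →
      ∀ t ∈ Ici t₀, |P.real {ω | discountedClaims X T ξ t ω ∈ x • A} /
        (G x * (I t).toReal) - 1| ≤ ε := by
    intro t₀ ht₀ ε hε
    obtain ⟨x₁, hx₁⟩ := D.ratio_of_le hG hpair hneg hk₁0 hk₁ hk₂ hM (hIpos t₀ ht₀) hε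
    exact ⟨x₁, fun x hx hx0 t ht => hx₁ x hx _ _ (hSm t) (hImono ht)
      (measure_discountedClaims_le hA hsum hx0 t)
      (le_measure_discountedClaims hA hX_nonneg hsum hx0 t)⟩
  refine ⟨hsum, fun t₀ ht₀ => uniformlyEquivalent_of_eventually hA hTm hξ hindep (part1 t₀ ht₀),
    fun hinit => uniformlyEquivalent_of_eventually hA hTm hξ hindep fun ε hε => ?_⟩
  obtain ⟨k, hk, t₁, ht₁, C, hC⟩ := hinit
  set N : Set ℝ≥0 := {s | (s : ℝ≥0∞) ∈ renewalSupport P T} with hN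
  set s₀ : ℝ≥0 := sInf N with hs₀
  have hmonoΛ : ∀ s t : ℝ≥0∞, s ∈ renewalSupport P T → s ≤ t → t ∈ renewalSupport P T := by
    intro s t hs hst
    rw [hT.mem_renewalSupport_iff] at hs ⊢
    exact fun h0 => hs (measure_mono_null (fun ω (hω : _ ≤ _) => le_trans hω hst) h0)
  have hlow : ∀ t ∈ renewalSupport P T, (s₀ : ℝ≥0∞) ≤ t := by
    intro t ht
    induction t with
    | top => exact le_top
    | coe t => exact ENNReal.coe_le_coe.2 (csInf_le (OrderBot.bddBelow _) ht)
  -- If `Λ` contains its infimum, it lies in `[s₀, ∞]` and the first uniformity statement suffices.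
  by_cases hs₀Λ : (s₀ : ℝ≥0∞) ∈ renewalSupport P T
  · obtain ⟨x₁, hx₁⟩ := part1 s₀ hs₀Λ ε hε
    exact ⟨x₁, fun x hx hx0 t ht => hx₁ x hx hx0 t (hlow t ht)⟩
  have hs₀null : P {ω | (T 0 ω : ℝ≥0∞) ≤ s₀} = 0 := by
    rwa [hT.mem_renewalSupport_iff, not_not] at hs₀Λ
  have hgtΛ : ∀ t : ℝ≥0∞, (s₀ : ℝ≥0∞) < t → t ∈ renewalSupport P T := by
    intro t ht
    -- This excludes the default value `sInf ∅ = 0`: the first arrival is finite, so some finite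
    -- time belongs to `Λ`.
    have hne : N.Nonempty := by
      by_contra hemp
      rw [not_nonempty_iff_eq_empty] at hemp
      have hcov : (univ : Set Ω) ⊆ ⋃ n : ℕ, {ω | (T 0 ω : ℝ≥0∞) ≤ (n : ℝ≥0)} := by
        intro ω _
        obtain ⟨n, hn⟩ := exists_nat_ge (T 0 ω)
        exact mem_iUnion.2 ⟨n, ENNReal.coe_le_coe.2 hn⟩
      have hnull : P (univ : Set Ω) = 0 := by
        refine measure_mono_null hcov (measure_iUnion_null fun n => ?_)
        by_contra h0
        have : (n : ℝ≥0) ∈ N := (hT.mem_renewalSupport_iff).2 h0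
        rw [hemp] at this
        exact this
      simp at hnull
    by_cases htop : t = ⊤
    · obtain ⟨s, hs⟩ := hne
      exact hmonoΛ s t hs (htop ▸ le_top)
    · lift t to ℝ≥0 using htop
      obtain ⟨s, hs, hst⟩ := exists_lt_of_csInf_lt hne (ENNReal.coe_lt_coe.1 ht)
      exact hmonoΛ s t hs (ENNReal.coe_le_coe.2 hst.le)
  have hgt : ∀ t ∈ renewalSupport P T, (s₀ : ℝ≥0∞) < t := fun t ht =>
    lt_of_le_of_ne (hlow t ht) fun h => hs₀Λ (h ▸ ht)
  have haegt : ∀ᵐ ω ∂P, (s₀ : ℝ≥0∞) < T 0 ω := by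
    rw [ae_iff]
    simpa only [not_lt] using hs₀null
  have haeΛ : ∀ᵐ ω ∂P, (T 0 ω : ℝ≥0∞) ∈ renewalSupport P T := haegt.mono fun ω => hgtΛ _
  obtain ⟨c, hc0, hc⟩ := exists_le_discountMoment (P := P) hξ α s₀
  -- The exponents here are `α / 2` and the `k` of the initial moment bound; the summability
  -- exponents serve only for finiteness of the integral.
  obtain ⟨q₀, hq₀, x₁, hx₁⟩ := D.ratio_of_small hG (half_pos hG.index_pos)
    (half_lt_self hG.index_pos) hk (fun S => D.tsum_setLIntegral_ne_top hk₁ hk₂ hM S)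
    (K := 1 + 2 * C) (by finiteness) hc0 hε
  have hqlim : Tendsto (fun n : ℕ => P {ω | (T 0 ω : ℝ≥0∞) ≤ (s₀ + 1 / ((n : ℝ≥0) + 1) : ℝ≥0)})
      atTop (𝓝 0) := by
    have hanti : Antitone fun n : ℕ =>
        {ω | (T 0 ω : ℝ≥0∞) ≤ (s₀ + 1 / ((n : ℝ≥0) + 1) : ℝ≥0)} := by
      intro a b hab ω hω
      refine le_trans (show (T 0 ω : ℝ≥0∞) ≤ _ from hω) (ENNReal.coe_le_coe.2 ?_)
      gcongr
    have h1 := tendsto_measure_iInter_atTop (μ := P)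
      (fun n => (D.le _ (hSm _ 0)).nullMeasurableSet) hanti ⟨0, measure_ne_top _ _⟩
    have h2 : P (⋂ n : ℕ, {ω | (T 0 ω : ℝ≥0∞) ≤ (s₀ + 1 / ((n : ℝ≥0) + 1) : ℝ≥0)}) = 0 := by
      refine measure_mono_null (fun ω hω => ENNReal.coe_le_coe.2 ?_) hs₀null
      have hlim : Tendsto (fun n : ℕ => s₀ + 1 / ((n : ℝ≥0) + 1)) atTop (𝓝 s₀) := by
        have h3 : Tendsto (fun n : ℕ => 1 / ((n : ℝ≥0) + 1)) atTop (𝓝 0) := by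
          rw [← NNReal.tendsto_coe]
          simpa using tendsto_one_div_add_atTop_nhds_zero_nat (𝕜 := ℝ)
        simpa using h3.const_add s₀
      exact ge_of_tendsto' hlim fun n => ENNReal.coe_le_coe.1 (mem_iInter.1 hω n)
    rwa [h2] at h1
  obtain ⟨n, hn⟩ := (hqlim.eventually (ge_mem_nhds (pos_iff_ne_zero.2 hq₀))).exists
  obtain ⟨s₁, hs₁, hcs₁⟩ := mem_nhdsGE_iff_exists_Ico_subset.1 hc
  -- Below `t'` the three local facts hold together: the moment bound up to `t₁`, the lower bound
  -- `c` up to `s₁`, and `P[T 0 ≤ t] ≤ q₀`. From `t'` on, the first uniformity statement takes over.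
  obtain ⟨t', hst', ht'⟩ : ∃ t' : ℝ≥0∞, (s₀ : ℝ≥0∞) < t' ∧
      t' < min t₁ (min s₁ (s₀ + 1 / ((n : ℝ≥0) + 1) : ℝ≥0)) := by
    refine exists_between (lt_min (hgt t₁ ht₁) (lt_min (ENNReal.coe_lt_coe.2 hs₁)
      (ENNReal.coe_lt_coe.2 ?_)))
    have : (0 : ℝ≥0) < 1 / ((n : ℝ≥0) + 1) := by positivity
    exact lt_add_of_pos_right _ this
  simp only [lt_min_iff] at ht'
  obtain ⟨ht'1, ht'2, ht'3⟩ := ht'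
  obtain ⟨x₂, hx₂⟩ := part1 t' (hgtΛ t' hst') ε hε
  refine ⟨max x₁ x₂, fun x hx hx0 t ht => ?_⟩
  rcases le_or_gt t' t with htt | htt
  · exact hx₂ x ((le_max_right _ _).trans hx) hx0 t htt
  refine hx₁ x ((le_max_left _ _).trans hx) _ _ (hSm t) ?_ (fun i => hT.measure_le_pow i t) ?_ ?_
    ((hT.mem_renewalSupport_iff).1 ht) ?_
    (measure_discountedClaims_le hA hsum hx0 t)
    (le_measure_discountedClaims hA hX_nonneg hsum hx0 t)
  · exact fun i j hij ω (hω : _ ≤ _) => le_trans (ENNReal.coe_le_coe.2 (hT.monotone ω hij)) hω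
  · exact fun i j hij => setLIntegral_add_le hT hξ hindep haeΛ (half_pos hG.index_pos).le
      ((half_lt_self hG.index_pos).trans hk).le hC (htt.trans ht'1).le hij
  · exact (measure_mono fun ω (hω : _ ≤ _) => hω.trans (htt.trans ht'3).le).trans hn
  · have hB : MeasurableSet {τ : ℕ → ℝ≥0 | (τ 0 : ℝ≥0∞) ≤ t} :=
      (measurable_pi_apply 0 : Measurable fun τ : ℕ → ℝ≥0 => τ 0)
        (measurableSet_le measurable_coe_nnreal_ennreal measurable_const)
    refine le_trans ?_ (setLIntegral_discountFactor hTm hξ hindep hB α 0).ge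
    rw [← setLIntegral_const]
    refine setLIntegral_mono_ae ((measurable_discountMoment hξ α).comp (hTm 0)).aemeasurable ?_
    -- The lower bound `c` holds only to the right of `s₀`, where `T 0` lies almost surely.
    filter_upwards [haegt] with ω hω hωt
    refine hcs₁ ⟨ENNReal.coe_le_coe.1 hω.le, ENNReal.coe_lt_coe.1 ?_⟩
    exact lt_of_le_of_lt hωt (htt.trans ht'2)
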